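/- Let $U,V$ be separable real Banach spaces, $(\Omega,\mathcal A,P)$ a probability space, $T>0$ and $H\in(0,1)\setminus\{\tfrac12\}$. Put $R(s,t)=\tfrac12(s^{2H}+t^{2H}-|s-t|^{2H})$. **Cylindrical notions.** A cylindrical random variable in $V$ is a linear map $Z:V^*\to L^0_P(\Omega;\mathbb R)$ that is continuous for convergence in probability; it is Gaussian if every $Zv^*$ has a (possibly degenerate) Gaussian law, and its covariance operator is $\langle Qu^*,v^*\rangle=E[Zu^*\,Zv^*]-E[Zu^*]E[Zv^*]$. A fractional Brownian motion (fBm) with Hurst parameter $H$ in $\mathbb R^n$ is a Gaussian process $b$ with $E\langle\alpha,b(s)\rangle=0$ and $E[\langle\alpha,b(s)\rangle\langle\beta,b(t)\rangle]=\langle M\alpha,\beta\rangle R(s,t)$ for some matrix $M$; it is standard if $M=\mathrm{Id}$. A cylindrical fBm in $U$ is a family $B=(B(t))_{t\ge0}$ of cylindrical random variables in $U$ such that $(B(t)u_1^*,\dots,B(t)u_n^*)_{t\ge 0}$ is an fBm with Hurst parameter $H$ in $\mathbb R^n$ for all $u_1^*,\dots,u_n^*\in U^*$, $n\in\mathbb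 N$, and such that the covariance operator of $B(1)$ is $U$-valued. **Integrands.** Let $X$ be a Hilbert space with scalar product $[\cdot,\cdot]$. Let $\mathcal E$ be the space of simple functions $f=\sum_{j} x_j\mathbb 1_{[0,r_j)}$ (finite sums, $x_j\in X$, $0<r_j\le T$) with $\langle x\mathbb 1_{[0,r)},y\mathbb 1_{[0,s)}\rangle_{\mathcal M}=[x,y]R(r,s)$. If $H<\tfrac12$, let $\widehat{\mathcal M}_X$ be the completion of $\mathcal E$ in this norm, realised inside $L^2([0,T];X)$: it consists of the $L^2$-limits of $\mathcal M$-Cauchy sequences in $\mathcal E$. If $H>\tfrac12$, let $\widehat{\mathcal M}_X$ be the space of measurable $f:[0,T]\to X$ with $\|f\|_{|\mathcal M|}^2=H(2H-1)\int_0^T\!\int_0^T\|f(s)\|\|f(t)\||s-t|^{2H-2}\,ds\,dt<\infty$. The operator $K^*:\widehat{\mathcal M}_X\to L^2([0,T];X)$ is the continuous extension of $$(K^*f)(t)=\int_t^T f(s)\,\tfrac{\partial\kappa}{\partial s}(s,t)\,ds\ \ (H>\tfrac12),\qquad (K^*f)(t)=f(t)\kappa(T,t)+\int_t^T (f(s)-f(t))\,\tfrac{\partial\kappa}{\partial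 s}(s,t)\,ds\ \ (H<\tfrac12)$$ from $f\in\mathcal E$, where, for $0\le u<t$ and with $\beta$ the Beta function, $\kappa(t,u)=b_Hu^{1/2-H}\int_u^t(r-u)^{H-3/2}r^{H-1/2}\,dr$ with $b_H=\big(H(2H-1)/\beta(2-2H,H-\tfrac12)\big)^{1/2}$ if $H>\tfrac12$, and $\kappa(t,u)=b_H\big((\tfrac tu)^{H-1/2}(t-u)^{H-1/2}-(H-\tfrac12)u^{1/2-H}\int_u^t(r-u)^{H-1/2}r^{H-3/2}\,dr\big)$ with $b_H=\big(2H/((1-2H)\beta(1-2H,H+\tfrac12))\big)^{1/2}$ if $H<\tfrac12$. For a real standard fBm $b$ the Wiener integral $\int_0^T f\,db$, $f\in\widehat{\mathcal M}_{\mathbb R}$, is the continuous extension to $\widehat{\mathcal M}_{\mathbb R}$, with values in $L^2_P$, of $\mathbb 1_{[0,r)}\mapsto b(r)-b(0)$. **Proposition.** Let $B$ be a cylindrical fBm in $U$ with Hurst parameter $H$, represented as $$B(t)u^*=\sum_{k}\langle ie_k,u^*\rangle\,b_k(t)\quad\text{in }L^2_P(\Omega;\mathbb R)\text{ for all }u^*\in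 U^*,\ t\ge0,\tag{1}$$ where $X$ is a Hilbert space with a countable orthonormal basis $(e_k)$, $i:X\to U$ is linear and continuous, and $(b_k)$ are independent real standard fBms with Hurst parameter $H$. Let $\Psi:[0,T]\to\mathcal L(U,V)$ satisfy $\Psi\in\mathcal I$, i.e. $i^*\Psi^*(\cdot)v^*\in\widehat{\mathcal M}_X$ for all $v^*\in V^*$. Then all integrals $\int_0^T\langle\Psi(t)ie_k,v^*\rangle\,db_k(t)$ and all $K^*(i^*\Psi^*(\cdot)v^*)$ are well defined, and for every $v^*\in V^*$ the series $$Z_\Psi v^*:=\sum_k\int_0^T\langle\Psi(t)ie_k,v^*\rangle\,db_k(t)$$ converges in $L^2_P(\Omega;\mathbb R)$. The map $Z_\Psi:V^*\to L^2_P(\Omega;\mathbb R)$ is linear and continuous and defines a Gaussian cylindrical random variable in $V$. Its covariance operator $Q_\Psi:V^*\to V^{**}$ satisfies $Q_\Psi=\Gamma_\Psi\Gamma_\Psi^*$, where $\Gamma_\Psi:L^2([0,T];X)\to V^{**}$ is the bounded linear operator $$\langle\Gamma_\Psi f,v^*\rangle=\int_0^T[K^*(i^*\Psi^*(\cdot)v^*)(t),f(t)]\,dt$$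 and $\Gamma_\Psi^*:V^*\to L^2([0,T];X)$ is its adjoint restricted to $V^*\subseteq V^{***}$. Furthermore $Z_\Psi$ does not depend on the representation (1): for any other representation of $B$ of this form, given by $(X',(e'_k),i',(b'_k))$, the function $\Psi$ again satisfies the integrability condition and the corresponding series converges in $L^2_P$ to the same $Z_\Psi v^*$ for all $v^*\in V^*$. -/

import Mathlib

open MeasureTheory ProbabilityTheory Filter Topology
open scoped NNReal ENNReal InnerProductSpace

namespace CylFBM

noncomputable section

/-! ### Cylindrical random variables -/

/-- A cylindrical random variable in `U`: a linear map `U* → L⁰(Ω)` which is continuous for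
convergence in probability. -/
structure CylRV (U : Type*) [NormedAddCommGroup U] [NormedSpace ℝ U]
    {Ω : Type*} [MeasurableSpace Ω] (P : Measure Ω) where
  /-- The underlying linear map. -/
  toLin : StrongDual ℝ U →ₗ[ℝ] (Ω →ₘ[P] ℝ)
  /-- Continuity into `L⁰` with the topology of convergence in probability. -/
  cont : ∀ u : StrongDual ℝ U, TendstoInMeasure P (fun w => ⇑(toLin w)) (𝓝 u) ⇑(toLin u)

/-- The cylindrical random variable given by a continuous linear map `V* → L²(Ω)`. -/
def CylRV.ofL2 {V : Type*} [NormedAddCommGroup V] [NormedSpace ℝ V]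
    {Ω : Type*} [MeasurableSpace Ω] {P : Measure Ω}
    (Z : StrongDual ℝ V →L[ℝ] Lp ℝ 2 P) : CylRV V P where
  toLin :=
    { toFun := fun v => (Z v : Ω →ₘ[P] ℝ)
      map_add' := fun v w => by rw [map_add]; rfl
      map_smul' := fun c v => by rw [map_smul]; rfl }
  cont := fun u => tendstoInMeasure_of_tendsto_Lp (Z.continuous.tendsto u)

/-- A cylindrical random variable `Z` is Gaussian if all one-dimensional images of its cylindrical
distribution, i.e. the laws of the random variables `Z u*`, are (possibly degenerate) Gaussian
measures on `ℝ`. -/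
def CylRV.IsGaussian {U : Type*} [NormedAddCommGroup U] [NormedSpace ℝ U]
    {Ω : Type*} [MeasurableSpace Ω] {P : Measure Ω} (Z : CylRV U P) : Prop :=
  ∀ u : StrongDual ℝ U, HasGaussianLaw (Z.toLin u) P

/-- `Q : U* → U**` is the covariance operator of `Z`:
`(Q u*) v* = E[(Z u*) (Z v*)] - E[Z u*] E[Z v*]`. -/
def CylRV.HasCovarianceOperator {U : Type*} [NormedAddCommGroup U] [NormedSpace ℝ U]
    {Ω : Type*} [MeasurableSpace Ω] {P : Measure Ω} (Z : CylRV U P)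
    (Q : StrongDual ℝ U →L[ℝ] StrongDual ℝ (StrongDual ℝ U)) : Prop :=
  (∀ u : StrongDual ℝ U, MemLp (Z.toLin u) 2 P) ∧
  ∀ u v : StrongDual ℝ U, Q u v =
    (∫ ω, Z.toLin u ω * Z.toLin v ω ∂P) - (∫ ω, Z.toLin u ω ∂P) * (∫ ω, Z.toLin v ω ∂P)

/-! ### Fractional Brownian motion -/

/-- The covariance function `R(s,t) = (s^{2H} + t^{2H} - |s-t|^{2H}) / 2`. -/
def R (H s t : ℝ) : ℝ := (s ^ (2 * H) + t ^ (2 * H) - |s - t| ^ (2 * H)) / 2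

/-- A real valued standard fractional Brownian motion with Hurst parameter `H`. -/
structure IsStandardFBM {Ω : Type*} [MeasurableSpace Ω] (H : ℝ) (P : Measure Ω)
    (b : ℝ≥0 → Ω → ℝ) : Prop where
  measurable : ∀ t, Measurable (b t)
  gaussian : IsGaussianProcess b P
  mean : ∀ t, ∫ ω, b t ω ∂P = 0
  covariance : ∀ s t, ∫ ω, b s ω * b t ω ∂P = R H s t

/-- A fractional Brownian motion with Hurst parameter `H` in `ℝⁿ`: a Gaussian process with
`E⟨α, b(s)⟩ = 0` and `E[⟨α, b(s)⟩⟨β, b(t)⟩] = ⟨Mα, β⟩ R(s,t)` for some matrix `M`. -/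
def IsFBMVec {Ω : Type*} [MeasurableSpace Ω] (H : ℝ) (P : Measure Ω) {n : ℕ}
    (b : ℝ≥0 → Ω → EuclideanSpace ℝ (Fin n)) : Prop :=
  IsGaussianProcess b P ∧
  (∀ (α : EuclideanSpace ℝ (Fin n)) (s : ℝ≥0), ∫ ω, ⟪α, b s ω⟫_ℝ ∂P = 0) ∧
  ∃ M : Matrix (Fin n) (Fin n) ℝ, ∀ (α β : EuclideanSpace ℝ (Fin n)) (s t : ℝ≥0),
    ∫ ω, ⟪α, b s ω⟫_ℝ * ⟪β, b t ω⟫_ℝ ∂P = ⟪Matrix.toEuclideanLin M α, β⟫_ℝ * R H s t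

/-- A cylindrical process `(B(t) : t ≥ 0)` in `U` is a cylindrical fractional Brownian motion with
Hurst parameter `H` if its finite-dimensional projections are fractional Brownian motions and the
covariance operator of `B(1)` takes values in `U`. -/
structure IsCylindricalFBM {U : Type*} [NormedAddCommGroup U] [NormedSpace ℝ U]
    {Ω : Type*} [MeasurableSpace Ω] {P : Measure Ω} (H : ℝ) (B : ℝ≥0 → CylRV U P) : Prop where
  projections : ∀ (n : ℕ) (u : Fin n → StrongDual ℝ U),
    IsFBMVec H P (fun t ω => WithLp.toLp 2 (fun j => (B t).toLin (u j) ω))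
  covariance : ∃ Q : StrongDual ℝ U → U, ∀ u v : StrongDual ℝ U,
    v (Q u) = ∫ ω, (B 1).toLin u ω * (B 1).toLin v ω ∂P

/-- The series representation `B(t)u* = ∑ₖ ⟨i eₖ, u*⟩ bₖ(t)` in `L²(Ω)` of a cylindrical process
`B`, where `(eₖ)` is an orthonormal basis of the Hilbert space `X`, `i : X → U` is linear and
continuous, and `(bₖ)` is a family of independent standard fractional Brownian motions. The terms
are pairwise orthogonal in `L²(Ω)`, so that convergence does not depend on their order. -/
structure IsSeriesRepresentation {U : Type*} [NormedAddCommGroup U] [NormedSpace ℝ U]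
    {Ω : Type*} [MeasurableSpace Ω] {P : Measure Ω} (H : ℝ) (B : ℝ≥0 → CylRV U P)
    {X : Type*} [NormedAddCommGroup X] [InnerProductSpace ℝ X] {ι : Type*}
    (e : HilbertBasis ι ℝ X) (i : X →L[ℝ] U) (b : ι → ℝ≥0 → Ω → ℝ) : Prop where
  fbm : ∀ k, IsStandardFBM H P (b k)
  indep : iIndepFun (fun k ω (t : ℝ≥0) => b k t ω) P
  series : ∀ (u : StrongDual ℝ U) (t : ℝ≥0),
    Tendsto (fun s : Finset ι =>
      eLpNorm (fun ω => (∑ k ∈ s, u (i (e k)) * b k t ω) - (B t).toLin u ω) 2 P) atTop (𝓝 0)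

/-! ### The kernel `κ` -/

/-- The constant `b_H`. -/
def bConst (H : ℝ) : ℝ :=
  if 1 / 2 < H then √(H * (2 * H - 1) / beta (2 - 2 * H) (H - 1 / 2))
  else √(2 * H / ((1 - 2 * H) * beta (1 - 2 * H) (H + 1 / 2)))

/-- The kernel `κ(t,u)`, `0 ≤ u < t`, of the representation
`R(s,t) = ∫₀^{min(s,t)} κ(s,u) κ(t,u) du`. -/
def kappa (H t u : ℝ) : ℝ :=
  if 1 / 2 < H then
    bConst H * u ^ (1 / 2 - H) * ∫ r in u..t, (r - u) ^ (H - 3 / 2) * r ^ (H - 1 / 2)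
  else
    bConst H * ((t / u) ^ (H - 1 / 2) * (t - u) ^ (H - 1 / 2)
      - (H - 1 / 2) * u ^ (1 / 2 - H) * ∫ r in u..t, (r - u) ^ (H - 1 / 2) * r ^ (H - 3 / 2))

/-! ### Simple functions -/

/-- Lebesgue measure on `[0,T]`. -/
abbrev leb (T : ℝ≥0) : Measure ℝ := volume.restrict (Set.Icc (0 : ℝ) T)

/-- The space of simple functions `∑ᵢ xᵢ 1_{[tᵢ, tᵢ₊₁)}`, `0 = t₀ < ⋯ < tₙ = T`. The functions
`1_{[0,r)}`, `0 < r ≤ T`, are linearly independent and each simple function is a linear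
combination `∑ᵣ xᵣ 1_{[0,r)}` of them, which is stored here as the finitely supported family
`r ↦ xᵣ`. -/
abbrev Simple (T : ℝ≥0) (X : Type*) [NormedAddCommGroup X] : Type _ :=
  Set.Ioc (0 : ℝ≥0) T →₀ X

variable {X : Type*} [NormedAddCommGroup X] [InnerProductSpace ℝ X] {T : ℝ≥0}

/-- The function `∑ᵣ xᵣ 1_{[0,r)}`. -/
def Simple.eval (φ : Simple T X) (t : ℝ) : X :=
  φ.sum fun r x => (Set.Ico (0 : ℝ) (r : ℝ≥0)).indicator (fun _ => x) t

/-- The inner product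
`⟨∑ᵣ xᵣ 1_{[0,r)}, ∑ₛ yₛ 1_{[0,s)}⟩_M = ∑ᵣ ∑ₛ [xᵣ, yₛ] R(r,s)`. -/
def Simple.innerM (H : ℝ) (φ ψ : Simple T X) : ℝ :=
  φ.sum fun r x => ψ.sum fun s y => ⟪x, y⟫_ℝ * R H (r : ℝ≥0) (s : ℝ≥0)

/-- The Wiener integral of a simple function: `∫ 1_{[0,r)} x db = (b(r) - b(0)) x`, extended
linearly. -/
def Simple.wiener {Ω : Type*} (b : ℝ≥0 → Ω → ℝ) (φ : Simple T X) (ω : Ω) : X :=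
  φ.sum fun r x => (b r ω - b 0 ω) • x

/-- The operator `K*` on simple functions. -/
def Simple.kStar (H : ℝ) (φ : Simple T X) (t : ℝ) : X :=
  if 1 / 2 < H then
    ∫ s in t..T, deriv (fun s' => kappa H s' t) s • φ.eval s
  else
    kappa H T t • φ.eval t
      + ∫ s in t..T, deriv (fun s' => kappa H s' t) s • (φ.eval s - φ.eval t)

/-! ### The space of integrands, the operator `K*` and the Wiener integral -/

/-- The square of the norm of `|M|`:
`H(2H-1) ∫₀ᵀ∫₀ᵀ ‖f(s)‖ ‖f(t)‖ |s-t|^{2H-2} ds dt`. -/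
def absMNormSq (H : ℝ) (T : ℝ≥0) (f : ℝ → X) : ℝ≥0∞ :=
  ENNReal.ofReal (H * (2 * H - 1)) *
    ∫⁻ s, ∫⁻ t, ‖f s‖ₑ * ‖f t‖ₑ * ENNReal.ofReal (|s - t| ^ (2 * H - 2)) ∂(leb T) ∂(leb T)

/-- The sequence `(φₙ)` of simple functions approximates the function `f` in the space of
integrands.
* For `H < 1/2` the space is the completion `M` of the simple functions, which consists of
  functions in `L²([0,T];X)`: the sequence is Cauchy for the norm of `M` and `f` is its limit
  in `L²([0,T];X)`.
* For `H > 1/2` the space is `|M|`: the sequence converges to `f` in the norm of `|M|`. -/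
def IsApprox (H : ℝ) (T : ℝ≥0) (f : ℝ → X) (φ : ℕ → Simple T X) : Prop :=
  if 1 / 2 < H then
    Tendsto (fun n => absMNormSq H T (fun t => (φ n).eval t - f t)) atTop (𝓝 0)
  else
    Tendsto (fun p : ℕ × ℕ => (φ p.1 - φ p.2).innerM H (φ p.1 - φ p.2)) atTop (𝓝 0) ∧
    Tendsto (fun n => eLpNorm (fun t => (φ n).eval t - f t) 2 (leb T)) atTop (𝓝 0)

/-- Membership of (the restriction to `[0,T]` of) `f` in the space of integrands: this space is
the completion `M` of the simple functions if `H < 1/2`, and `|M|` if `H > 1/2`. -/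
def MemIntegrand (H : ℝ) (T : ℝ≥0) (f : ℝ → X) : Prop :=
  AEStronglyMeasurable f (leb T) ∧
    if 1 / 2 < H then absMNormSq H T f < ∞ else ∃ φ : ℕ → Simple T X, IsApprox H T f φ

/-- `g = K* f`: the extension of `K*` from simple functions by continuity. -/
def IsKStar (H : ℝ) (T : ℝ≥0) (f : ℝ → X) (g : Lp X 2 (leb T)) : Prop :=
  ∃ φ : ℕ → Simple T X, IsApprox H T f φ ∧
    Tendsto (fun n => eLpNorm (fun t => (φ n).kStar H t - g t) 2 (leb T)) atTop (𝓝 0)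

/-- The operator `K*` from the space of integrands to `L²([0,T];X)`. -/
def kStar (H : ℝ) (T : ℝ≥0) (f : ℝ → X) : Lp X 2 (leb T) :=
  Classical.epsilon (IsKStar H T f)

/-- `ξ = ∫₀ᵀ f db`: the extension of the Wiener integral from simple functions by continuity. -/
def IsWienerIntegral {Ω : Type*} [MeasurableSpace Ω] (H : ℝ) (T : ℝ≥0) (P : Measure Ω)
    (b : ℝ≥0 → Ω → ℝ) (f : ℝ → X) (ξ : Lp X 2 P) : Prop :=
  ∃ φ : ℕ → Simple T X, IsApprox H T f φ ∧
    Tendsto (fun n => eLpNorm (fun ω => (φ n).wiener b ω - ξ ω) 2 P) atTop (𝓝 0)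

/-- The Wiener integral `∫₀ᵀ f db` of an integrand `f`. -/
def wienerIntegral {Ω : Type*} [MeasurableSpace Ω] (H : ℝ) (T : ℝ≥0) (P : Measure Ω)
    (b : ℝ≥0 → Ω → ℝ) (f : ℝ → X) : Lp X 2 P :=
  Classical.epsilon (IsWienerIntegral H T P b f)

/-! ### Operator valued integrands -/

/-- The element `i* Ψ(t)* v*` of `X`, where `X* = X`. -/
def pullback [CompleteSpace X] {U V : Type*} [NormedAddCommGroup U] [NormedSpace ℝ U]
    [NormedAddCommGroup V] [NormedSpace ℝ V] (i : X →L[ℝ] U) (Ψ : ℝ → U →L[ℝ] V)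
    (v : StrongDual ℝ V) (t : ℝ) : X :=
  (InnerProductSpace.toDual ℝ X).symm ((v.comp (Ψ t)).comp i)

/-- The space of integrands `Ψ : [0,T] → L(U,V)` for which each `i* Ψ(·)* v*` is an
`X`-valued integrand. -/
def MemI [CompleteSpace X] {U V : Type*} [NormedAddCommGroup U] [NormedSpace ℝ U]
    [NormedAddCommGroup V] [NormedSpace ℝ V] (H : ℝ) (T : ℝ≥0) (i : X →L[ℝ] U)
    (Ψ : ℝ → U →L[ℝ] V) : Prop :=
  ∀ v : StrongDual ℝ V, MemIntegrand H T (pullback i Ψ v)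

/-- `Γ : L²([0,T];X) → V**` is the operator with
`⟨Γ f, v*⟩ = ∫₀ᵀ [K*(i* Ψ(·)* v*)(t), f(t)] dt`. -/
def IsGammaOperator [CompleteSpace X] {U V : Type*} [NormedAddCommGroup U] [NormedSpace ℝ U]
    [NormedAddCommGroup V] [NormedSpace ℝ V] (H : ℝ) (T : ℝ≥0) (i : X →L[ℝ] U)
    (Ψ : ℝ → U →L[ℝ] V)
    (Γ : Lp X 2 (leb T) →L[ℝ] StrongDual ℝ (StrongDual ℝ V)) : Prop :=
  ∀ (f : Lp X 2 (leb T)) (v : StrongDual ℝ V),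
    Γ f v = ∫ t, ⟪kStar H T (pullback i Ψ v) t, f t⟫_ℝ ∂(leb T)

/-- For a Hilbert space `E` and `Γ : E → V**`, the restriction to `V* ⊆ V***` of the adjoint
`Γ* : V*** → E* = E`, i.e. `[Γ* v*, f] = ⟨Γ f, v*⟩`. -/
def adjointOnDual {E V : Type*} [NormedAddCommGroup E] [InnerProductSpace ℝ E] [CompleteSpace E]
    [NormedAddCommGroup V] [NormedSpace ℝ V]
    (Γ : E →L[ℝ] StrongDual ℝ (StrongDual ℝ V)) : StrongDual ℝ V →L[ℝ] E :=
  { toFun := fun v => (InnerProductSpace.toDual ℝ E).symm (Γ.flip v)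
    map_add' := fun v w => by simp
    map_smul' := fun c v => by simp
    cont := (InnerProductSpace.toDual ℝ E).symm.continuous.comp Γ.flip.continuous }

end

end CylFBM

/-! Everything is transported to `L²([0,T];X)`. The kernel factorises the covariance, `R(s,t) = ∫
κ(s,u) κ(t,u) du`, and `K*` sends `x 1_{[0,r)}` to `κ(r,·) 1_{(0,r)} x`; hence `K*` is isometric
from simple functions with the `M` inner product into `L²` (`inner_kOp`). Independent standard fBms
have the same Gram matrix, so `K*(φ eₖ) ↦ ∫ φ dbₖ` extends to a bounded operator `J` into `L²(Ω)`,
isometric on the closed range of `K*`, with centred Gaussian values (`exists_isWienerMap`). The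
`k`-th integral of the series is `J` applied to the `k`-th coordinate of `K*(i*Ψ*v*)`, so the series
converges to `Z v* = J K*(i*Ψ*v*)`, and isometry turns the covariance into `⟪K*(i*Ψ*u*),
K*(i*Ψ*v*)⟫`, which is `ΓΓ*`.

Factorisation (`lintegral_kappa_mul_kappa`). For `H > 1/2`, `κ` is the primitive of a positive `∂κ`,
and a Beta integral gives `∫ ∂κ(v,u) ∂κ(w,u) du = H(2H-1)|v-w|^{2H-2}`. For `H < 1/2`, `κ(·,u)`
decreases to a multiple of `u^{H-1/2}`; writing `κ(t,u)` as this limit plus `∫_t^∞ |∂κ|`, both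
resulting integrals against `κ(s,·)` are explicit. All of this is Tonelli's theorem for nonnegative
functions.

Well-definedness of `K*`. Since `κ(r,rx) = r^{H-1/2} κ(1,x)`, pairing `K*φ` with `t^{m+1} x` gives a
constant times `∫ ⟪φ(t),x⟫ t^{m+H+1/2} dt` (`inner_kOp_powSmul`). This functional is continuous in
`L¹`, where approximating sequences converge, and such moments determine an element of `L²`. So the
limit depends only on the integrand. The same identity closes the graph of `v* ↦ K*(i*Ψ*v*)`, which
makes `Z` and `Γ` bounded (`exists_kStar_clm`).

Independence of the representation. Both isometries send `K*(i*u 1_{[0,r)})` and `K*(i'*u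
1_{[0,r)})` to `B(r)u - B(0)u`. Hence `[i*u,i*v] = [i'*u,i'*v]`, the map `i*u ↦ i'*u` extends to a
bounded `L`, and `L` carries one integrand and its integral to the other
(`IsSeriesRepresentation.memI_and_eq`). -/

namespace CylFBM

/-! ### Beta integrals. -/

section

/-- Writing positive bases as exponentials reduces identities between products of real powers to
linear identities between exponents. -/
lemma exists_eq_exp {x : ℝ} (hx : 0 < x) : ∃ y, x = Real.exp y := ⟨Real.log x, (Real.exp_log hx).symm⟩

lemma setLIntegral_Ioo_scale {r : ℝ} (hr : 0 < r) (f : ℝ → ℝ≥0∞) :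
    ∫⁻ u in Set.Ioo 0 r, f u = ENNReal.ofReal r * ∫⁻ x in Set.Ioo (0 : ℝ) 1, f (r * x) := by
  have him : (fun x : ℝ => r * x) '' Set.Ioo 0 1 = Set.Ioo 0 r := by
    rw [Set.image_mul_left_Ioo hr]; simp
  rw [← him, lintegral_image_eq_lintegral_abs_deriv_mul (f' := fun _ => r) measurableSet_Ioo
    (fun x _ => by simpa using ((hasDerivAt_id x).const_mul r).hasDerivWithinAt)
    (fun x _ y _ h => mul_left_cancel₀ hr.ne' h), abs_of_pos hr,
    lintegral_const_mul' _ _ ENNReal.ofReal_ne_top]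

lemma lintegral_beta {p q : ℝ} (hp : 0 < p) (hq : 0 < q) :
    ∫⁻ x in Set.Ioo (0 : ℝ) 1, ENNReal.ofReal (x ^ (p - 1) * (1 - x) ^ (q - 1))
      = ENNReal.ofReal (beta p q) := by
  have h := lintegral_betaPDF_eq_one hp hq
  have hb := beta_pos hp hq
  rw [lintegral_betaPDF] at h
  have h2 : ∫⁻ x in Set.Ioo (0 : ℝ) 1, ENNReal.ofReal (1 / beta p q * x ^ (p - 1) * (1 - x) ^ (q - 1))
      = ENNReal.ofReal (1 / beta p q) * ∫⁻ x in Set.Ioo (0 : ℝ) 1,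
        ENNReal.ofReal (x ^ (p - 1) * (1 - x) ^ (q - 1)) := by
    rw [← lintegral_const_mul' _ _ ENNReal.ofReal_ne_top]
    congr 1; ext x
    rw [← ENNReal.ofReal_mul (by positivity), mul_assoc]
  rw [h2] at h
  have h3 := congrArg (ENNReal.ofReal (beta p q) * ·) h
  simp only [← mul_assoc, ← ENNReal.ofReal_mul hb.le, mul_one_div_cancel hb.ne', mul_one,
    ENNReal.ofReal_one, one_mul] at h3
  exact h3

/-- The Möbius map `y = x (t - r) / (t - r x)` preserves `(0,1)`. Because the exponent of `t - r x`
is exactly `-(p + q)`, that factor is absorbed by the change of variables and a plain Beta integral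
remains. -/
lemma lintegral_beta_moebius {p q r t : ℝ} (hp : 0 < p) (hq : 0 < q) (hr : 0 < r) (hrt : r < t) :
    ∫⁻ x in Set.Ioo (0 : ℝ) 1,
        ENNReal.ofReal (x ^ (p - 1) * (1 - x) ^ (q - 1) * (t - r * x) ^ (-(p + q)))
      = ENNReal.ofReal (beta p q * (t - r) ^ (-p) * t ^ (-q)) := by
  have ht : 0 < t := hr.trans hrt
  have htr : 0 < t - r := sub_pos.2 hrt
  have hA : ∀ x ∈ Set.Ioo (0 : ℝ) 1, 0 < t - r * x := fun x hx => by nlinarith [hx.1, hx.2]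
  have him : (fun x : ℝ => x * (t - r) / (t - r * x)) '' Set.Ioo 0 1 = Set.Ioo 0 1 := by
    ext y; constructor
    · rintro ⟨x, hx, rfl⟩
      have := hA x hx
      refine ⟨div_pos (mul_pos hx.1 htr) this, (div_lt_one this).2 ?_⟩
      nlinarith [hx.1, hx.2]
    · intro hy
      have h1 : 0 < t - r + r * y := by nlinarith [hy.1]
      -- The preimage comes from solving `y = x (t - r) / (t - r x)` for `x`.
      refine ⟨y * t / (t - r + r * y), ⟨by have := hy.1; positivity, (div_lt_one h1).2 ?_⟩, ?_⟩
      · nlinarith [hy.1, hy.2]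
      · have : t - r * (y * t / (t - r + r * y)) = t * (t - r) / (t - r + r * y) := by
          field_simp; ring
        simp only [this]
        have h2 := h1.ne'
        rw [div_mul_eq_mul_div, div_div_div_cancel_right₀ h2, mul_assoc,
          mul_div_cancel_right₀ _ (by positivity)]
  have key := lintegral_image_eq_lintegral_abs_deriv_mul (s := Set.Ioo (0 : ℝ) 1)
    (f := fun x : ℝ => x * (t - r) / (t - r * x)) (f' := fun x => (t - r) * t / (t - r * x) ^ 2)
    measurableSet_Ioo
    (fun x hx => by
      have h := hA x hx
      have := (((hasDerivAt_id x).mul_const (t - r)).div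
        (((hasDerivAt_id x).const_mul r).const_sub t) h.ne').hasDerivWithinAt (s := Set.Ioo 0 1)
      refine this.congr_deriv ?_
      simp only [id]
      congr 1; ring)
    (fun x hx y hy h => by
      have h1 := hA x hx
      have h2 := hA y hy
      rw [div_eq_div_iff h1.ne' h2.ne'] at h
      have : (t - r) * t * (x - y) = 0 := by linarith
      rcases mul_eq_zero.1 this with h | h
      · exact absurd h (by positivity)
      · linarith)
    (fun y => ENNReal.ofReal (y ^ (p - 1) * (1 - y) ^ (q - 1)))
  rw [him, lintegral_beta hp hq] at key
  rw [mul_assoc, ENNReal.ofReal_mul (beta_pos hp hq).le, key, mul_comm,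
    ← lintegral_const_mul' _ _ ENNReal.ofReal_ne_top]
  refine setLIntegral_congr_fun measurableSet_Ioo fun x hx => ?_
  have h1 := hA x hx
  have h2 : 0 < 1 - x := sub_pos.2 hx.2
  have h3 : 1 - x * (t - r) / (t - r * x) = t * (1 - x) / (t - r * x) := by
    rw [eq_div_iff h1.ne', sub_mul, div_mul_cancel₀ _ h1.ne']; ring
  rw [h3, abs_of_pos (by positivity), ← ENNReal.ofReal_mul (by positivity),
    ← ENNReal.ofReal_mul (by positivity)]
  congr 1
  have h0 := hx.1
  obtain ⟨A, hA⟩ := exists_eq_exp h1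
  obtain ⟨B, hB⟩ := exists_eq_exp htr
  obtain ⟨x', hx'⟩ := exists_eq_exp h0
  obtain ⟨y', hy'⟩ := exists_eq_exp h2
  obtain ⟨t', ht'⟩ := exists_eq_exp ht
  rw [hA, hB, hy', hx', ht']
  simp only [← Real.exp_add, ← Real.exp_sub, ← Real.exp_mul, ← Real.exp_nat_mul]
  congr 1; push_cast; ring

lemma lintegral_beta_scaled {p q r t : ℝ} (hp : 0 < p) (hq : 0 < q) (hr : 0 < r) (hrt : r < t) :
    ∫⁻ u in Set.Ioo (0 : ℝ) r,
        ENNReal.ofReal (u ^ (p - 1) * (r - u) ^ (q - 1) * (t - u) ^ (-(p + q)))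
      = ENNReal.ofReal (beta p q * r ^ (p + q - 1) * (t - r) ^ (-p) * t ^ (-q)) := by
  have h0 : beta p q * r ^ (p + q - 1) * (t - r) ^ (-p) * t ^ (-q)
    = (r * r ^ (p + q - 2)) * (beta p q * (t - r) ^ (-p) * t ^ (-q)) := by
    rw [mul_comm r, ← Real.rpow_add_one hr.ne']; ring_nf
  rw [setLIntegral_Ioo_scale hr, h0, ENNReal.ofReal_mul (by positivity),
    ENNReal.ofReal_mul (p := r) hr.le, ← lintegral_beta_moebius hp hq hr hrt, mul_assoc]
  congr 1
  rw [← lintegral_const_mul' _ _ ENNReal.ofReal_ne_top]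
  refine setLIntegral_congr_fun measurableSet_Ioo fun x hx => ?_
  rw [← ENNReal.ofReal_mul (Real.rpow_nonneg hr.le _)]
  congr 1
  have h2 : 0 < 1 - x := sub_pos.2 hx.2
  rw [show r - r * x = r * (1 - x) by ring, Real.mul_rpow hr.le hx.1.le, Real.mul_rpow hr.le h2.le,
    show p + q - 2 = (p - 1) + (q - 1) by ring, Real.rpow_add hr]
  ring

end

/-! ### The fundamental theorem of calculus for lower integrals and the derivative of `κ`. -/

section

/-- A nonnegative derivative of a continuous function is automatically integrable, so singularities
of `f'` at the endpoints are harmless. Most explicit integrals below are evaluated in this way. -/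
lemma lintegral_Ioo_deriv {f f' : ℝ → ℝ} {a b : ℝ} (hab : a ≤ b)
    (hc : ContinuousOn f (Set.Icc a b)) (hd : ∀ x ∈ Set.Ioo a b, HasDerivAt f (f' x) x)
    (hn : ∀ x ∈ Set.Ioo a b, 0 ≤ f' x) :
    ∫⁻ x in Set.Ioo a b, ENNReal.ofReal (f' x) = ENNReal.ofReal (f b - f a) := by
  have hi := intervalIntegral.integrableOn_deriv_of_nonneg hc hd hn
  rw [← intervalIntegral.integral_eq_sub_of_hasDerivAt_of_le hab hc hd
    ((intervalIntegrable_iff_integrableOn_Ioc_of_le hab).2 hi),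
    intervalIntegral.integral_of_le hab, integral_Ioc_eq_integral_Ioo,
    ofReal_integral_eq_lintegral_ofReal (hi.mono_set Set.Ioo_subset_Ioc_self)
    (ae_restrict_of_forall_mem measurableSet_Ioo hn)]

lemma lintegral_Ioi_deriv {f f' : ℝ → ℝ} {a m : ℝ}
    (hc : ContinuousWithinAt f (Set.Ici a) a) (hd : ∀ x ∈ Set.Ioi a, HasDerivAt f (f' x) x)
    (hn : ∀ x ∈ Set.Ioi a, 0 ≤ f' x) (hm : Tendsto f atTop (𝓝 m)) :
    ∫⁻ x in Set.Ioi a, ENNReal.ofReal (f' x) = ENNReal.ofReal (m - f a) := by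
  have hi := integrableOn_Ioi_deriv_of_nonneg hc hd hn hm
  rw [← integral_Ioi_of_hasDerivAt_of_nonneg hc hd hn hm, ofReal_integral_eq_lintegral_ofReal hi
    (ae_restrict_of_forall_mem measurableSet_Ioi hn)]

lemma intervalIntegrable_sub_rpow_mul_rpow {p u t : ℝ} (hp : -1 < p) (hu : 0 < u) (ht : 0 < t)
    (q : ℝ) : IntervalIntegrable (fun r => (r - u) ^ p * r ^ q) volume u t := by
  refine IntervalIntegrable.mul_continuousOn ?_ ?_
  · simpa using (intervalIntegral.intervalIntegrable_rpow' (a := 0) (b := t - u) hp).comp_sub_right u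
  · intro x hx
    have : 0 < x := lt_of_lt_of_le (lt_min hu ht) hx.1
    exact (Real.continuousAt_rpow_const _ _ (Or.inl this.ne')).continuousWithinAt

/-- The constant in `∂κ/∂s`. -/
noncomputable def dConst (H : ℝ) : ℝ := if 1 / 2 < H then bConst H else bConst H * (H - 1 / 2)

/-- The kernel `u^{1/2-H} (s-u)^{H-3/2} s^{H-1/2}`, to which `∂κ/∂s(s,u)` is proportional. -/
noncomputable def dKer (H s u : ℝ) : ℝ := u ^ (1 / 2 - H) * (s - u) ^ (H - 3 / 2) * s ^ (H - 1 / 2)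

lemma dKer_pos {H s u : ℝ} (hu : 0 < u) (hs : u < s) : 0 < dKer H s u := by
  have := hu.trans hs
  have := sub_pos.2 hs
  unfold dKer; positivity

lemma hasDerivAt_integral_rpow {p u s : ℝ} (hp : -1 < p) (hu : 0 < u) (hs : u < s) (q : ℝ) :
    HasDerivAt (fun t => ∫ r in u..t, (r - u) ^ p * r ^ q) ((s - u) ^ p * s ^ q) s := by
  refine intervalIntegral.integral_hasDerivAt_right
    (intervalIntegrable_sub_rpow_mul_rpow hp hu (hu.trans hs) q) ?_ ?_
  · exact Measurable.stronglyMeasurable (by fun_prop) |>.stronglyMeasurableAtFilter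
  · have h1 : s - u ≠ 0 := (sub_pos.2 hs).ne'
    have h2 : s ≠ 0 := (hu.trans hs).ne'
    exact (((continuousAt_id.sub continuousAt_const).rpow_const (Or.inl h1))).mul
      (continuousAt_id.rpow_const (Or.inl h2))

/-- For `H < 1/2` the derivative of `(t/u)^{H-1/2}` and that of the integral cancel, which leaves
one term of the same shape as for `H > 1/2`, with the additional factor `H - 1/2`. -/
lemma hasDerivAt_kappa {H s u : ℝ} (hH0 : 0 < H) (hu : 0 < u) (hs : u < s) :
    HasDerivAt (fun t => kappa H t u) (dConst H * dKer H s u) s := by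
  unfold dConst dKer kappa
  have hs0 := hu.trans hs
  have hsu := sub_pos.2 hs
  split_ifs with h
  · have := (hasDerivAt_integral_rpow (p := H - 3 / 2) (by linarith) hu hs (H - 1 / 2)).const_mul
      (bConst H * u ^ (1 / 2 - H))
    refine this.congr_deriv ?_
    ring
  · have h1 := (hasDerivAt_integral_rpow (p := H - 1 / 2) (by linarith) hu hs (H - 3 / 2)).const_mul
      ((H - 1 / 2) * u ^ (1 / 2 - H))
    have h2 := ((hasDerivAt_id s).div_const u).rpow_const (p := H - 1 / 2) (Or.inl (div_pos hs0 hu).ne')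
    have h3 := ((hasDerivAt_id s).sub_const u).rpow_const (p := H - 1 / 2) (Or.inl hsu.ne')
    refine (((h2.mul h3).sub h1).const_mul (bConst H)).congr_deriv ?_
    simp only [id]
    rw [mul_assoc (bConst H)]
    congr 1
    have F2 : (s / u) ^ (H - 1 / 2) = s ^ (H - 1 / 2) * u ^ (1 / 2 - H) := by
      rw [Real.div_rpow hs0.le hu.le, div_eq_mul_inv, ← Real.rpow_neg hu.le]; ring_nf
    have F1 : 1 / u * (s / u) ^ (H - 3 / 2) = u ^ (1 / 2 - H) * s ^ (H - 3 / 2) := by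
      rw [Real.div_rpow hs0.le hu.le, show 1 / 2 - H = -(H - 3 / 2) - 1 by ring,
        Real.rpow_sub_one hu.ne', Real.rpow_neg hu.le]; ring
    rw [show H - 1 / 2 - 1 = H - 3 / 2 by ring]
    linear_combination (H - 1 / 2) * (s - u) ^ (H - 1 / 2) * F1
      + (H - 1 / 2) * (s - u) ^ (H - 3 / 2) * F2

end

/-! ### The factorisation of the covariance for `H > 1/2`. -/

section

/-- The absolute value of `∂κ/∂s(s,u)` for `0 < u < s`, extended by zero. -/
noncomputable def dKerE (H s u : ℝ) : ℝ≥0∞ :=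
  {p : ℝ × ℝ | 0 < p.2 ∧ p.2 < p.1}.indicator
    (fun p => ENNReal.ofReal (|dConst H| * dKer H p.1 p.2)) (s, u)

lemma measurable_dKerE (H : ℝ) : Measurable (fun p : ℝ × ℝ => dKerE H p.1 p.2) := by
  have : Measurable (fun p : ℝ × ℝ => ENNReal.ofReal (|dConst H| * dKer H p.1 p.2)) := by
    unfold dKer; fun_prop
  exact this.indicator ((measurableSet_lt measurable_const measurable_snd).inter
    (measurableSet_lt measurable_snd measurable_fst))

lemma dKerE_of_lt {H s u : ℝ} (hu : 0 < u) (hs : u < s) :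
    dKerE H s u = ENNReal.ofReal (|dConst H| * dKer H s u) :=
  Set.indicator_of_mem (s := {p : ℝ × ℝ | 0 < p.2 ∧ p.2 < p.1}) (a := (s, u)) ⟨hu, hs⟩ _

lemma dKerE_of_le {H s u : ℝ} (hs : s ≤ u) : dKerE H s u = 0 :=
  Set.indicator_of_notMem (s := {p : ℝ × ℝ | 0 < p.2 ∧ p.2 < p.1}) (a := (s, u))
    (fun h => absurd h.2 (not_lt.2 hs)) _

lemma dKerE_of_nonpos {H s u : ℝ} (hs : u ≤ 0) : dKerE H s u = 0 :=
  Set.indicator_of_notMem (s := {p : ℝ × ℝ | 0 < p.2 ∧ p.2 < p.1}) (a := (s, u))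
    (fun h => absurd h.1 (not_lt.2 hs)) _

lemma bConst_nonneg (H : ℝ) : 0 ≤ bConst H := by
  unfold bConst; split_ifs <;> exact Real.sqrt_nonneg _

lemma bConst_sq_of_gt {H : ℝ} (hH : 1 / 2 < H) (hH1 : H < 1) :
    bConst H ^ 2 * beta (2 - 2 * H) (H - 1 / 2) = H * (2 * H - 1) := by
  have hb := beta_pos (α := 2 - 2 * H) (β := H - 1 / 2) (by linarith) (by linarith)
  have h1 : 0 ≤ H * (2 * H - 1) := mul_nonneg (by linarith) (by linarith)
  rw [bConst, if_pos hH, Real.sq_sqrt (by positivity), div_mul_cancel₀ _ hb.ne']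

lemma continuousOn_kappa_Icc {H : ℝ} (hH1 : 1 / 2 < H) {u s : ℝ} (hu : 0 < u) (hs : u ≤ s) :
    ContinuousOn (fun t => kappa H t u) (Set.Icc u s) := by
  simp only [kappa, if_pos hH1]
  refine continuousOn_const.mul ?_
  have := intervalIntegral.continuousOn_primitive_interval (μ := volume) (a := u) (b := s)
    (f := fun r => (r - u) ^ (H - 3 / 2) * r ^ (H - 1 / 2)) ?_
  · rwa [Set.uIcc_of_le hs] at this
  · rw [Set.uIcc_of_le hs, integrableOn_Icc_iff_integrableOn_Ioc,
      ← intervalIntegrable_iff_integrableOn_Ioc_of_le hs]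
    exact intervalIntegrable_sub_rpow_mul_rpow (by linarith) hu (hu.trans_le hs) _

lemma ofReal_kappa_of_gt {H s u : ℝ} (hH : 1 / 2 < H) (hu : 0 < u) (hs : u < s) :
    ENNReal.ofReal (kappa H s u) = ∫⁻ v in Set.Ioo 0 s, dKerE H v u := by
  have hd : 0 ≤ dConst H := by rw [dConst, if_pos hH]; exact bConst_nonneg H
  have h0 : ∫⁻ v in Set.Ioo 0 s, dKerE H v u
      = ∫⁻ v in Set.Ioo u s, ENNReal.ofReal (dConst H * dKer H v u) := by
    rw [← lintegral_indicator measurableSet_Ioo, ← lintegral_indicator measurableSet_Ioo]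
    congr 1; ext v
    by_cases hv : u < v
    · by_cases hvs : v < s
      · rw [Set.indicator_of_mem (Set.mem_Ioo.2 ⟨hu.trans hv, hvs⟩), Set.indicator_of_mem (Set.mem_Ioo.2 ⟨hv, hvs⟩),
          dKerE_of_lt hu hv, abs_of_nonneg hd]
      · rw [Set.indicator_of_notMem (fun h => hvs h.2), Set.indicator_of_notMem (fun h => hvs h.2)]
    · rw [Set.indicator_of_notMem (s := Set.Ioo u s) (fun h => hv h.1)]
      simp only [Set.indicator_apply, dKerE_of_le (not_lt.1 hv), ite_self]
  rw [h0, lintegral_Ioo_deriv (f := fun t => kappa H t u) hs.le (continuousOn_kappa_Icc hH hu hs.le)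
    (fun x hx => hasDerivAt_kappa (by linarith) hu hx.1)
    (fun x hx => mul_nonneg hd (dKer_pos hu hx.1).le)]
  simp only [kappa, if_pos hH, intervalIntegral.integral_same, mul_zero, sub_zero]

/-- A Beta integral with `p = 2 - 2H` and `q = H - 1/2`: the powers of `v` and `w` cancel against
those in the kernels, and `bConst` is normalised so that the constant becomes `H(2H-1)`. -/
lemma lintegral_dKerE_mul_of_lt {H v w : ℝ} (hH : 1 / 2 < H) (hH1 : H < 1) (hv : 0 < v)
    (hw : v < w) : ∫⁻ u, dKerE H v u * dKerE H w u
      = ENNReal.ofReal (H * (2 * H - 1) * (w - v) ^ (2 * H - 2)) := by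
  have h0 : ∀ u, dKerE H v u * dKerE H w u = (Set.Ioo 0 v).indicator (fun u =>
      ENNReal.ofReal (bConst H ^ 2 * v ^ (H - 1 / 2) * w ^ (H - 1 / 2)) * ENNReal.ofReal
        (u ^ (2 - 2 * H - 1) * (v - u) ^ (H - 1 / 2 - 1) *
          (w - u) ^ (-(2 - 2 * H + (H - 1 / 2))))) u := by
    intro u
    by_cases hu : 0 < u
    · by_cases huv : u < v
      · have h1 := sub_pos.2 huv
        have h2 := sub_pos.2 (huv.trans hw)
        have h3 := hv.trans hw
        rw [Set.indicator_of_mem (Set.mem_Ioo.2 ⟨hu, huv⟩), dKerE_of_lt hu huv, dKerE_of_lt hu (huv.trans hw),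
          ← ENNReal.ofReal_mul (mul_nonneg (abs_nonneg _) (dKer_pos hu huv).le),
          ← ENNReal.ofReal_mul (by positivity), dConst, if_pos hH,
          abs_of_nonneg (bConst_nonneg H), dKer, dKer,
          show 2 - 2 * H - 1 = (1 / 2 - H) + (1 / 2 - H) by ring, Real.rpow_add hu]
        ring_nf
      · rw [Set.indicator_of_notMem (fun h => huv h.2), dKerE_of_le (not_lt.1 huv), zero_mul]
    · rw [Set.indicator_of_notMem (fun h => hu h.1), dKerE_of_nonpos (not_lt.1 hu), zero_mul]
  have h3 := hv.trans hw
  simp_rw [h0]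
  rw [lintegral_indicator measurableSet_Ioo, lintegral_const_mul' _ _ ENNReal.ofReal_ne_top,
    lintegral_beta_scaled (by linarith) (by linarith) hv hw, ← ENNReal.ofReal_mul (by positivity),
    ← bConst_sq_of_gt hH hH1]
  congr 1
  have e1 : v ^ (H - 1 / 2) * v ^ (2 - 2 * H + (H - 1 / 2) - 1) = 1 := by
    rw [← Real.rpow_add hv]; ring_nf; simp
  have e2 : w ^ (H - 1 / 2) * w ^ (-(H - 1 / 2)) = 1 := by
    rw [← Real.rpow_add h3]; ring_nf; simp
  rw [show -(2 - 2 * H) = 2 * H - 2 by ring]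
  linear_combination (bConst H ^ 2 * beta (2 - 2 * H) (H - 1 / 2) * (w - v) ^ (2 * H - 2)) *
    (w ^ (H - 1 / 2) * w ^ (-(H - 1 / 2)) * e1 + e2)

lemma lintegral_dKerE_mul {H v w : ℝ} (hH : 1 / 2 < H) (hH1 : H < 1) (hv : 0 < v) (hw : 0 < w)
    (hvw : v ≠ w) : ∫⁻ u, dKerE H v u * dKerE H w u
      = ENNReal.ofReal (H * (2 * H - 1)) * ENNReal.ofReal (|v - w| ^ (2 * H - 2)) := by
  have h1 : 0 ≤ H * (2 * H - 1) := mul_nonneg (by linarith) (by linarith)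
  rw [← ENNReal.ofReal_mul h1]
  rcases lt_or_gt_of_ne hvw with h | h
  · rw [lintegral_dKerE_mul_of_lt hH hH1 hv h, abs_sub_comm, abs_of_pos (sub_pos.2 h)]
  · rw [abs_of_pos (sub_pos.2 h), ← lintegral_dKerE_mul_of_lt hH hH1 hw h]
    simp_rw [mul_comm]

/-- Tonelli's theorem for the kernel `∂κ/∂s`. -/
lemma lintegral_mul_dKerE {H : ℝ} (hH : 1 / 2 < H) (hH1 : H < 1) {μ : Measure ℝ} [SFinite μ]
    [NullSingletonClass μ] (hμ : ∀ᵐ s ∂μ, 0 < s) {φ ψ : ℝ → ℝ≥0∞} (hφ : Measurable φ) (hψ : Measurable ψ) :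
    ∫⁻ u, (∫⁻ v, φ v * dKerE H v u ∂μ) * (∫⁻ w, ψ w * dKerE H w u ∂μ)
      = ENNReal.ofReal (H * (2 * H - 1)) *
        ∫⁻ v, ∫⁻ w, φ v * ψ w * ENNReal.ofReal (|v - w| ^ (2 * H - 2)) ∂μ ∂μ := by
  have hm := measurable_dKerE H
  have m1 : Measurable (fun p : ℝ × ℝ => φ p.1 * dKerE H p.1 p.2) :=
    (hφ.comp measurable_fst).mul hm
  have m2 : Measurable (fun p : ℝ × ℝ => ψ p.1 * dKerE H p.1 p.2) :=
    (hψ.comp measurable_fst).mul hm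
  calc ∫⁻ u, (∫⁻ v, φ v * dKerE H v u ∂μ) * (∫⁻ w, ψ w * dKerE H w u ∂μ)
      = ∫⁻ u, ∫⁻ v, ∫⁻ w, (φ v * dKerE H v u) * (ψ w * dKerE H w u) ∂μ ∂μ := by
        congr 1; ext u
        rw [lintegral_lintegral_mul]
        · exact (m1.comp (measurable_id.prodMk measurable_const)).aemeasurable
        · exact (m2.comp (measurable_id.prodMk measurable_const)).aemeasurable
    _ = ∫⁻ v, ∫⁻ w, (∫⁻ u, (φ v * dKerE H v u) * (ψ w * dKerE H w u)) ∂μ ∂μ := by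
        rw [lintegral_lintegral_swap]
        · refine lintegral_congr fun v => ?_
          rw [lintegral_lintegral_swap]
          refine Measurable.aemeasurable ?_
          exact ((m1.comp (measurable_const.prodMk measurable_fst))).mul
            (m2.comp (measurable_snd.prodMk measurable_fst))
        · refine Measurable.aemeasurable ?_
          refine Measurable.lintegral_prod_right' (f := fun q : (ℝ × ℝ) × ℝ =>
            (φ q.1.2 * dKerE H q.1.2 q.1.1) * (ψ q.2 * dKerE H q.2 q.1.1)) ?_
          exact (m1.comp ((measurable_snd.comp measurable_fst).prodMk
            (measurable_fst.comp measurable_fst))).mul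
            (m2.comp (measurable_snd.prodMk (measurable_fst.comp measurable_fst)))
    _ = _ := by
        rw [← lintegral_const_mul' _ _ ENNReal.ofReal_ne_top]
        refine lintegral_congr_ae ?_
        filter_upwards [hμ] with v hv
        rw [← lintegral_const_mul' _ _ ENNReal.ofReal_ne_top]
        refine lintegral_congr_ae ?_
        -- The kernel identity fails on the diagonal, where the integral diverges but `0 ^ (2H-2)`
        -- is `0`; a measure without atoms ignores it.
        have hne : ∀ᵐ w ∂μ, w ≠ v := by
          simp [ae_iff]
        filter_upwards [hμ, hne] with w hw hwv
        have : ∀ u, (φ v * dKerE H v u) * (ψ w * dKerE H w u)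
            = (φ v * ψ w) * (dKerE H v u * dKerE H w u) := fun u => by ring
        simp_rw [this]
        rw [lintegral_const_mul, lintegral_dKerE_mul hH hH1 hv hw hwv.symm]
        · ring
        · exact (hm.comp (measurable_const.prodMk measurable_id)).mul
            (hm.comp (measurable_const.prodMk measurable_id))

lemma lintegral_abs_sub_rpow {H v t : ℝ} (hH : 1 / 2 < H) (hv : 0 < v) (hvt : v < t) :
    ∫⁻ w in Set.Ioo 0 t, ENNReal.ofReal (|v - w| ^ (2 * H - 2))
      = ENNReal.ofReal ((v ^ (2 * H - 1) + (t - v) ^ (2 * H - 1)) / (2 * H - 1)) := by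
  have h1 : 0 < 2 * H - 1 := by linarith
  have hs : Set.Ioo 0 t =ᵐ[volume] (Set.Ioo 0 v ∪ Set.Ioo v t : Set ℝ) := by
    rw [show Set.Ioo 0 t = Set.Ioc 0 v ∪ Set.Ioo v t from (Set.Ioc_union_Ioo_eq_Ioo hv.le hvt).symm]
    exact Ioo_ae_eq_Ioc.symm.union (ae_eq_refl _)
  rw [setLIntegral_congr hs, lintegral_union measurableSet_Ioo
    (Set.disjoint_left.2 fun x hx hy => absurd hx.2 (not_lt.2 hy.1.le))]
  have e1 : ∫⁻ w in Set.Ioo 0 v, ENNReal.ofReal (|v - w| ^ (2 * H - 2))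
      = ENNReal.ofReal (v ^ (2 * H - 1) / (2 * H - 1)) := by
    rw [show v ^ (2 * H - 1) / (2 * H - 1) =
      -((v - v) ^ (2 * H - 1) / (2 * H - 1)) - -((v - 0) ^ (2 * H - 1) / (2 * H - 1)) by
        rw [sub_self, Real.zero_rpow h1.ne', sub_zero]; ring]
    rw [← lintegral_Ioo_deriv (f := fun w => -((v - w) ^ (2 * H - 1) / (2 * H - 1)))
      (f' := fun w => (v - w) ^ (2 * H - 2)) hv.le]
    · refine setLIntegral_congr_fun measurableSet_Ioo fun w hw => ?_
      simp only [abs_of_pos (sub_pos.2 hw.2)]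
    · exact (((continuousOn_const.sub continuousOn_id).rpow_const
        (fun _ _ => Or.inr h1.le)).div_const _).neg
    · intro x hx
      have := ((((hasDerivAt_id x).const_sub v).rpow_const (p := 2 * H - 1)
        (Or.inl (sub_pos.2 hx.2).ne')).div_const (2 * H - 1)).neg
      refine this.congr_deriv ?_
      simp only [id]
      rw [show 2 * H - 1 - 1 = 2 * H - 2 by ring]
      field_simp
    · intro x hx; exact Real.rpow_nonneg (sub_pos.2 hx.2).le _
  have e2 : ∫⁻ w in Set.Ioo v t, ENNReal.ofReal (|v - w| ^ (2 * H - 2))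
      = ENNReal.ofReal ((t - v) ^ (2 * H - 1) / (2 * H - 1)) := by
    rw [show (t - v) ^ (2 * H - 1) / (2 * H - 1) =
      (t - v) ^ (2 * H - 1) / (2 * H - 1) - (v - v) ^ (2 * H - 1) / (2 * H - 1) by
        rw [sub_self, Real.zero_rpow h1.ne']; ring]
    rw [← lintegral_Ioo_deriv (f := fun w => (w - v) ^ (2 * H - 1) / (2 * H - 1))
      (f' := fun w => (w - v) ^ (2 * H - 2)) hvt.le]
    · refine setLIntegral_congr_fun measurableSet_Ioo fun w hw => ?_
      simp only [abs_sub_comm v w, abs_of_pos (sub_pos.2 hw.1)]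
    · exact (((continuousOn_id.sub continuousOn_const).rpow_const
        (fun _ _ => Or.inr h1.le)).div_const _)
    · intro x hx
      have := ((((hasDerivAt_id x).sub_const v).rpow_const (p := 2 * H - 1)
        (Or.inl (sub_pos.2 hx.1).ne')).div_const (2 * H - 1))
      refine this.congr_deriv ?_
      simp only [id]
      rw [show 2 * H - 1 - 1 = 2 * H - 2 by ring]
      field_simp
    · intro x hx; exact Real.rpow_nonneg (sub_pos.2 hx.1).le _
  have := sub_pos.2 hvt
  rw [e1, e2, ← ENNReal.ofReal_add (by positivity) (by positivity), add_div]

/-- Tonelli's identity `lintegral_mul_dKerE` for the weights `1_{(0,s)}` and `1` on `(0,t)`: the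
left side is the integral of `κ(s,·) κ(t,·)`, the right side is `H(2H-1) ∫₀ˢ∫₀ᵗ |v-w|^{2H-2} dw dv`,
which is elementary. -/
lemma lintegral_kappa_mul_of_gt {H s t : ℝ} (hH : 1 / 2 < H) (hH1 : H < 1) (hs : 0 < s)
    (hst : s ≤ t) : ∫⁻ u in Set.Ioo 0 s, ENNReal.ofReal (kappa H s u) * ENNReal.ofReal (kappa H t u)
      = ENNReal.ofReal (R H s t) := by
  have h1 : 0 < 2 * H - 1 := by linarith
  have h2 : 0 < H * (2 * H - 1) := mul_pos (by linarith) h1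
  have ht := hs.trans_le hst
  have key := lintegral_mul_dKerE hH hH1 (μ := volume.restrict (Set.Ioo 0 t))
    (ae_restrict_of_forall_mem measurableSet_Ioo fun x hx => hx.1)
    (φ := (Set.Iio s).indicator 1) (ψ := 1) (measurable_one.indicator measurableSet_Iio)
    measurable_one
  have e0 : ∀ g : ℝ → ℝ≥0∞, ∫⁻ v in Set.Ioo 0 t, (Set.Iio s).indicator 1 v * g v
      = ∫⁻ v in Set.Ioo 0 s, g v := by
    intro g
    have : ∀ v, (Set.Iio s).indicator 1 v * g v = (Set.Iio s).indicator g v := fun v => by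
      by_cases hv : v ∈ Set.Iio s <;> simp [hv]
    simp_rw [this]
    rw [setLIntegral_indicator measurableSet_Iio, Set.inter_comm, Set.Ioo_inter_Iio, min_eq_right hst]
  have e2 : ∀ (v : ℝ) (g : ℝ → ℝ≥0∞), ∫⁻ w in Set.Ioo 0 t, (Set.Iio s).indicator 1 v * g w
      = (Set.Iio s).indicator 1 v * ∫⁻ w in Set.Ioo 0 t, g w := fun v g =>
    lintegral_const_mul' _ _ (by by_cases hv : v ∈ Set.Iio s <;> simp [hv])
  simp only [Pi.one_apply, one_mul, mul_one, e2, e0] at key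
  have e1 : ∫⁻ u in Set.Ioo 0 s, ENNReal.ofReal (kappa H s u) * ENNReal.ofReal (kappa H t u)
      = ∫⁻ u, (∫⁻ v in Set.Ioo 0 s, dKerE H v u) * (∫⁻ w in Set.Ioo 0 t, dKerE H w u) := by
    rw [← lintegral_indicator measurableSet_Ioo]
    congr 1; ext u
    by_cases hu : 0 < u
    · by_cases hus : u < s
      · rw [Set.indicator_of_mem (Set.mem_Ioo.2 ⟨hu, hus⟩), ofReal_kappa_of_gt hH hu hus,
          ofReal_kappa_of_gt hH hu (hus.trans_le hst)]
      · rw [Set.indicator_of_notMem (fun h => hus h.2),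
          setLIntegral_congr_fun measurableSet_Ioo (g := fun _ => 0)
            (fun v hv => dKerE_of_le (hv.2.le.trans (not_lt.1 hus)))]
        simp
    · simp [Set.indicator_of_notMem (fun h : u ∈ Set.Ioo 0 s => hu h.1), dKerE_of_nonpos (not_lt.1 hu)]
  rw [e1, key]
  rw [setLIntegral_congr_fun measurableSet_Ioo
    (fun v hv => lintegral_abs_sub_rpow hH hv.1 (hv.2.trans_le hst))]
  rw [lintegral_Ioo_deriv
    (f := fun v => (v ^ (2 * H) - (t - v) ^ (2 * H)) / (2 * H * (2 * H - 1))) hs.le,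
    ← ENNReal.ofReal_mul h2.le]
  · congr 1
    rw [R, abs_sub_comm, abs_of_nonneg (sub_nonneg.2 hst), Real.zero_rpow (by linarith), sub_zero]
    have h0 : H ≠ 0 := by linarith
    have h3 := h1.ne'
    generalize 2 * H - 1 = D at h3 ⊢
    field_simp
    ring
  · exact (((continuousOn_id).rpow_const (fun _ _ => Or.inr (by linarith))).sub
      ((continuousOn_const.sub continuousOn_id).rpow_const (fun _ _ => Or.inr (by linarith)))).div_const _
  · intro x hx
    have a1 := (hasDerivAt_id x).rpow_const (p := 2 * H) (Or.inl hx.1.ne')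
    have a2 := ((hasDerivAt_id x).const_sub t).rpow_const (p := 2 * H)
      (Or.inl (sub_pos.2 (hx.2.trans_le hst)).ne')
    have h3 := h1.ne'
    refine ((a1.sub a2).div_const (2 * H * (2 * H - 1))).congr_deriv ?_
    have : H ≠ 0 := by linarith
    have h3 := h1.ne'
    simp only [id]
    field_simp
    ring
  · intro x hx
    have := hx.1
    have := sub_pos.2 (hx.2.trans_le hst)
    positivity

end

/-! ### Interchanging integrals over triangles, for `H < 1/2`. -/

section

lemma lintegral_triangle_swap {s : ℝ} {F : ℝ → ℝ → ℝ≥0∞} (hF : Measurable (Function.uncurry F)) :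
    ∫⁻ r in Set.Ioo 0 s, ∫⁻ u in Set.Ioo 0 r, F r u
      = ∫⁻ u in Set.Ioo 0 s, ∫⁻ r in Set.Ioo u s, F r u := by
  let S : Set (ℝ × ℝ) := {p | 0 < p.2 ∧ p.2 < p.1 ∧ p.1 < s}
  have hS : MeasurableSet S := (measurableSet_lt measurable_const measurable_snd).inter
    ((measurableSet_lt measurable_snd measurable_fst).inter
      (measurableSet_lt measurable_fst measurable_const))
  have e1 : ∫⁻ r in Set.Ioo 0 s, ∫⁻ u in Set.Ioo 0 r, F r u
      = ∫⁻ r, ∫⁻ u, S.indicator (Function.uncurry F) (r, u) := by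
    rw [← lintegral_indicator measurableSet_Ioo]
    congr 1; ext r
    by_cases hr : r ∈ Set.Ioo 0 s
    · rw [Set.indicator_of_mem hr, ← lintegral_indicator measurableSet_Ioo]
      congr 1; ext u
      by_cases hu : u ∈ Set.Ioo 0 r
      · rw [Set.indicator_of_mem hu, Set.indicator_of_mem (show (r, u) ∈ S from ⟨hu.1, hu.2, hr.2⟩)]
        rfl
      · rw [Set.indicator_of_notMem hu, Set.indicator_of_notMem (fun h : (r, u) ∈ S => hu ⟨h.1, h.2.1⟩)]
    · rw [Set.indicator_of_notMem hr, ← lintegral_zero (μ := volume) (α := ℝ)]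
      congr 1; ext u
      rw [Set.indicator_of_notMem (fun h : (r, u) ∈ S => hr ⟨h.1.trans h.2.1, h.2.2⟩)]
  have e2 : ∫⁻ u in Set.Ioo 0 s, ∫⁻ r in Set.Ioo u s, F r u
      = ∫⁻ u, ∫⁻ r, S.indicator (Function.uncurry F) (r, u) := by
    rw [← lintegral_indicator measurableSet_Ioo]
    congr 1; ext u
    by_cases hu : u ∈ Set.Ioo 0 s
    · rw [Set.indicator_of_mem hu, ← lintegral_indicator measurableSet_Ioo]
      congr 1; ext r
      by_cases hr : r ∈ Set.Ioo u s
      · rw [Set.indicator_of_mem hr, Set.indicator_of_mem (show (r, u) ∈ S from ⟨hu.1, hr.1, hr.2⟩)]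
        rfl
      · rw [Set.indicator_of_notMem hr, Set.indicator_of_notMem (fun h : (r, u) ∈ S => hr h.2)]
    · rw [Set.indicator_of_notMem hu, ← lintegral_zero (μ := volume) (α := ℝ)]
      congr 1; ext r
      rw [Set.indicator_of_notMem (fun h : (r, u) ∈ S => hu ⟨h.1, h.2.1.trans h.2.2⟩)]
  rw [e1, e2, lintegral_lintegral_swap]
  exact (hF.indicator hS).aemeasurable

/-- After `u = r x` the variable `r` enters only through `r^{3/2-H} (t - r x)^{H-3/2}`, which
vanishes at `r = 0`. Its derivative in `r` contains `(t - r x)^{H-5/2}`, the exponent for which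
`lintegral_beta_moebius` evaluates the integral over `x`. The result displays the integral as a
primitive in `r`, as needed for `lintegral_kappa_mul`. -/
lemma lintegral_beta_eq_lintegral {H r t : ℝ} (hH0 : 0 < H) (hH : H < 1 / 2) (hr : 0 < r)
    (hrt : r < t) :
    ∫⁻ u in Set.Ioo 0 r,
        ENNReal.ofReal (u ^ (1 - 2 * H) * (r - u) ^ (H - 1 / 2) * (t - u) ^ (H - 3 / 2))
      = ∫⁻ v in Set.Ioo 0 r, ENNReal.ofReal ((3 / 2 - H) * beta (2 - 2 * H) (H + 1 / 2) *
          t ^ (1 / 2 - H) * v ^ (1 / 2 - H) * (t - v) ^ (2 * H - 2)) := by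
  have ht := hr.trans hrt
  have e1 : ∀ x ∈ Set.Ioo (0 : ℝ) 1, ENNReal.ofReal r * ENNReal.ofReal ((r * x) ^ (1 - 2 * H) *
      (r - r * x) ^ (H - 1 / 2) * (t - r * x) ^ (H - 3 / 2))
      = ∫⁻ v in Set.Ioo 0 r, ENNReal.ofReal ((3 / 2 - H) * t * v ^ (1 / 2 - H)) * ENNReal.ofReal
        (x ^ (2 - 2 * H - 1) * (1 - x) ^ (H + 1 / 2 - 1) *
          (t - v * x) ^ (-(2 - 2 * H + (H + 1 / 2)))) := by
    intro x hx
    have hx0 := hx.1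
    have h1 : 0 < 1 - x := sub_pos.2 hx.2
    have hA : ∀ v ∈ Set.Icc 0 r, 0 < t - v * x := fun v hv => by nlinarith [hx.1, hx.2, hv.1, hv.2]
    have h2 := hA r ⟨hr.le, le_rfl⟩
    have h3 : (0 : ℝ) < 3 / 2 - H := by linarith
    have e : ENNReal.ofReal r * ENNReal.ofReal ((r * x) ^ (1 - 2 * H) *
      (r - r * x) ^ (H - 1 / 2) * (t - r * x) ^ (H - 3 / 2)) =
      ENNReal.ofReal (x ^ (1 - 2 * H) * (1 - x) ^ (H - 1 / 2) * r ^ (3 / 2 - H) * (t - r * x) ^ (H - 3 / 2)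
        - x ^ (1 - 2 * H) * (1 - x) ^ (H - 1 / 2) * 0 ^ (3 / 2 - H) * (t - 0 * x) ^ (H - 3 / 2)) := by
      rw [← ENNReal.ofReal_mul hr.le]
      congr 1
      rw [Real.zero_rpow h3.ne', show r - r * x = r * (1 - x) by ring, Real.mul_rpow hr.le hx0.le,
        Real.mul_rpow hr.le h1.le, show 3 / 2 - H = 1 + ((1 - 2 * H) + (H - 1 / 2)) by ring,
        Real.rpow_add hr, Real.rpow_add hr, Real.rpow_one]
      ring
    rw [e, ← lintegral_Ioo_deriv (f := fun v => x ^ (1 - 2 * H) * (1 - x) ^ (H - 1 / 2) *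
      v ^ (3 / 2 - H) * (t - v * x) ^ (H - 3 / 2)) (f' := fun v => (3 / 2 - H) * t * v ^ (1 / 2 - H) *
        (x ^ (2 - 2 * H - 1) * (1 - x) ^ (H + 1 / 2 - 1) *
          (t - v * x) ^ (-(2 - 2 * H + (H + 1 / 2))))) hr.le]
    · refine setLIntegral_congr_fun measurableSet_Ioo fun v hv => ?_
      have := hv.1
      rw [← ENNReal.ofReal_mul (by positivity)]
    · refine ContinuousOn.mul (continuousOn_const.mul
        (continuousOn_id.rpow_const fun _ _ => Or.inr h3.le)) ?_
      exact (continuousOn_const.sub (continuousOn_id.mul continuousOn_const)).rpow_const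
        fun v hv => Or.inl (hA v hv).ne'
    · intro v hv
      have h4 := hA v ⟨hv.1.le, hv.2.le⟩
      have a1 := ((hasDerivAt_id v).rpow_const (p := 3 / 2 - H) (Or.inl hv.1.ne')).const_mul
        (x ^ (1 - 2 * H) * (1 - x) ^ (H - 1 / 2))
      have a2 := (((hasDerivAt_id v).mul_const x).const_sub t).rpow_const (p := H - 3 / 2)
        (Or.inl h4.ne')
      refine (a1.mul a2).congr_deriv ?_
      simp only [id]
      rw [show 3 / 2 - H - 1 = 1 / 2 - H by ring, show H - 3 / 2 - 1 = H - 5 / 2 by ring,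
        show 2 - 2 * H - 1 = 1 - 2 * H by ring, show H + 1 / 2 - 1 = H - 1 / 2 by ring,
        show -(2 - 2 * H + (H + 1 / 2)) = H - 5 / 2 by ring,
        show 3 / 2 - H = (1 / 2 - H) + 1 by ring, show H - 3 / 2 = (H - 5 / 2) + 1 by ring,
        Real.rpow_add_one hv.1.ne', Real.rpow_add_one h4.ne']
      ring
    · intro v hv
      have := hv.1
      have h4 := hA v ⟨hv.1.le, hv.2.le⟩
      positivity
  rw [setLIntegral_Ioo_scale hr, ← lintegral_const_mul' _ _ ENNReal.ofReal_ne_top,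
    setLIntegral_congr_fun measurableSet_Ioo e1, lintegral_lintegral_swap]
  · refine setLIntegral_congr_fun measurableSet_Ioo fun v hv => ?_
    have hv0 := hv.1
    have h4 := sub_pos.2 (hv.2.trans hrt)
    have h3 : (0 : ℝ) < 3 / 2 - H := by linarith
    rw [lintegral_const_mul' _ _ ENNReal.ofReal_ne_top, lintegral_beta_moebius (by linarith)
      (by linarith) hv.1 (hv.2.trans hrt), ← ENNReal.ofReal_mul (by positivity)]
    congr 1
    rw [show -(2 - 2 * H) = 2 * H - 2 by ring, show 1 / 2 - H = 1 + -(H + 1 / 2) by ring,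
      Real.rpow_add ht, Real.rpow_one]
    ring
  · exact Measurable.aemeasurable (by fun_prop)

/-- Partial summation: each `m v` receives the total weight `s^{-a} + ∫_v^s a r^{-a-1} dr = v^{-a}`.
-/
lemma lintegral_abel {a s : ℝ} {m : ℝ → ℝ≥0∞} (hm : Measurable m) (ha : 0 < a) (hs : 0 < s) :
    ENNReal.ofReal (s ^ (-a)) * (∫⁻ v in Set.Ioo 0 s, m v) +
      ∫⁻ r in Set.Ioo 0 s, ENNReal.ofReal (a * r ^ (-a - 1)) * ∫⁻ v in Set.Ioo 0 r, m v
      = ∫⁻ v in Set.Ioo 0 s, m v * ENNReal.ofReal (v ^ (-a)) := by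
  simp_rw [← lintegral_const_mul' _ _ ENNReal.ofReal_ne_top]
  rw [lintegral_triangle_swap, ← lintegral_add_left (by fun_prop)]
  · refine setLIntegral_congr_fun measurableSet_Ioo fun v hv => ?_
    have e : ∫⁻ r in Set.Ioo v s, ENNReal.ofReal (a * r ^ (-a - 1)) * m v
        = ENNReal.ofReal (v ^ (-a) - s ^ (-a)) * m v := by
      rw [lintegral_mul_const _ (by fun_prop), show v ^ (-a) - s ^ (-a) = -s ^ (-a) - -v ^ (-a) by ring,
        ← lintegral_Ioo_deriv (f := fun r => - r ^ (-a)) hv.2.le]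
      · exact (continuousOn_id.rpow_const fun x hx => Or.inl (hv.1.trans_le hx.1).ne').neg
      · intro x hx
        refine ((hasDerivAt_id x).rpow_const (p := -a)
          (Or.inl (hv.1.trans hx.1).ne')).neg.congr_deriv ?_
        simp
      · intro x hx
        have := hv.1.trans hx.1
        positivity
    have h1 : s ^ (-a) ≤ v ^ (-a) := Real.rpow_le_rpow_of_nonpos hv.1 hv.2.le (by linarith)
    rw [e, ← add_mul, ← ENNReal.ofReal_add (by positivity) (sub_nonneg.2 h1), add_sub_cancel,
      mul_comm]
  · exact Measurable.mul (by fun_prop) (hm.comp measurable_snd)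

end

/-! ### The factorisation of the covariance for `H < 1/2`. -/

section

lemma bConst_sq_of_lt {H : ℝ} (hH0 : 0 < H) (hH : H < 1 / 2) :
    bConst H ^ 2 * ((1 / 2 - H) * beta (1 - 2 * H) (H + 1 / 2)) = H := by
  have hb := beta_pos (α := 1 - 2 * H) (β := H + 1 / 2) (by linarith) (by linarith)
  have h1 : 0 < 1 - 2 * H := by linarith
  rw [bConst, if_neg (by linarith), Real.sq_sqrt (by positivity),
    show (1 / 2 - H) * beta (1 - 2 * H) (H + 1 / 2) =
      ((1 - 2 * H) * beta (1 - 2 * H) (H + 1 / 2)) / 2 by ring]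
  generalize beta (1 - 2 * H) (H + 1 / 2) = D at hb ⊢
  field_simp

lemma beta_shift {H : ℝ} (hH0 : 0 < H) (hH : H < 1 / 2) :
    (3 / 2 - H) * beta (2 - 2 * H) (H + 1 / 2) = (1 - 2 * H) * beta (1 - 2 * H) (H + 1 / 2) := by
  have h1 : Real.Gamma (2 - 2 * H) = (1 - 2 * H) * Real.Gamma (1 - 2 * H) := by
    rw [← Real.Gamma_add_one (by linarith)]; ring_nf
  have h2 : Real.Gamma (2 - 2 * H + (H + 1 / 2)) = (3 / 2 - H) * Real.Gamma (1 - 2 * H + (H + 1 / 2)) := by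
    rw [show 3 / 2 - H = 1 - 2 * H + (H + 1 / 2) by ring, ← Real.Gamma_add_one (by linarith)]
    ring_nf
  have h3 : 3 / 2 - H ≠ 0 := by linarith
  have h4 := (Real.Gamma_pos_of_pos (s := 1 - 2 * H + (H + 1 / 2)) (by linarith)).ne'
  rw [beta, beta, h1, h2]
  generalize Real.Gamma (1 - 2 * H + (H + 1 / 2)) = D at h4 ⊢
  generalize 3 / 2 - H = E at h3 ⊢
  field_simp

/-- Since `1/2 - H > 0`, both terms of `κ` are nonnegative. In this form `κ(s,·)` is a combination
of the functions `u^{1/2-H} (r-u)^{H-1/2}`, `r ≤ s`, with the weights of `lintegral_abel`. -/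
lemma ofReal_kappa_of_lt {H s u : ℝ} (hH0 : 0 < H) (hH : H < 1 / 2) (hu : 0 < u) (hs : u < s) :
    ENNReal.ofReal (kappa H s u) = ENNReal.ofReal (bConst H) *
      (ENNReal.ofReal (s ^ (H - 1 / 2)) * ENNReal.ofReal (u ^ (1 / 2 - H) * (s - u) ^ (H - 1 / 2)) +
        ∫⁻ r in Set.Ioo u s, ENNReal.ofReal ((1 / 2 - H) * r ^ (H - 3 / 2)) *
          ENNReal.ofReal (u ^ (1 / 2 - H) * (r - u) ^ (H - 1 / 2))) := by
  have hs0 := hu.trans hs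
  have hsu := sub_pos.2 hs
  have ha : 0 < 1 / 2 - H := by linarith
  have F2 : (s / u) ^ (H - 1 / 2) = s ^ (H - 1 / 2) * u ^ (1 / 2 - H) := by
    rw [Real.div_rpow hs0.le hu.le, div_eq_mul_inv, ← Real.rpow_neg hu.le]; ring_nf
  have hi := intervalIntegrable_sub_rpow_mul_rpow (p := H - 1 / 2) (by linarith) hu hs0 (H - 3 / 2)
  rw [intervalIntegrable_iff_integrableOn_Ioc_of_le hs.le, integrableOn_Ioc_iff_integrableOn_Ioo] at hi
  have e : ∫⁻ r in Set.Ioo u s, ENNReal.ofReal ((1 / 2 - H) * r ^ (H - 3 / 2)) *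
          ENNReal.ofReal (u ^ (1 / 2 - H) * (r - u) ^ (H - 1 / 2))
      = ENNReal.ofReal ((1 / 2 - H) * u ^ (1 / 2 - H) *
        ∫ r in u..s, (r - u) ^ (H - 1 / 2) * r ^ (H - 3 / 2)) := by
    rw [intervalIntegral.integral_of_le hs.le, integral_Ioc_eq_integral_Ioo,
      ENNReal.ofReal_mul (by positivity), ofReal_integral_eq_lintegral_ofReal hi,
      ← lintegral_const_mul' _ _ ENNReal.ofReal_ne_top]
    · refine setLIntegral_congr_fun measurableSet_Ioo fun r hr => ?_
      have := hu.trans hr.1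
      rw [← ENNReal.ofReal_mul (by positivity), ← ENNReal.ofReal_mul (by positivity)]
      ring_nf
    · refine ae_restrict_of_forall_mem measurableSet_Ioo fun r hr => ?_
      have := hu.trans hr.1
      have := sub_pos.2 hr.1
      simp only [Pi.zero_apply]
      positivity
  have hn : 0 ≤ ∫ r in u..s, (r - u) ^ (H - 1 / 2) * r ^ (H - 3 / 2) := by
    refine intervalIntegral.integral_nonneg hs.le fun r hr => ?_
    have := hu.trans_le hr.1
    have := sub_nonneg.2 hr.1
    positivity
  rw [e, ← ENNReal.ofReal_mul (by positivity), ← ENNReal.ofReal_add (by positivity) (by positivity),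
    ← ENNReal.ofReal_mul (bConst_nonneg H), kappa, if_neg (by linarith), F2]
  ring_nf

/-- Reduces integration against `κ(s,·)` to integration against the simpler functions `u^{1/2-H}
(r-u)^{H-1/2}`: if the latter yields a primitive of `m` in `r`, partial summation converts the
weights in `κ` into `v^{H-1/2}`. -/
lemma lintegral_kappa_mul {H s : ℝ} (hH0 : 0 < H) (hH : H < 1 / 2) (hs : 0 < s)
    {h m : ℝ → ℝ≥0∞} (hh : Measurable h) (hm : Measurable m)
    (hM : ∀ r ∈ Set.Ioc 0 s, ∫⁻ u in Set.Ioo 0 r,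
      ENNReal.ofReal (u ^ (1 / 2 - H) * (r - u) ^ (H - 1 / 2)) * h u = ∫⁻ v in Set.Ioo 0 r, m v) :
    ∫⁻ u in Set.Ioo 0 s, ENNReal.ofReal (kappa H s u) * h u
      = ENNReal.ofReal (bConst H) * ∫⁻ v in Set.Ioo 0 s, m v * ENNReal.ofReal (v ^ (H - 1 / 2)) := by
  have e0 : ∀ u ∈ Set.Ioo 0 s, ENNReal.ofReal (kappa H s u) * h u = ENNReal.ofReal (bConst H) *
      (ENNReal.ofReal (s ^ (H - 1 / 2)) * (ENNReal.ofReal (u ^ (1 / 2 - H) * (s - u) ^ (H - 1 / 2)) * h u) +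
        ∫⁻ r in Set.Ioo u s, ENNReal.ofReal ((1 / 2 - H) * r ^ (H - 3 / 2)) *
          (ENNReal.ofReal (u ^ (1 / 2 - H) * (r - u) ^ (H - 1 / 2)) * h u)) := by
    intro u hu
    rw [ofReal_kappa_of_lt hH0 hH hu.1 hu.2, mul_assoc, add_mul, mul_assoc, ← lintegral_mul_const _ (by fun_prop)]
    simp_rw [mul_assoc]
  have key := lintegral_abel hm (a := 1 / 2 - H) (by linarith) hs
  rw [setLIntegral_congr_fun measurableSet_Ioo e0, lintegral_const_mul' _ _ ENNReal.ofReal_ne_top,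
    lintegral_add_left (by fun_prop), ← lintegral_triangle_swap (by fun_prop),
    lintegral_const_mul' _ _ ENNReal.ofReal_ne_top, hM s ⟨hs, le_rfl⟩]
  rw [show -(1 / 2 - H) = H - 1 / 2 by ring, show H - 1 / 2 - 1 = H - 3 / 2 by ring] at key
  rw [← key]
  congr 2
  refine setLIntegral_congr_fun measurableSet_Ioo fun r hr => ?_
  rw [lintegral_const_mul' _ _ ENNReal.ofReal_ne_top, hM r ⟨hr.1, hr.2.le⟩]

lemma lintegral_rpow {s p : ℝ} (hs : 0 < s) (hp : -1 < p) :
    ∫⁻ v in Set.Ioo 0 s, ENNReal.ofReal (v ^ p) = ENNReal.ofReal (s ^ (p + 1) / (p + 1)) := by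
  have h1 : 0 < p + 1 := by linarith
  rw [lintegral_Ioo_deriv (f := fun v => v ^ (p + 1) / (p + 1)) hs.le, Real.zero_rpow h1.ne',
    zero_div, sub_zero]
  · exact (continuousOn_id.rpow_const fun _ _ => Or.inr h1.le).div_const _
  · intro x hx
    refine (((hasDerivAt_id x).rpow_const (p := p + 1) (Or.inl hx.1.ne')).div_const _).congr_deriv ?_
    simp only [id, add_sub_cancel_right, one_mul]
    field_simp
  · intro x hx
    exact Real.rpow_nonneg hx.1.le _

/-- The second factor is the limit of `κ(t,u)` as `t → ∞`, see `tendsto_kappa_atTop`. The powers of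
`u` cancel in the hypothesis of `lintegral_kappa_mul`, and reflecting `(0,r)` gives `m`. -/
lemma lintegral_kappa_mul_rpow {H s : ℝ} (hH0 : 0 < H) (hH : H < 1 / 2) (hs : 0 < s) :
    ∫⁻ u in Set.Ioo 0 s, ENNReal.ofReal (kappa H s u) *
        ENNReal.ofReal (bConst H * ((1 / 2 - H) * beta (1 - 2 * H) (H + 1 / 2)) * u ^ (H - 1 / 2))
      = ENNReal.ofReal (s ^ (2 * H) / 2) := by
  set k := bConst H * ((1 / 2 - H) * beta (1 - 2 * H) (H + 1 / 2)) with hk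
  have hk0 : 0 ≤ k := mul_nonneg (bConst_nonneg H) (mul_nonneg (by linarith)
    (beta_pos (by linarith) (by linarith)).le)
  rw [lintegral_kappa_mul hH0 hH hs (m := fun v => ENNReal.ofReal (k * v ^ (H - 1 / 2)))
    (by fun_prop) (by fun_prop)]
  · have e : ∀ v ∈ Set.Ioo 0 s, ENNReal.ofReal (k * v ^ (H - 1 / 2)) *
        ENNReal.ofReal (v ^ (H - 1 / 2)) = ENNReal.ofReal k * ENNReal.ofReal (v ^ (2 * H - 1)) := by
      intro v hv
      have := hv.1
      rw [← ENNReal.ofReal_mul (by positivity), ← ENNReal.ofReal_mul hk0, mul_assoc,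
        ← Real.rpow_add hv.1]
      ring_nf
    rw [setLIntegral_congr_fun measurableSet_Ioo e, lintegral_const_mul' _ _ ENNReal.ofReal_ne_top,
      lintegral_rpow hs (by linarith), ← mul_assoc, ← ENNReal.ofReal_mul (bConst_nonneg H),
      ← ENNReal.ofReal_mul (mul_nonneg (bConst_nonneg H) hk0), hk, ← mul_assoc, ← pow_two,
      bConst_sq_of_lt hH0 hH, sub_add_cancel]
    congr 1
    field_simp
  · intro r hr
    have e : ∀ u ∈ Set.Ioo 0 r, ENNReal.ofReal (u ^ (1 / 2 - H) * (r - u) ^ (H - 1 / 2)) *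
        ENNReal.ofReal (k * u ^ (H - 1 / 2)) = ENNReal.ofReal (k * (r - u) ^ (H - 1 / 2)) := by
      intro u hu
      have := hu.1
      have := sub_pos.2 hu.2
      rw [← ENNReal.ofReal_mul (by positivity)]
      congr 1
      have : u ^ (1 / 2 - H) * u ^ (H - 1 / 2) = 1 := by
        rw [← Real.rpow_add hu.1]; ring_nf; simp
      linear_combination k * (r - u) ^ (H - 1 / 2) * this
    have h1 : 0 < H + 1 / 2 := by linarith
    rw [setLIntegral_congr_fun measurableSet_Ioo e]
    rw [lintegral_Ioo_deriv (f := fun u => -(k * ((r - u) ^ (H + 1 / 2) / (H + 1 / 2)))) hr.1.le,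
      lintegral_Ioo_deriv (f := fun u => (k * (u ^ (H + 1 / 2) / (H + 1 / 2)))) hr.1.le]
    · rw [sub_self, Real.zero_rpow h1.ne', sub_zero]
      congr 1; ring
    · exact continuousOn_const.mul ((continuousOn_id.rpow_const fun _ _ => Or.inr h1.le).div_const _)
    · intro x hx
      refine ((((hasDerivAt_id x).rpow_const (p := H + 1 / 2) (Or.inl hx.1.ne')).div_const
        _).const_mul k).congr_deriv ?_
      simp only [id]
      rw [show H + 1 / 2 - 1 = H - 1 / 2 by ring]
      generalize H + 1 / 2 = D at h1 ⊢
      field_simp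
    · intro x hx
      have := hx.1
      positivity
    · exact (continuousOn_const.mul (((continuousOn_const.sub continuousOn_id).rpow_const
        fun _ _ => Or.inr h1.le).div_const _)).neg
    · intro x hx
      refine (((((hasDerivAt_id x).const_sub r).rpow_const (p := H + 1 / 2)
        (Or.inl (sub_pos.2 hx.2).ne')).div_const _).const_mul k).neg.congr_deriv ?_
      simp only [id]
      rw [show H + 1 / 2 - 1 = H - 1 / 2 by ring]
      generalize H + 1 / 2 = D at h1 ⊢
      field_simp
    · intro x hx
      have := sub_pos.2 hx.2
      positivity

lemma abs_dConst_of_lt {H : ℝ} (hH : H < 1 / 2) : |dConst H| = bConst H * (1 / 2 - H) := by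
  rw [dConst, if_neg (by linarith), abs_mul, abs_of_nonneg (bConst_nonneg H),
    abs_of_neg (by linarith)]
  ring

/-- Here `m` in `lintegral_kappa_mul` is supplied by `lintegral_beta_eq_lintegral`; `beta_shift` and
the normalisation of `bConst` reduce the constant to `H`. -/
lemma lintegral_kappa_mul_dKerE {H s t : ℝ} (hH0 : 0 < H) (hH : H < 1 / 2) (hs : 0 < s)
    (hst : s < t) :
    ∫⁻ u in Set.Ioo 0 s, ENNReal.ofReal (kappa H s u) * dKerE H t u
      = ENNReal.ofReal (H * ((t - s) ^ (2 * H - 1) - t ^ (2 * H - 1))) := by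
  have ht := hs.trans hst
  set C := (3 / 2 - H) * beta (2 - 2 * H) (H + 1 / 2) with hC
  have hC0 : 0 ≤ C := mul_nonneg (by linarith) (beta_pos (by linarith) (by linarith)).le
  have hd : 0 ≤ |dConst H| := abs_nonneg _
  rw [lintegral_kappa_mul hH0 hH hs (h := fun u => dKerE H t u) (m := fun v => ENNReal.ofReal (|dConst H| * C *
    v ^ (1 / 2 - H) * (t - v) ^ (2 * H - 2)))
    ((measurable_dKerE H).comp
      (measurable_const.prodMk measurable_id)) (by fun_prop)]
  · have e : ∀ v ∈ Set.Ioo 0 s, ENNReal.ofReal (|dConst H| * C *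
        v ^ (1 / 2 - H) * (t - v) ^ (2 * H - 2)) * ENNReal.ofReal (v ^ (H - 1 / 2))
        = ENNReal.ofReal (|dConst H| * C * (t - v) ^ (2 * H - 2)) := by
      intro v hv
      have := hv.1
      have := sub_pos.2 (hv.2.trans hst)
      rw [← ENNReal.ofReal_mul (by positivity)]
      congr 1
      have : v ^ (1 / 2 - H) * v ^ (H - 1 / 2) = 1 := by
        rw [← Real.rpow_add hv.1]; ring_nf; simp
      linear_combination |dConst H| * C * (t - v) ^ (2 * H - 2) * this
    rw [setLIntegral_congr_fun measurableSet_Ioo e, lintegral_Ioo_deriv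
      (f := fun v => |dConst H| * C * ((t - v) ^ (2 * H - 1) / (1 - 2 * H))) hs.le,
      ← ENNReal.ofReal_mul (bConst_nonneg H), abs_dConst_of_lt hH, hC, beta_shift hH0 hH, sub_zero]
    · congr 1
      have h1 : 1 - 2 * H ≠ 0 := by linarith
      have := bConst_sq_of_lt hH0 hH
      generalize hD : 1 - 2 * H = D at h1 this ⊢
      generalize beta D (H + 1 / 2) = E at this ⊢
      field_simp
      linear_combination 2 * ((t - s) ^ (2 * H - 1) - t ^ (2 * H - 1)) * this
    · exact continuousOn_const.mul (((continuousOn_const.sub continuousOn_id).rpow_const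
        fun x hx => Or.inl (sub_pos.2 (hx.2.trans_lt hst)).ne').div_const _)
    · intro x hx
      refine (((((hasDerivAt_id x).const_sub t).rpow_const (p := 2 * H - 1)
        (Or.inl (sub_pos.2 (hx.2.trans hst)).ne')).div_const (1 - 2 * H)).const_mul _).congr_deriv ?_
      simp only [id]
      rw [show 2 * H - 1 - 1 = 2 * H - 2 by ring, show 2 * H - 1 = - (1 - 2 * H) by ring]
      have h1 : 1 - 2 * H ≠ 0 := by linarith
      generalize 1 - 2 * H = D at h1 ⊢
      field_simp
    · intro x hx
      have := sub_pos.2 (hx.2.trans hst)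
      positivity
  · intro r hr
    have hrt := hr.2.trans_lt hst
    have e : ∀ u ∈ Set.Ioo 0 r, ENNReal.ofReal (u ^ (1 / 2 - H) * (r - u) ^ (H - 1 / 2)) *
        dKerE H t u = ENNReal.ofReal (|dConst H| * t ^ (H - 1 / 2)) * ENNReal.ofReal
          (u ^ (1 - 2 * H) * (r - u) ^ (H - 1 / 2) * (t - u) ^ (H - 3 / 2)) := by
      intro u hu
      have := hu.1
      have := sub_pos.2 hu.2
      rw [dKerE_of_lt hu.1 (hu.2.trans hrt), ← ENNReal.ofReal_mul (by positivity),
        ← ENNReal.ofReal_mul (by positivity), dKer,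
        show 1 - 2 * H = (1 / 2 - H) + (1 / 2 - H) by ring, Real.rpow_add hu.1]
      ring_nf
    rw [setLIntegral_congr_fun measurableSet_Ioo e, lintegral_const_mul' _ _ ENNReal.ofReal_ne_top,
      lintegral_beta_eq_lintegral hH0 hH hr.1 hrt, ← lintegral_const_mul' _ _ ENNReal.ofReal_ne_top]
    refine setLIntegral_congr_fun measurableSet_Ioo fun v hv => ?_
    rw [← ENNReal.ofReal_mul (by positivity)]
    congr 1
    have : t ^ (1 / 2 - H) * t ^ (H - 1 / 2) = 1 := by
      rw [← Real.rpow_add ht]; ring_nf; simp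
    linear_combination |dConst H| * C * v ^ (1 / 2 - H) * (t - v) ^ (2 * H - 2) * this

/-- The substitution `r = u / x` produces a Beta integral. -/
lemma lintegral_Ioi_beta {H u : ℝ} (hH0 : 0 < H) (hH : H < 1 / 2) (hu : 0 < u) :
    ∫⁻ r in Set.Ioi u, ENNReal.ofReal ((r - u) ^ (H - 1 / 2) * r ^ (H - 3 / 2))
      = ENNReal.ofReal (beta (1 - 2 * H) (H + 1 / 2) * u ^ (2 * H - 1)) := by
  have him : (fun x : ℝ => u / x) '' Set.Ioo 0 1 = Set.Ioi u := by
    ext r; constructor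
    · rintro ⟨x, hx, rfl⟩
      exact (lt_div_iff₀ hx.1).2 (by nlinarith [hx.2])
    · intro hr
      have hr0 : 0 < r := hu.trans hr
      exact ⟨u / r, ⟨by positivity, (div_lt_one hr0).2 hr⟩, by simp only; field_simp⟩
  rw [← him, lintegral_image_eq_lintegral_abs_deriv_mul (f' := fun x => -(u / x ^ 2)) measurableSet_Ioo
    (fun x hx => by
      refine ((hasDerivAt_inv hx.1.ne').const_mul u).hasDerivWithinAt.congr_deriv ?_
      field_simp)
    (fun x hx y hy h => by
      have h1 := hx.1.ne'
      have h2 := hy.1.ne'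
      field_simp at h
      exact h.symm),
    ENNReal.ofReal_mul (beta_pos (by linarith) (by linarith)).le,
    ← lintegral_beta (by linarith) (by linarith), ← lintegral_mul_const _ (by fun_prop)]
  refine setLIntegral_congr_fun measurableSet_Ioo fun x hx => ?_
  have h0 := hx.1
  have h1 := sub_pos.2 hx.2
  rw [abs_neg, abs_of_pos (by positivity), ← ENNReal.ofReal_mul (by positivity),
    ← ENNReal.ofReal_mul (by positivity), show u / x - u = u * (1 - x) / x by field_simp]
  congr 1
  obtain ⟨x', hx'⟩ := exists_eq_exp h0
  obtain ⟨y', hy'⟩ := exists_eq_exp h1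
  obtain ⟨u', hu'⟩ := exists_eq_exp hu
  rw [hy', hx', hu']
  simp only [← Real.exp_add, ← Real.exp_sub, ← Real.exp_mul, ← Real.exp_nat_mul]
  congr 1; push_cast; ring

/-- The first term of `κ` decays because `H - 1/2 < 0`, and the integral converges to a Beta
integral over `(u,∞)`. -/
lemma tendsto_kappa_atTop {H u : ℝ} (hH0 : 0 < H) (hH : H < 1 / 2) (hu : 0 < u) :
    Tendsto (fun t => kappa H t u) atTop
      (𝓝 (bConst H * ((1 / 2 - H) * beta (1 - 2 * H) (H + 1 / 2)) * u ^ (H - 1 / 2))) := by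
  have hn : ∀ r ∈ Set.Ioi u, 0 ≤ (r - u) ^ (H - 1 / 2) * r ^ (H - 3 / 2) := fun r hr => by
    have := hu.trans hr
    have := sub_pos.2 (Set.mem_Ioi.1 hr)
    positivity
  have hb := beta_pos (α := 1 - 2 * H) (β := H + 1 / 2) (by linarith) (by linarith)
  have hm : AEStronglyMeasurable (fun r : ℝ => (r - u) ^ (H - 1 / 2) * r ^ (H - 3 / 2))
      (volume.restrict (Set.Ioi u)) := Measurable.aestronglyMeasurable (by fun_prop)
  have hi : IntegrableOn (fun r : ℝ => (r - u) ^ (H - 1 / 2) * r ^ (H - 3 / 2)) (Set.Ioi u) := by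
    refine (lintegral_ofReal_ne_top_iff_integrable hm
      (ae_restrict_of_forall_mem measurableSet_Ioi hn)).1 ?_
    rw [lintegral_Ioi_beta hH0 hH hu]
    exact ENNReal.ofReal_ne_top
  have hv : ∫ r in Set.Ioi u, (r - u) ^ (H - 1 / 2) * r ^ (H - 3 / 2)
      = beta (1 - 2 * H) (H + 1 / 2) * u ^ (2 * H - 1) := by
    rw [integral_eq_lintegral_of_nonneg_ae (ae_restrict_of_forall_mem measurableSet_Ioi hn) hm,
      lintegral_Ioi_beta hH0 hH hu, ENNReal.toReal_ofReal (by positivity)]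
  have h1 := intervalIntegral_tendsto_integral_Ioi u hi tendsto_id
  rw [hv] at h1
  have h2 : Tendsto (fun t : ℝ => (t / u) ^ (H - 1 / 2) * (t - u) ^ (H - 1 / 2)) atTop (𝓝 (0 * 0)) := by
    have h3 := tendsto_rpow_neg_atTop (y := 1 / 2 - H) (by linarith)
    rw [show -(1 / 2 - H) = H - 1 / 2 by ring] at h3
    exact (h3.comp (tendsto_id.atTop_div_const hu)).mul
      (h3.comp (tendsto_atTop_add_const_right _ (-u) tendsto_id))
  have h4 := (h2.sub (h1.const_mul ((H - 1 / 2) * u ^ (1 / 2 - H)))).const_mul (bConst H)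
  have e : u ^ (H - 1 / 2) = u ^ (1 / 2 - H) * u ^ (2 * H - 1) := by
    rw [← Real.rpow_add hu]; ring_nf
  simp only [kappa, if_neg (show ¬ 1 / 2 < H by linarith)]
  refine (h4.congr fun t => rfl).trans (le_of_eq ?_)
  rw [e]
  congr 1
  ring

/-- As `∂κ` is negative for `H < 1/2`, `κ(·,u)` is recovered from its limit at infinity by adding
the integral of `|∂κ|`. This replaces integration from the diagonal, where `∂κ` is not integrable.
-/
lemma ofReal_kappa_eq_add {H s u : ℝ} (hH0 : 0 < H) (hH : H < 1 / 2) (hu : 0 < u) (hs : u < s) :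
    ENNReal.ofReal (kappa H s u) =
      ENNReal.ofReal (bConst H * ((1 / 2 - H) * beta (1 - 2 * H) (H + 1 / 2)) * u ^ (H - 1 / 2))
        + ∫⁻ v in Set.Ioi s, dKerE H v u := by
  have hb := beta_pos (α := 1 - 2 * H) (β := H + 1 / 2) (by linarith) (by linarith)
  have ha : 0 < 1 / 2 - H := by linarith
  have hb' := bConst_nonneg H
  have hd : |dConst H| = - dConst H := by
    rw [abs_of_nonpos]
    rw [dConst, if_neg (by linarith)]
    exact mul_nonpos_of_nonneg_of_nonpos hb' (by linarith)
  have hc : ContinuousWithinAt (fun t => -kappa H t u) (Set.Ici s) s :=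
    (hasDerivAt_kappa hH0 hu hs).continuousAt.neg.continuousWithinAt
  have hD : ∀ x ∈ Set.Ioi s, HasDerivAt (fun t => -kappa H t u) (|dConst H| * dKer H x u) x :=
    fun x hx => (hasDerivAt_kappa hH0 hu (hs.trans hx)).neg.congr_deriv (by rw [hd]; ring)
  have hn : ∀ x ∈ Set.Ioi s, 0 ≤ |dConst H| * dKer H x u :=
    fun x hx => mul_nonneg (abs_nonneg _) (dKer_pos hu (hs.trans hx)).le
  have hT := (tendsto_kappa_atTop hH0 hH hu).neg
  have h1 := integral_Ioi_of_hasDerivAt_of_nonneg hc hD hn hT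
  have h2 := setIntegral_nonneg measurableSet_Ioi hn (μ := volume)
  rw [h1] at h2
  rw [setLIntegral_congr_fun measurableSet_Ioi (fun v hv => dKerE_of_lt hu (hs.trans hv)),
    lintegral_Ioi_deriv hc hD hn hT, ← ENNReal.ofReal_add (by positivity) h2]
  ring_nf

/-- Bernoulli's inequality for the exponent `2H ≤ 1` bounds the difference by `2H s (t-s)^{2H-1}`.
-/
lemma tendsto_sub_rpow_sub_rpow {H s : ℝ} (hH0 : 0 < H) (hH : H < 1 / 2) (hs : 0 < s) :
    Tendsto (fun t : ℝ => t ^ (2 * H) - (t - s) ^ (2 * H)) atTop (𝓝 0) := by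
  have h3 := tendsto_rpow_neg_atTop (y := 1 - 2 * H) (by linarith)
  have h4 : Tendsto (fun t : ℝ => s * (2 * H) * (t - s) ^ (-(1 - 2 * H))) atTop (𝓝 (s * (2 * H) * 0)) :=
    (h3.comp (tendsto_atTop_add_const_right _ (-s) tendsto_id)).const_mul _
  rw [mul_zero] at h4
  refine squeeze_zero' ?_ ?_ h4
  · filter_upwards [eventually_gt_atTop s] with t ht
    exact sub_nonneg.2 (Real.rpow_le_rpow (sub_pos.2 ht).le (by linarith) (by linarith))
  · filter_upwards [eventually_gt_atTop s] with t ht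
    have ht' := sub_pos.2 ht
    have := rpow_one_add_le_one_add_mul_self (s := s / (t - s)) (p := 2 * H)
      (by have : 0 ≤ s / (t - s) := by positivity
          linarith) (by linarith) (by linarith)
    have e : 1 + s / (t - s) = t / (t - s) := by field_simp; ring
    rw [e, Real.div_rpow (hs.trans ht).le ht'.le, div_le_iff₀ (by positivity)] at this
    have e2 : (t - s) ^ (2 * H) = (t - s) * (t - s) ^ (-(1 - 2 * H)) := by
      rw [show 2 * H = 1 + (-(1 - 2 * H)) by ring, Real.rpow_add ht', Real.rpow_one]
      ring_nf
    calc t ^ (2 * H) - (t - s) ^ (2 * H) ≤ 2 * H * (s / (t - s)) * (t - s) ^ (2 * H) := by linarith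
      _ = s * (2 * H) * (t - s) ^ (-(1 - 2 * H)) := by rw [e2]; field_simp

/-- Expanding `κ(t,u)` by `ofReal_kappa_eq_add`, the limit contributes `s^{2H}/2`, and the integral
of `lintegral_kappa_mul_dKerE` over `(t,∞)` contributes `(t^{2H} - (t-s)^{2H})/2`. -/
lemma lintegral_kappa_mul_of_lt {H s t : ℝ} (hH0 : 0 < H) (hH : H < 1 / 2) (hs : 0 < s)
    (hst : s ≤ t) : ∫⁻ u in Set.Ioo 0 s, ENNReal.ofReal (kappa H s u) * ENNReal.ofReal (kappa H t u)
      = ENNReal.ofReal (R H s t) := by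
  have ht := hs.trans_le hst
  have hm := measurable_dKerE H
  have hmk : AEMeasurable (fun u => ENNReal.ofReal (kappa H s u)) (volume.restrict (Set.Ioo 0 s)) := by
    have : Measurable fun u => ENNReal.ofReal (bConst H * ((1 / 2 - H) * beta (1 - 2 * H) (H + 1 / 2)) * u ^ (H - 1 / 2))
        + ∫⁻ v in Set.Ioi s, dKerE H v u :=
      Measurable.add (by fun_prop) (Measurable.lintegral_prod_left' (f := fun p : ℝ × ℝ => dKerE H p.1 p.2) hm)
    exact ⟨_, this, ae_restrict_of_forall_mem measurableSet_Ioo fun u hu =>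
      ofReal_kappa_eq_add hH0 hH hu.1 hu.2⟩
  have hmk' : AEMeasurable (fun u => ENNReal.ofReal (kappa H s u) * ENNReal.ofReal
      (bConst H * ((1 / 2 - H) * beta (1 - 2 * H) (H + 1 / 2)) * u ^ (H - 1 / 2)))
      (volume.restrict (Set.Ioo 0 s)) := hmk.mul (by fun_prop)
  have e0 : ∀ u ∈ Set.Ioo 0 s, ENNReal.ofReal (kappa H s u) * ENNReal.ofReal (kappa H t u) =
      ENNReal.ofReal (kappa H s u) *
        ENNReal.ofReal (bConst H * ((1 / 2 - H) * beta (1 - 2 * H) (H + 1 / 2)) * u ^ (H - 1 / 2))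
      + ∫⁻ v in Set.Ioi t, ENNReal.ofReal (kappa H s u) * dKerE H v u := by
    intro u hu
    rw [ofReal_kappa_eq_add hH0 hH hu.1 (hu.2.trans_le hst), mul_add,
      lintegral_const_mul' _ _ ENNReal.ofReal_ne_top]
  have h1 := tendsto_sub_rpow_sub_rpow hH0 hH hs
  have hn : ∀ x ∈ Set.Ioi t, 0 ≤ H * ((x - s) ^ (2 * H - 1) - x ^ (2 * H - 1)) := fun x hx =>
    mul_nonneg hH0.le (sub_nonneg.2 (Real.rpow_le_rpow_of_nonpos
      (sub_pos.2 (hst.trans_lt hx)) (by linarith) (by linarith)))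
  rw [setLIntegral_congr_fun measurableSet_Ioo e0, lintegral_add_left' hmk',
    lintegral_kappa_mul_rpow hH0 hH hs, lintegral_lintegral_swap,
    setLIntegral_congr_fun measurableSet_Ioi
      (fun v hv => lintegral_kappa_mul_dKerE hH0 hH hs (hst.trans_lt hv)),
    lintegral_Ioi_deriv (f := fun v => -(v ^ (2 * H) - (v - s) ^ (2 * H)) / 2) (m := -0 / 2),
    ← ENNReal.ofReal_add (by positivity)]
  · congr 1
    rw [R, abs_sub_comm, abs_of_nonneg (sub_nonneg.2 hst)]
    ring
  · have := Real.rpow_le_rpow (z := 2 * H) (sub_nonneg.2 hst) (show t - s ≤ t by linarith) (by linarith)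
    linarith
  · refine ContinuousAt.continuousWithinAt ?_
    exact (((continuousAt_id.rpow_const (Or.inr (by linarith))).sub
      ((continuousAt_id.sub continuousAt_const).rpow_const (Or.inr (by linarith)))).neg).div_const _
  · intro x hx
    have a1 := (hasDerivAt_id x).rpow_const (p := 2 * H) (Or.inl (ht.trans hx).ne')
    have a2 := ((hasDerivAt_id x).sub_const s).rpow_const (p := 2 * H)
      (Or.inl (sub_pos.2 (hst.trans_lt hx)).ne')
    refine ((a1.sub a2).neg.div_const 2).congr_deriv ?_
    simp only [id]
    ring
  · exact hn
  · exact h1.neg.div_const 2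
  · refine AEMeasurable.mul ?_ (hm.comp measurable_swap).aemeasurable
    exact hmk.comp_quasiMeasurePreserving Measure.quasiMeasurePreserving_fst

lemma lintegral_kappa_mul_kappa {H s t : ℝ} (hH0 : 0 < H) (hH1 : H < 1) (hH : H ≠ 1 / 2) (hs : 0 < s)
    (hst : s ≤ t) : ∫⁻ u in Set.Ioo 0 s, ENNReal.ofReal (kappa H s u) * ENNReal.ofReal (kappa H t u)
      = ENNReal.ofReal (R H s t) := by
  rcases lt_or_gt_of_ne hH with h | h
  · exact lintegral_kappa_mul_of_lt hH0 h hs hst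
  · exact lintegral_kappa_mul_of_gt h hH1 hs hst

end

/-! ### The operator `K*` on indicator functions. -/

section

lemma kappa_nonneg {H s u : ℝ} (hu : 0 < u) (hs : u < s) : 0 ≤ kappa H s u := by
  have hs0 := hu.trans hs
  have hsu := sub_pos.2 hs
  have hb := bConst_nonneg H
  have hn : ∀ p q : ℝ, 0 ≤ ∫ r in u..s, (r - u) ^ p * r ^ q := fun p q =>
    intervalIntegral.integral_nonneg hs.le fun r hr => by
      have := hu.trans_le hr.1
      have := sub_nonneg.2 hr.1
      positivity
  unfold kappa
  split_ifs with h
  · have := hn (H - 3 / 2) (H - 1 / 2)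
    positivity
  · have := hn (H - 1 / 2) (H - 3 / 2)
    have h2 : 0 ≤ -(H - 1 / 2) := by linarith
    have : 0 ≤ -(H - 1 / 2) * u ^ (1 / 2 - H) * ∫ r in u..s, (r - u) ^ (H - 1 / 2) * r ^ (H - 3 / 2) := by
      positivity
    refine mul_nonneg hb ?_
    have h3 : 0 ≤ (s / u) ^ (H - 1 / 2) * (s - u) ^ (H - 1 / 2) := by positivity
    linarith

lemma R_comm (H s t : ℝ) : R H s t = R H t s := by
  rw [R, R, abs_sub_comm]; ring

lemma R_nonneg {H s t : ℝ} (hH0 : 0 < H) (hs : 0 ≤ s) (ht : 0 ≤ t) : 0 ≤ R H s t := by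
  wlog hst : s ≤ t generalizing s t
  · rw [R_comm]; exact this ht hs (not_le.1 hst).le
  have := Real.rpow_le_rpow (z := 2 * H) (sub_nonneg.2 hst) (show t - s ≤ t by linarith) (by linarith)
  have h2 : 0 ≤ s ^ (2 * H) := by positivity
  rw [R, abs_sub_comm, abs_of_nonneg (sub_nonneg.2 hst)]
  linarith

/-- The function `K* 1_{[0,r)} = κ(r, ·) 1_{(0,r)}`. -/
noncomputable def kap (H r t : ℝ) : ℝ := (Set.Ioo 0 r).indicator (fun u => kappa H r u) t

lemma kap_nonneg (H r t : ℝ) : 0 ≤ kap H r t :=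
  Set.indicator_nonneg (fun _ hu => kappa_nonneg hu.1 hu.2) _

lemma leb_le (T : ℝ≥0) : leb T ≤ volume := Measure.restrict_le_self

lemma ae_leb_mem (T : ℝ≥0) : ∀ᵐ t ∂(leb T), t ∈ Set.Ioo (0 : ℝ) T := by
  rw [leb, ← Measure.restrict_congr_set (Ioo_ae_eq_Icc (a := (0 : ℝ)) (b := T))]
  exact ae_restrict_mem measurableSet_Ioo

lemma leb_eq (T : ℝ≥0) : leb T = volume.restrict (Set.Ioo (0 : ℝ) T) :=
  (Measure.restrict_congr_set Ioo_ae_eq_Icc).symm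

/-- The indicator function of `[0,r)`. -/
noncomputable def ind (r t : ℝ) : ℝ := (Set.Ico 0 r).indicator 1 t

lemma ind_of_lt {r t : ℝ} (h0 : 0 ≤ t) (h : t < r) : ind r t = 1 :=
  Set.indicator_of_mem (Set.mem_Ico.2 ⟨h0, h⟩) _

lemma ind_of_le {r t : ℝ} (h : r ≤ t) : ind r t = 0 :=
  Set.indicator_of_notMem (fun h' => absurd h'.2 (not_lt.2 h)) _

lemma kap_of_le {H : ℝ} {r t : ℝ} (h : r ≤ t) : kap H r t = 0 :=
  Set.indicator_of_notMem (fun h' => absurd h'.2 (not_lt.2 h)) _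

lemma kap_of_lt {H : ℝ} {r t : ℝ} (h0 : 0 < t) (h : t < r) : kap H r t = kappa H r t :=
  Set.indicator_of_mem (Set.mem_Ioo.2 ⟨h0, h⟩) _

/-- For `t < r` the difference of indicators vanishes on `(t,r)`, so the singularity of `∂κ` at `s =
t` is never met. On `(r,T)` it equals `-1`, and `κ(T,t) - (κ(T,t) - κ(r,t))` remains. -/
lemma kStar_ind_of_lt {H : ℝ} (hH0 : 0 < H) {T r t : ℝ} (hr : r ≤ T) (ht : 0 < t)
    (htT : t < T) :
    IntervalIntegrable (fun s => deriv (fun s' => kappa H s' t) s * (ind r s - ind r t)) volume t T ∧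
      kappa H T t * ind r t + ∫ s in t..T, deriv (fun s' => kappa H s' t) s * (ind r s - ind r t)
        = kap H r t := by
  by_cases htr : t < r
  · have hd : ∀ s ∈ Set.Icc r T, HasDerivAt (fun s' => kappa H s' t) (dConst H * dKer H s t) s :=
      fun s hs => hasDerivAt_kappa hH0 ht (htr.trans_le hs.1)
    have hi : IntervalIntegrable (fun s => dConst H * dKer H s t) volume r T := by
      refine ContinuousOn.intervalIntegrable ?_
      rw [Set.uIcc_of_le hr]
      refine continuousOn_const.mul ((continuousOn_const.mul ?_).mul ?_)
      · exact (continuousOn_id.sub continuousOn_const).rpow_const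
          fun x hx => Or.inl (sub_pos.2 (htr.trans_le hx.1)).ne'
      · exact continuousOn_id.rpow_const fun x hx => Or.inl (ht.trans (htr.trans_le hx.1)).ne'
    have hv : ∫ s in r..T, dConst H * dKer H s t = kappa H T t - kappa H r t :=
      intervalIntegral.integral_eq_sub_of_hasDerivAt
        (fun s hs => hd s (by rwa [Set.uIcc_of_le hr] at hs)) hi
    have e1 : Set.EqOn (fun s => deriv (fun s' => kappa H s' t) s * (ind r s - ind r t))
        (fun _ => 0) (Set.Ioo t r) := by
      intro s hs
      simp only [ind_of_lt (ht.trans hs.1).le hs.2, ind_of_lt ht.le htr, sub_self, mul_zero]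
    have e2 : Set.EqOn (fun s => deriv (fun s' => kappa H s' t) s * (ind r s - ind r t))
        (fun s => -(dConst H * dKer H s t)) (Set.Ioc r T) := by
      intro s hs
      simp only [(hd s ⟨hs.1.le, hs.2⟩).deriv, ind_of_le hs.1.le, ind_of_lt ht.le htr]
      ring
    have i1 : IntervalIntegrable (fun s => deriv (fun s' => kappa H s' t) s * (ind r s - ind r t))
        volume t r := by
      rw [intervalIntegrable_iff_integrableOn_Ioo_of_le htr.le]
      exact integrableOn_zero.congr_fun e1.symm measurableSet_Ioo
    have i2 : IntervalIntegrable (fun s => deriv (fun s' => kappa H s' t) s * (ind r s - ind r t))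
        volume r T := by
      have := hi.neg
      rw [intervalIntegrable_iff_integrableOn_Ioc_of_le hr] at this ⊢
      exact this.congr_fun e2.symm measurableSet_Ioc
    refine ⟨i1.trans i2, ?_⟩
    rw [← intervalIntegral.integral_add_adjacent_intervals i1 i2,
      intervalIntegral.integral_of_le htr.le, integral_Ioc_eq_integral_Ioo,
      setIntegral_congr_fun measurableSet_Ioo e1, intervalIntegral.integral_of_le hr,
      setIntegral_congr_fun measurableSet_Ioc e2, integral_neg,
      ← intervalIntegral.integral_of_le hr, hv, kap_of_lt ht htr, ind_of_lt ht.le htr]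
    simp
  · have hrt := not_lt.1 htr
    have e1 : Set.EqOn (fun s => deriv (fun s' => kappa H s' t) s * (ind r s - ind r t))
        (fun _ => 0) (Set.Ioc t T) := by
      intro s hs
      simp only [ind_of_le hrt, ind_of_le (hrt.trans hs.1.le), sub_self, mul_zero]
    constructor
    · rw [intervalIntegrable_iff_integrableOn_Ioc_of_le htT.le]
      exact integrableOn_zero.congr_fun e1.symm measurableSet_Ioc
    · rw [intervalIntegral.integral_of_le htT.le, setIntegral_congr_fun measurableSet_Ioc e1,
        ind_of_le hrt, kap_of_le hrt]
      simp

/-- For `H > 1/2` the derivative is integrable up to the diagonal, and the boundary value `κ(t,t)`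
is an integral over an empty interval. -/
lemma kStar_ind_of_gt {H : ℝ} (hH1 : 1 / 2 < H) {T r t : ℝ} (hr : r ≤ T) (ht : 0 < t)
    (htT : t < T) :
    IntervalIntegrable (fun s => deriv (fun s' => kappa H s' t) s * ind r s) volume t T ∧
      ∫ s in t..T, deriv (fun s' => kappa H s' t) s * ind r s = kap H r t := by
  have hd0 : 0 ≤ dConst H := by rw [dConst, if_pos hH1]; exact bConst_nonneg H
  by_cases htr : t < r
  · have hd : ∀ s ∈ Set.Ioo t r, HasDerivAt (fun s' => kappa H s' t) (dConst H * dKer H s t) s :=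
      fun s hs => hasDerivAt_kappa (by linarith) ht hs.1
    have hc := continuousOn_kappa_Icc hH1 ht htr.le
    have hi : IntervalIntegrable (fun s => dConst H * dKer H s t) volume t r := by
      rw [intervalIntegrable_iff_integrableOn_Ioc_of_le htr.le]
      exact intervalIntegral.integrableOn_deriv_of_nonneg hc hd
        fun s hs => mul_nonneg hd0 (dKer_pos ht hs.1).le
    have hv : ∫ s in t..r, dConst H * dKer H s t = kappa H r t - kappa H t t :=
      intervalIntegral.integral_eq_sub_of_hasDerivAt_of_le htr.le hc hd hi
    have e1 : Set.EqOn (fun s => deriv (fun s' => kappa H s' t) s * ind r s)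
        (fun s => dConst H * dKer H s t) (Set.Ioo t r) := by
      intro s hs
      simp only [(hd s hs).deriv, ind_of_lt (ht.trans hs.1).le hs.2, mul_one]
    have e2 : Set.EqOn (fun s => deriv (fun s' => kappa H s' t) s * ind r s)
        (fun s => 0) (Set.Ioc r T) := by
      intro s hs
      simp only [ind_of_le hs.1.le, mul_zero]
    have i1 : IntervalIntegrable (fun s => deriv (fun s' => kappa H s' t) s * ind r s)
        volume t r := by
      rw [intervalIntegrable_iff_integrableOn_Ioo_of_le htr.le] at hi ⊢
      exact hi.congr_fun e1.symm measurableSet_Ioo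
    have i2 : IntervalIntegrable (fun s => deriv (fun s' => kappa H s' t) s * ind r s)
        volume r T := by
      rw [intervalIntegrable_iff_integrableOn_Ioc_of_le hr]
      exact integrableOn_zero.congr_fun e2.symm measurableSet_Ioc
    refine ⟨i1.trans i2, ?_⟩
    rw [← intervalIntegral.integral_add_adjacent_intervals i1 i2,
      intervalIntegral.integral_of_le htr.le, integral_Ioc_eq_integral_Ioo,
      setIntegral_congr_fun measurableSet_Ioo e1, intervalIntegral.integral_of_le hr,
      setIntegral_congr_fun measurableSet_Ioc e2, ← integral_Ioc_eq_integral_Ioo,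
      ← intervalIntegral.integral_of_le htr.le, hv, kap_of_lt ht htr, integral_zero, add_zero]
    have : kappa H t t = 0 := by simp only [kappa, if_pos hH1, intervalIntegral.integral_same, mul_zero]
    rw [this, sub_zero]
  · have hrt := not_lt.1 htr
    have e1 : Set.EqOn (fun s => deriv (fun s' => kappa H s' t) s * ind r s)
        (fun _ => 0) (Set.Ioc t T) := by
      intro s hs
      simp only [ind_of_le (hrt.trans hs.1.le), mul_zero]
    constructor
    · rw [intervalIntegrable_iff_integrableOn_Ioc_of_le htT.le]
      exact integrableOn_zero.congr_fun e1.symm measurableSet_Ioc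
    · rw [intervalIntegral.integral_of_le htT.le, setIntegral_congr_fun measurableSet_Ioc e1,
        kap_of_le hrt]
      simp

variable {H : ℝ} [hH : Fact (0 < H ∧ H < 1 ∧ H ≠ 1 / 2)]

/-- Measurability is read off from the representations of `κ` through parameter integrals of the
jointly measurable `dKerE`. -/
lemma aemeasurable_kappa {s : ℝ} :
    AEMeasurable (fun u => kappa H s u) (volume.restrict (Set.Ioo 0 s)) := by
  obtain ⟨hH0, hH1, hH2⟩ := hH.out
  have hm := measurable_dKerE H
  have key : AEMeasurable (fun u => ENNReal.ofReal (kappa H s u)) (volume.restrict (Set.Ioo 0 s)) := by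
    rcases lt_or_gt_of_ne hH2 with h | h
    · have : Measurable fun u => ENNReal.ofReal (bConst H * ((1 / 2 - H) * beta (1 - 2 * H) (H + 1 / 2)) * u ^ (H - 1 / 2))
          + ∫⁻ v in Set.Ioi s, dKerE H v u :=
        Measurable.add (by fun_prop) (Measurable.lintegral_prod_left' (f := fun p : ℝ × ℝ => dKerE H p.1 p.2) hm)
      exact ⟨_, this, ae_restrict_of_forall_mem measurableSet_Ioo fun u hu =>
        ofReal_kappa_eq_add hH0 h hu.1 hu.2⟩
    · exact ⟨_, Measurable.lintegral_prod_left' (f := fun p : ℝ × ℝ => dKerE H p.1 p.2) hm,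
        ae_restrict_of_forall_mem measurableSet_Ioo fun u hu => ofReal_kappa_of_gt h hu.1 hu.2⟩
  refine key.ennreal_toReal.congr (ae_restrict_of_forall_mem measurableSet_Ioo fun u hu => ?_)
  exact ENNReal.toReal_ofReal (kappa_nonneg hu.1 hu.2)

lemma aestronglyMeasurable_kap (r : ℝ) (μ : Measure ℝ) (hμ : μ ≤ volume) :
    AEStronglyMeasurable (kap H r) μ :=
  (((aemeasurable_indicator_iff measurableSet_Ioo).2 aemeasurable_kappa).mono_measure
    hμ).aestronglyMeasurable

lemma lintegral_kap_mul {T : ℝ≥0} {r s : ℝ} (hr : 0 < r) (hrs : r ≤ s) (hs : s ≤ T) :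
    ∫⁻ t, ENNReal.ofReal (kap H r t * kap H s t) ∂(leb T) = ENNReal.ofReal (R H r s) := by
  obtain ⟨hH0, hH1, hH2⟩ := hH.out
  rw [← lintegral_kappa_mul_kappa hH0 hH1 hH2 hr hrs, leb_eq]
  have : ∀ t, ENNReal.ofReal (kap H r t * kap H s t) = (Set.Ioo 0 r).indicator
      (fun u => ENNReal.ofReal (kappa H r u) * ENNReal.ofReal (kappa H s u)) t := by
    intro t
    rw [ENNReal.ofReal_mul (kap_nonneg _ _ _)]
    by_cases ht : t ∈ Set.Ioo 0 r
    · rw [Set.indicator_of_mem ht, kap, kap, Set.indicator_of_mem ht,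
        Set.indicator_of_mem (Set.Ioo_subset_Ioo_right hrs ht)]
    · rw [Set.indicator_of_notMem ht, kap, Set.indicator_of_notMem ht, ENNReal.ofReal_zero, zero_mul]
  simp_rw [this]
  rw [lintegral_indicator measurableSet_Ioo, Measure.restrict_restrict measurableSet_Ioo,
    Set.Ioo_inter_Ioo]
  simp [hrs.trans hs]

lemma integrable_kap_mul {T : ℝ≥0} {r s : ℝ} (hr : 0 < r) (hrT : r ≤ T) (hs : 0 < s) (hsT : s ≤ T) :
    Integrable (fun t => kap H r t * kap H s t) (leb T) ∧
      ∫ t, kap H r t * kap H s t ∂(leb T) = R H r s := by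
  wlog hrs : r ≤ s generalizing r s
  · have := this hs hsT hr hrT (not_le.1 hrs).le
    rw [R_comm]
    simpa only [mul_comm] using this
  have hm : AEStronglyMeasurable (fun t => kap H r t * kap H s t) (leb T) :=
    (aestronglyMeasurable_kap r _ (leb_le T)).mul (aestronglyMeasurable_kap s _ (leb_le T))
  have hn : 0 ≤ᵐ[leb T] fun t => kap H r t * kap H s t :=
    Eventually.of_forall fun t => mul_nonneg (kap_nonneg _ _ _) (kap_nonneg _ _ _)
  have key := lintegral_kap_mul (H := H) hr hrs hsT
  constructor
  · refine (lintegral_ofReal_ne_top_iff_integrable hm hn).1 ?_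
    rw [key]; exact ENNReal.ofReal_ne_top
  · rw [integral_eq_lintegral_of_nonneg_ae hn hm, key,
      ENNReal.toReal_ofReal (R_nonneg hH.out.1 hr.le hs.le)]

lemma memLp_kap {T : ℝ≥0} {r : ℝ} (hr : 0 < r) (hrT : r ≤ T) : MemLp (kap H r) 2 (leb T) := by
  rw [memLp_two_iff_integrable_sq (aestronglyMeasurable_kap r _ (leb_le T))]
  simpa only [pow_two] using (integrable_kap_mul (H := H) hr hrT hr hrT).1

end

/-! ### Simple functions and the isometry `K*`. -/

section

section Simple

variable {X : Type*} [NormedAddCommGroup X] [InnerProductSpace ℝ X] {T : ℝ≥0}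

lemma Simple.eval_eq (φ : Simple T X) (t : ℝ) :
    φ.eval t = φ.sum fun r x => ind ((r : ℝ≥0) : ℝ) t • x := by
  unfold Simple.eval
  refine Finsupp.sum_congr fun r _ => ?_
  by_cases h : t ∈ Set.Ico (0 : ℝ) ((r : ℝ≥0) : ℝ)
  · rw [Set.indicator_of_mem h, ind, Set.indicator_of_mem h, Pi.one_apply, one_smul]
  · rw [Set.indicator_of_notMem h, ind, Set.indicator_of_notMem h, zero_smul]

lemma Simple.le_T (r : Set.Ioc (0 : ℝ≥0) T) : ((r : ℝ≥0) : ℝ) ≤ T := by exact_mod_cast r.2.2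

lemma Simple.pos (r : Set.Ioc (0 : ℝ≥0) T) : 0 < ((r : ℝ≥0) : ℝ) := by exact_mod_cast r.2.1

lemma Simple.kStar_eq [CompleteSpace X] {H : ℝ} (hH0 : 0 < H) (φ : Simple T X) {t : ℝ}
    (ht : t ∈ Set.Ioo (0 : ℝ) T) :
    φ.kStar H t = φ.sum fun r x => kap H ((r : ℝ≥0) : ℝ) t • x := by
  unfold Simple.kStar
  split_ifs with h
  · have e : ∀ s, deriv (fun s' => kappa H s' t) s • φ.eval s
        = ∑ r ∈ φ.support, (deriv (fun s' => kappa H s' t) s * ind ((r : ℝ≥0) : ℝ) s) • φ r := by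
      intro s
      rw [Simple.eval_eq, Finsupp.sum, Finset.smul_sum]
      simp_rw [smul_smul]
    have key := fun r : Set.Ioc (0 : ℝ≥0) T => kStar_ind_of_gt h (Simple.le_T r) ht.1 ht.2
    simp_rw [e]
    rw [intervalIntegral.integral_finsetSum fun r _ => ⟨(key r).1.1.smul_const _, (key r).1.2.smul_const _⟩, Finsupp.sum]
    refine Finset.sum_congr rfl fun r _ => ?_
    rw [intervalIntegral.integral_smul_const, (key r).2]
  · have e : ∀ s, deriv (fun s' => kappa H s' t) s • (φ.eval s - φ.eval t)
        = ∑ r ∈ φ.support, (deriv (fun s' => kappa H s' t) s *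
          (ind ((r : ℝ≥0) : ℝ) s - ind ((r : ℝ≥0) : ℝ) t)) • φ r := by
      intro s
      rw [Simple.eval_eq, Simple.eval_eq, Finsupp.sum, Finsupp.sum, ← Finset.sum_sub_distrib,
        Finset.smul_sum]
      simp_rw [← sub_smul, smul_smul]
    have key := fun r : Set.Ioc (0 : ℝ≥0) T => kStar_ind_of_lt hH0 (Simple.le_T r) ht.1 ht.2
    simp_rw [e]
    rw [intervalIntegral.integral_finsetSum fun r _ => ⟨(key r).1.1.smul_const _, (key r).1.2.smul_const _⟩, Finsupp.sum,
      Simple.eval_eq, Finsupp.sum, Finset.smul_sum, ← Finset.sum_add_distrib]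
    refine Finset.sum_congr rfl fun r _ => ?_
    rw [intervalIntegral.integral_smul_const, smul_smul, ← add_smul, (key r).2]

lemma Simple.eval_add (φ ψ : Simple T X) (t : ℝ) : (φ + ψ).eval t = φ.eval t + ψ.eval t := by
  simp only [Simple.eval_eq]
  exact Finsupp.sum_add_index' (fun _ => smul_zero _) (fun _ _ _ => smul_add _ _ _)

lemma Simple.eval_smul (c : ℝ) (φ : Simple T X) (t : ℝ) : (c • φ).eval t = c • φ.eval t := by
  simp only [Simple.eval_eq]
  rw [Finsupp.sum_smul_index' (fun _ => smul_zero _), Finsupp.smul_sum]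
  exact Finsupp.sum_congr fun r _ => smul_comm _ _ _

lemma Simple.eval_sub (φ ψ : Simple T X) (t : ℝ) : (φ - ψ).eval t = φ.eval t - ψ.eval t := by
  rw [sub_eq_add_neg, ← neg_one_smul ℝ ψ, Simple.eval_add, Simple.eval_smul, neg_one_smul,
    ← sub_eq_add_neg]

/-- The function `K* φ` for a simple function `φ`. -/
noncomputable def Simple.kFun (H : ℝ) (φ : Simple T X) (t : ℝ) : X :=
  φ.sum fun r x => kap H ((r : ℝ≥0) : ℝ) t • x

lemma measurable_ind (r : ℝ) : Measurable (ind r) := measurable_one.indicator measurableSet_Ico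

lemma Simple.stronglyMeasurable_eval (φ : Simple T X) : StronglyMeasurable φ.eval := by
  have : φ.eval = fun t => ∑ r ∈ φ.support, ind ((r : ℝ≥0) : ℝ) t • φ r := by
    ext t; rw [Simple.eval_eq]; rfl
  rw [this]
  exact Finset.stronglyMeasurable_fun_sum _ fun r _ =>
    (measurable_ind _).stronglyMeasurable.smul_const _

lemma Simple.exists_norm_eval_le (φ : Simple T X) : ∃ C, ∀ t, ‖φ.eval t‖ ≤ C := by
  refine ⟨∑ r ∈ φ.support, ‖φ r‖, fun t => ?_⟩
  rw [Simple.eval_eq]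
  refine (norm_sum_le _ _).trans (Finset.sum_le_sum fun r _ => ?_)
  rw [norm_smul]
  refine mul_le_of_le_one_left (norm_nonneg _) ?_
  by_cases h : t ∈ Set.Ico (0 : ℝ) ((r : ℝ≥0) : ℝ)
  · simp [ind, Set.indicator_of_mem h]
  · simp [ind, Set.indicator_of_notMem h]

lemma Simple.memLp_eval (φ : Simple T X) (p : ℝ≥0∞) : MemLp φ.eval p (leb T) := by
  obtain ⟨C, hC⟩ := φ.exists_norm_eval_le
  exact MemLp.of_bound φ.stronglyMeasurable_eval.aestronglyMeasurable C (Eventually.of_forall hC)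

variable {H : ℝ} [hH : Fact (0 < H ∧ H < 1 ∧ H ≠ 1 / 2)]

lemma Simple.memLp_kFun (φ : Simple T X) : MemLp (φ.kFun H) 2 (leb T) := by
  refine memLp_finsetSum _ fun r _ => ?_
  have h := memLp_kap (H := H) (T := T) (Simple.pos r) (Simple.le_T r)
  exact (MemLp.smul (memLp_const (φ r) (p := ∞)) h : MemLp (fun t => kap H _ t • φ r) 2 (leb T))

variable (H X T) in
/-- The operator `K*` on simple functions as a linear map into `L²`. -/
noncomputable def kOp : Simple T X →ₗ[ℝ] Lp X 2 (leb T) where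
  toFun φ := (φ.memLp_kFun (H := H)).toLp
  map_add' φ ψ := by
    rw [← MemLp.toLp_add]
    congr 1; ext t
    exact Finsupp.sum_add_index' (fun _ => smul_zero _) (fun _ _ _ => smul_add _ _ _)
  map_smul' c φ := by
    rw [RingHom.id_apply, ← MemLp.toLp_const_smul]
    congr 1; ext t
    rw [Pi.smul_apply, Simple.kFun, Simple.kFun, Finsupp.sum_smul_index' (fun _ => smul_zero _),
      Finsupp.smul_sum]
    exact Finsupp.sum_congr fun r _ => smul_comm _ _ _

lemma coeFn_kOp (φ : Simple T X) : kOp X T H φ =ᵐ[leb T] φ.kFun H :=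
  MemLp.coeFn_toLp (φ.memLp_kFun (H := H))

lemma Simple.kStar_ae_eq [CompleteSpace X] (φ : Simple T X) : φ.kStar H =ᵐ[leb T] kOp X T H φ := by
  filter_upwards [coeFn_kOp (H := H) φ, ae_leb_mem T] with t h1 h2
  rw [h1, Simple.kStar_eq hH.out.1 φ h2, Simple.kFun]

/-- The factorisation of the covariance, extended bilinearly: completion in the `M` norm becomes
closure in `L²([0,T];X)`. -/
lemma inner_kOp (φ ψ : Simple T X) : ⟪kOp X T H φ, kOp X T H ψ⟫_ℝ = φ.innerM H ψ := by
  have e : ∀ᵐ t ∂(leb T), ⟪kOp X T H φ t, kOp X T H ψ t⟫_ℝ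
      = ∑ r ∈ φ.support, ∑ s ∈ ψ.support, ⟪φ r, ψ s⟫_ℝ * (kap H ((r : ℝ≥0) : ℝ) t * kap H ((s : ℝ≥0) : ℝ) t) := by
    filter_upwards [coeFn_kOp (H := H) φ, coeFn_kOp (H := H) ψ] with t h1 h2
    rw [h1, h2, Simple.kFun, Simple.kFun, Finsupp.sum, Finsupp.sum, sum_inner]
    refine Finset.sum_congr rfl fun r _ => ?_
    rw [inner_sum]
    refine Finset.sum_congr rfl fun s _ => ?_
    rw [real_inner_smul_left, real_inner_smul_right]
    ring
  have key := fun r s : Set.Ioc (0 : ℝ≥0) T => integrable_kap_mul (H := H) (T := T)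
    (Simple.pos r) (Simple.le_T r) (Simple.pos s) (Simple.le_T s)
  rw [L2.inner_def, integral_congr_ae e, integral_finsetSum]
  · refine Finset.sum_congr rfl fun r _ => ?_
    rw [integral_finsetSum]
    · refine Finset.sum_congr rfl fun s _ => ?_
      rw [integral_const_mul, (key r s).2]
    · intro s _
      exact (key r s).1.const_mul _
  · intro r _
    exact integrable_finsetSum _ fun s _ => (key r s).1.const_mul _

end Simple

section Map

variable {X Y : Type*} [NormedAddCommGroup X] [InnerProductSpace ℝ X] [NormedAddCommGroup Y]
  [InnerProductSpace ℝ Y] {T : ℝ≥0}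

/-- Composition of a simple function with a linear operator. -/
noncomputable def Simple.map (L : X →L[ℝ] Y) : Simple T X →ₗ[ℝ] Simple T Y :=
  Finsupp.mapRange.linearMap (L : X →ₗ[ℝ] Y)

lemma Simple.sum_map (L : X →L[ℝ] Y) (φ : Simple T X) (c : Set.Ioc (0 : ℝ≥0) T → ℝ) :
    ((Simple.map L φ).sum fun r y => c r • y) = L (φ.sum fun r x => c r • x) := by
  rw [Simple.map, Finsupp.mapRange.linearMap_apply, Finsupp.sum_mapRange_index (fun _ => smul_zero _)]
  simp [Finsupp.sum, map_sum]

lemma Simple.eval_map (L : X →L[ℝ] Y) (φ : Simple T X) (t : ℝ) :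
    (Simple.map L φ).eval t = L (φ.eval t) := by
  rw [Simple.eval_eq, Simple.eval_eq, Simple.sum_map]

variable {H : ℝ} [hH : Fact (0 < H ∧ H < 1 ∧ H ≠ 1 / 2)]

lemma kOp_map (L : X →L[ℝ] Y) (φ : Simple T X) :
    kOp Y T H (Simple.map L φ) = L.compLp (kOp X T H φ) := by
  refine Lp.ext ?_
  filter_upwards [coeFn_kOp (H := H) φ, coeFn_kOp (H := H) (Simple.map L φ), L.coeFn_compLp (kOp X T H φ)]
    with t h1 h2 h3
  rw [h2, h3, h1, Simple.kFun, Simple.kFun, Simple.sum_map]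

end Map

end

/-! ### Moments of `K* φ` against powers of `t`. -/

section

lemma integral_sub_rpow_mul_rpow_scale {p q r x : ℝ} (hr : 0 < r) (hx0 : 0 < x) (hx : x < 1) :
    ∫ y in (r * x)..r, (y - r * x) ^ p * y ^ q
      = r ^ (p + q + 1) * ∫ y in x..1, (y - x) ^ p * y ^ q := by
  have h := intervalIntegral.mul_integral_comp_mul_left (a := x) (b := 1)
    (f := fun y => (y - r * x) ^ p * y ^ q) r
  rw [mul_one] at h
  rw [← h, ← intervalIntegral.integral_const_mul, ← intervalIntegral.integral_const_mul]
  refine intervalIntegral.integral_congr fun y hy => ?_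
  rw [Set.uIcc_of_le hx.le] at hy
  have hy0 := hx0.trans_le hy.1
  rw [← mul_sub, Real.mul_rpow hr.le (sub_nonneg.2 hy.1), Real.mul_rpow hr.le hy0.le,
    Real.rpow_add hr, Real.rpow_add hr, Real.rpow_one]
  ring

/-- `κ` is homogeneous of degree `H - 1/2`, which makes all its moments pure powers of `r`. -/
lemma kappa_scale {H r x : ℝ} (hr : 0 < r) (hx0 : 0 < x) (hx : x < 1) :
    kappa H r (r * x) = r ^ (H - 1 / 2) * kappa H 1 x := by
  unfold kappa
  have h1 := sub_pos.2 hx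
  split_ifs with h
  · rw [integral_sub_rpow_mul_rpow_scale hr hx0 hx, Real.mul_rpow hr.le hx0.le]
    have e : r ^ (1 / 2 - H) * r ^ (H - 3 / 2 + (H - 1 / 2) + 1) = r ^ (H - 1 / 2) := by
      rw [← Real.rpow_add hr]; ring_nf
    linear_combination bConst H * x ^ (1 / 2 - H) *
      (∫ y in x..1, (y - x) ^ (H - 3 / 2) * y ^ (H - 1 / 2)) * e
  · rw [integral_sub_rpow_mul_rpow_scale hr hx0 hx, Real.mul_rpow hr.le hx0.le,
      show r / (r * x) = 1 / x by field_simp, show r - r * x = r * (1 - x) by ring,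
      Real.mul_rpow hr.le h1.le]
    have e : r ^ (1 / 2 - H) * r ^ (H - 1 / 2 + (H - 3 / 2) + 1) = r ^ (H - 1 / 2) := by
      rw [← Real.rpow_add hr]; ring_nf
    linear_combination - bConst H * (H - 1 / 2) * x ^ (1 / 2 - H) *
      (∫ y in x..1, (y - x) ^ (H - 1 / 2) * y ^ (H - 3 / 2)) * e

/-- Weierstrass approximation extends the vanishing from monomials to all smooth test functions. -/
lemma ae_eq_zero_of_forall_integral_mul_pow {T : ℝ≥0} {h : ℝ → ℝ} (hi : Integrable h (leb T))
    (h0 : ∀ m : ℕ, ∫ t, h t * t ^ m ∂(leb T) = 0) : h =ᵐ[leb T] 0 := by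
  have hb : ∀ {g : ℝ → ℝ} (_ : Continuous g), Integrable (fun t => h t * g t) (leb T) := by
    intro g hg
    have hg' : MemLp g ∞ (leb T) := by
      obtain ⟨C, hC⟩ := isCompact_Icc.exists_bound_of_continuousOn (s := Set.Icc (0 : ℝ) T) hg.continuousOn
      exact memLp_top_of_bound hg.aestronglyMeasurable C
        (ae_restrict_of_forall_mem measurableSet_Icc hC)
    exact hi.mul_of_top_left hg'
  have hp : ∀ p : Polynomial ℝ, ∫ t, h t * p.eval t ∂(leb T) = 0 := by
    intro p
    induction p using Polynomial.induction_on' with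
    | add p q hp hq =>
      simp only [Polynomial.eval_add, mul_add]
      rw [integral_add (hb p.continuous) (hb q.continuous), hp, hq, add_zero]
    | monomial n a =>
      simp only [Polynomial.eval_monomial]
      have : ∀ t : ℝ, h t * (a * t ^ n) = a * (h t * t ^ n) := fun t => by ring
      simp_rw [this]
      rw [integral_const_mul, h0, mul_zero]
  refine ae_eq_zero_of_integral_contDiff_smul_eq_zero hi.locallyIntegrable fun g hg _ => ?_
  have hgc := hg.continuous
  simp_rw [smul_eq_mul, mul_comm (g _)]
  by_contra hne
  set I := ∫ t, ‖h t‖ ∂(leb T) with hI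
  have hI0 : 0 ≤ I := integral_nonneg fun _ => norm_nonneg _
  set J := |∫ t, h t * g t ∂(leb T)| with hJ
  have hJ0 : 0 < J := abs_pos.2 hne
  -- With tolerance `J / (I + 1)` the error is at most `I J / (I + 1) < J`, a contradiction also
  -- when `I = 0`.
  obtain ⟨p, hpp⟩ := exists_polynomial_near_of_continuousOn 0 T g hgc.continuousOn (J / (I + 1))
    (by positivity)
  have e : ∫ t, h t * g t ∂(leb T) = ∫ t, h t * (g t - p.eval t) ∂(leb T) := by
    simp_rw [mul_sub]
    rw [integral_sub (hb hgc) (hb p.continuous), hp, sub_zero]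
  have hle : J ≤ I * (J / (I + 1)) := by
    calc J = ‖∫ t, h t * (g t - p.eval t) ∂(leb T)‖ := by rw [hJ, e, Real.norm_eq_abs]
      _ ≤ ∫ t, ‖h t‖ * (J / (I + 1)) ∂(leb T) := by
        refine norm_integral_le_of_norm_le (hi.norm.mul_const _) ?_
        refine ae_restrict_of_forall_mem measurableSet_Icc fun t ht => ?_
        rw [norm_mul]
        refine mul_le_mul_of_nonneg_left ?_ (norm_nonneg _)
        rw [Real.norm_eq_abs, abs_sub_comm]
        exact (hpp t ht).le
      _ = I * (J / (I + 1)) := integral_mul_const _ _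
  rw [← mul_div_assoc, le_div_iff₀ (by positivity)] at hle
  nlinarith

variable {X : Type*} [NormedAddCommGroup X] [InnerProductSpace ℝ X] {T : ℝ≥0}

lemma memLp_pow_smul (m : ℕ) (x : X) : MemLp (fun t : ℝ => t ^ (m + 1) • x) 2 (leb T) := by
  have hc : Continuous (fun t : ℝ => t ^ (m + 1) • x) := by fun_prop
  obtain ⟨C, hC⟩ := isCompact_Icc.exists_bound_of_continuousOn (s := Set.Icc (0 : ℝ) T) hc.continuousOn
  exact MemLp.of_bound (((continuous_pow (m + 1)).stronglyMeasurable).smul_const x).aestronglyMeasurable C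
    (ae_restrict_of_forall_mem measurableSet_Icc hC)

variable (T) in
/-- The test functions `t ↦ t^{m+1} x`. -/
noncomputable def powSmul (m : ℕ) (x : X) : Lp X 2 (leb T) := (memLp_pow_smul m x).toLp

lemma inner_powSmul (g : Lp X 2 (leb T)) (m : ℕ) (x : X) :
    ⟪g, powSmul T m x⟫_ℝ = ∫ t, ⟪g t, x⟫_ℝ * t ^ (m + 1) ∂(leb T) := by
  rw [L2.inner_def]
  refine integral_congr_ae ?_
  filter_upwards [(memLp_pow_smul (T := T) m x).coeFn_toLp] with t ht
  rw [powSmul, ht, real_inner_smul_right, mul_comm]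

/-- Each coordinate `⟪g, eₖ⟫ t` has vanishing moments of every order, and the factor `t` can be
divided out away from `0`. Countability of the basis merges the null sets. -/
lemma eq_zero_of_forall_inner_powSmul {ι : Type*} [Countable ι] (e : HilbertBasis ι ℝ X)
    {g : Lp X 2 (leb T)} (h : ∀ (m : ℕ) (x : X), ⟪g, powSmul T m x⟫_ℝ = 0) : g = 0 := by
  have hk : ∀ k, ∀ᵐ t ∂(leb T), ⟪e k, g t⟫_ℝ = 0 := by
    intro k
    have hi : Integrable (fun t => ⟪g t, e k⟫_ℝ * t) (leb T) := by
      have h1 := (Lp.memLp g).integrable (by norm_num)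
      have h2 : Integrable (fun t => ⟪g t, e k⟫_ℝ) (leb T) := h1.inner_const (𝕜 := ℝ) (e k)
      refine h2.mul_of_top_left (memLp_top_of_bound (by fun_prop) T ?_)
      refine ae_restrict_of_forall_mem measurableSet_Icc fun t ht => ?_
      rw [Real.norm_eq_abs, abs_of_nonneg ht.1]
      exact ht.2
    have := ae_eq_zero_of_forall_integral_mul_pow hi fun m => by
      rw [← h m (e k), inner_powSmul]
      congr 1; ext t; ring
    filter_upwards [this, ae_leb_mem T] with t h1 h2
    rw [real_inner_comm]
    exact (mul_eq_zero.1 h1).resolve_right h2.1.ne'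
  refine Lp.eq_zero_iff_ae_eq_zero.2 ?_
  filter_upwards [ae_all_iff.2 hk] with t ht
  refine e.repr.injective ?_
  ext k
  rw [e.repr_apply_apply, ht k]
  simp

/-- The constants in the identity `∫ (K* f)(t) t^{m+1} dt = c_m ∫ f(t) t^{m+H+1/2} dt`. -/
noncomputable def momentConst (H : ℝ) (m : ℕ) : ℝ :=
  (m + H + 3 / 2) * ∫ x in (0 : ℝ)..1, kappa H 1 x * x ^ (m + 1)

/-- By homogeneity both integrals are multiples of `r^{m+H+3/2}`, so their ratio does not depend on
`r`. -/
lemma integral_kap_mul_pow {H r : ℝ} (hH0 : 0 < H) (hr : 0 < r) (hrT : r ≤ T) (m : ℕ) :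
    ∫ t, kap H r t * t ^ (m + 1) ∂(leb T)
      = momentConst H m * ∫ t, ind r t * t ^ (m + H + 1 / 2) ∂(leb T) := by
  have h1 : (0 : ℝ) < m + H + 3 / 2 := by positivity
  have e1 : ∫ t, kap H r t * t ^ (m + 1) ∂(leb T) = ∫ t in (0 : ℝ)..r, kappa H r t * t ^ (m + 1) := by
    rw [intervalIntegral.integral_of_le hr.le, integral_Ioc_eq_integral_Ioo, leb_eq]
    have : ∀ t, kap H r t * t ^ (m + 1)
        = (Set.Ioo 0 r).indicator (fun t => kappa H r t * t ^ (m + 1)) t := fun t => by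
      by_cases ht : t ∈ Set.Ioo 0 r
      · rw [kap, Set.indicator_of_mem ht, Set.indicator_of_mem ht]
      · rw [kap, Set.indicator_of_notMem ht, Set.indicator_of_notMem ht, zero_mul]
    simp_rw [this]
    rw [setIntegral_indicator measurableSet_Ioo, Set.Ioo_inter_Ioo]
    simp [hrT]
  have e2 : ∫ t, ind r t * t ^ (m + H + 1 / 2) ∂(leb T) = ∫ t in (0 : ℝ)..r, t ^ (m + H + 1 / 2) := by
    rw [intervalIntegral.integral_of_le hr.le, integral_Ioc_eq_integral_Ioo, leb_eq]
    have : ∀ t ∈ Set.Ioo (0 : ℝ) T, ind r t * t ^ (m + H + 1 / 2)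
        = (Set.Ioo 0 r).indicator (fun t => t ^ (m + H + 1 / 2)) t := fun t ht0 => by
      by_cases ht : t < r
      · rw [ind_of_lt ht0.1.le ht, Set.indicator_of_mem (Set.mem_Ioo.2 ⟨ht0.1, ht⟩), one_mul]
      · rw [ind_of_le (not_lt.1 ht), Set.indicator_of_notMem (fun h => ht h.2), zero_mul]
    rw [setIntegral_congr_fun measurableSet_Ioo this, setIntegral_indicator measurableSet_Ioo,
      Set.Ioo_inter_Ioo]
    simp [hrT]
  have e3 := intervalIntegral.mul_integral_comp_mul_left (a := 0) (b := 1)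
    (f := fun t => kappa H r t * t ^ (m + 1)) r
  rw [mul_zero, mul_one] at e3
  have e4 : ∫ x in (0 : ℝ)..1, kappa H r (r * x) * (r * x) ^ (m + 1)
      = r ^ (H - 1 / 2) * r ^ (m + 1) * ∫ x in (0 : ℝ)..1, kappa H 1 x * x ^ (m + 1) := by
    rw [← intervalIntegral.integral_const_mul]
    simp_rw [intervalIntegral.integral_of_le zero_le_one, integral_Ioc_eq_integral_Ioo]
    refine setIntegral_congr_fun measurableSet_Ioo fun x hx => ?_
    rw [kappa_scale hr hx.1 hx.2]
    ring
  rw [e1, e2, ← e3, e4, momentConst, integral_rpow (Or.inl (by linarith)),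
    show (m : ℝ) + H + 1 / 2 + 1 = m + H + 3 / 2 by ring, Real.zero_rpow h1.ne', sub_zero]
  have e5 : r * (r ^ (H - 1 / 2) * r ^ (m + 1)) = r ^ ((m : ℝ) + H + 3 / 2) := by
    rw [show (m : ℝ) + H + 3 / 2 = 1 + ((H - 1 / 2) + ((m + 1 : ℕ) : ℝ)) by push_cast; ring,
      Real.rpow_add hr, Real.rpow_add hr, Real.rpow_one, Real.rpow_natCast]
  rw [← mul_assoc, e5]
  field_simp

lemma integrable_inner_mul_rpow {f : ℝ → X} (hf : Integrable f (leb T)) (x : X) {q : ℝ} (hq : 0 ≤ q) :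
    Integrable (fun t => ⟪f t, x⟫_ℝ * t ^ q) (leb T) := by
  have h2 : Integrable (fun t => ⟪f t, x⟫_ℝ) (leb T) := hf.inner_const (𝕜 := ℝ) x
  refine h2.mul_of_top_left (memLp_top_of_bound (by fun_prop) (T ^ q) ?_)
  refine ae_restrict_of_forall_mem measurableSet_Icc fun t ht => ?_
  rw [Real.norm_eq_abs, abs_of_nonneg (Real.rpow_nonneg ht.1 _)]
  exact_mod_cast Real.rpow_le_rpow ht.1 ht.2 hq

/-- `L¹` convergence suffices because `t^q` is bounded on `[0,T]` for `q ≥ 0`. This is why the test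
functions are `t^{m+1}`: with `t^m` the exponent `m + H - 1/2` could be negative. -/
lemma tendsto_integral_inner_mul_rpow {α : Type*} {l : Filter α} {F : α → ℝ → X} {f : ℝ → X}
    (hF : ∀ a, Integrable (F a) (leb T)) (hf : Integrable f (leb T))
    (h : Tendsto (fun a => eLpNorm (fun t => F a t - f t) 1 (leb T)) l (𝓝 0))
    (x : X) {q : ℝ} (hq : 0 ≤ q) :
    Tendsto (fun a => ∫ t, ⟪F a t, x⟫_ℝ * t ^ q ∂(leb T)) l (𝓝 (∫ t, ⟪f t, x⟫_ℝ * t ^ q ∂(leb T))) := by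
  refine tendsto_integral_of_L1 _ (integrable_inner_mul_rpow hf x hq).aestronglyMeasurable
    (Eventually.of_forall fun a => integrable_inner_mul_rpow (hF a) x hq) ?_
  have h2 : Tendsto (fun a => ENNReal.ofReal (‖x‖ * T ^ q) * eLpNorm (fun t => F a t - f t) 1 (leb T)) l
      (𝓝 (ENNReal.ofReal (‖x‖ * T ^ q) * 0)) :=
    ENNReal.Tendsto.const_mul h (Or.inr ENNReal.ofReal_ne_top)
  rw [mul_zero] at h2
  refine tendsto_of_tendsto_of_tendsto_of_le_of_le tendsto_const_nhds h2 (fun _ => zero_le) fun a => ?_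
  simp only [eLpNorm_one_eq_lintegral_enorm]
  rw [← lintegral_const_mul' _ _ ENNReal.ofReal_ne_top]
  refine lintegral_mono_ae ?_
  filter_upwards [ae_leb_mem T] with t ht
  rw [← sub_mul, ← inner_sub_left, ← ofReal_norm, ← ofReal_norm,
    ← ENNReal.ofReal_mul (by positivity)]
  refine ENNReal.ofReal_le_ofReal ?_
  rw [norm_mul]
  calc ‖⟪F a t - f t, x⟫_ℝ‖ * ‖t ^ q‖ ≤ (‖F a t - f t‖ * ‖x‖) * T ^ q := by
        refine mul_le_mul (norm_inner_le_norm _ _) ?_ (norm_nonneg _) (by positivity)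
        rw [Real.norm_eq_abs, abs_of_nonneg (Real.rpow_nonneg ht.1.le _)]
        exact_mod_cast Real.rpow_le_rpow ht.1.le ht.2.le hq
    _ = _ := by ring

variable {H : ℝ} [hH : Fact (0 < H ∧ H < 1 ∧ H ≠ 1 / 2)]

/-- The right side involves only `φ` as an `L¹` function, so it passes to limits of approximating
sequences although `K*` is not continuous in `L¹`. -/
lemma inner_kOp_powSmul (φ : Simple T X) (m : ℕ) (x : X) :
    ⟪kOp X T H φ, powSmul T m x⟫_ℝ
      = momentConst H m * ∫ t, ⟪φ.eval t, x⟫_ℝ * t ^ (m + H + 1 / 2) ∂(leb T) := by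
  have hH0 := hH.out.1
  have e1 : ∀ᵐ t ∂(leb T), ⟪kOp X T H φ t, x⟫_ℝ * t ^ (m + 1)
      = ∑ r ∈ φ.support, ⟪φ r, x⟫_ℝ * (kap H ((r : ℝ≥0) : ℝ) t * t ^ (m + 1)) := by
    filter_upwards [coeFn_kOp (H := H) φ] with t ht
    rw [ht, Simple.kFun, Finsupp.sum, sum_inner, Finset.sum_mul]
    refine Finset.sum_congr rfl fun r _ => ?_
    rw [real_inner_smul_left]; ring
  have e2 : ∀ t, ⟪φ.eval t, x⟫_ℝ * t ^ (m + H + 1 / 2)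
      = ∑ r ∈ φ.support, ⟪φ r, x⟫_ℝ * (ind ((r : ℝ≥0) : ℝ) t * t ^ (m + H + 1 / 2)) := by
    intro t
    rw [Simple.eval_eq, Finsupp.sum, sum_inner, Finset.sum_mul]
    refine Finset.sum_congr rfl fun r _ => ?_
    rw [real_inner_smul_left]; ring
  rw [inner_powSmul, integral_congr_ae e1, integral_finsetSum]
  · simp_rw [e2]
    rw [integral_finsetSum, Finset.mul_sum]
    · refine Finset.sum_congr rfl fun r _ => ?_
      rw [integral_const_mul, integral_const_mul,
        integral_kap_mul_pow hH0 (Simple.pos r) (Simple.le_T r)]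
      ring
    · intro r _
      have hi : Integrable (fun t => ind ((r : ℝ≥0) : ℝ) t) (leb T) :=
        Integrable.indicator (integrable_const 1) measurableSet_Ico
      have := integrable_inner_mul_rpow hi 1 (q := m + H + 1 / 2) (by positivity)
      refine Integrable.const_mul (this.congr (Eventually.of_forall fun t => ?_)) _
      simp
  · intro r _
    have hi : Integrable (kap H ((r : ℝ≥0) : ℝ)) (leb T) :=
      (memLp_kap (Simple.pos r) (Simple.le_T r)).integrable (by norm_num)
    have := integrable_inner_mul_rpow hi 1 (q := (m + 1 : ℕ)) (by positivity)
    refine Integrable.const_mul (this.congr (Eventually.of_forall fun t => ?_)) _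
    simp only [Real.rpow_natCast]
    simp

end

/-! ### The norm of `|M|` for `H > 1/2`. -/

section

variable {X : Type*} [NormedAddCommGroup X] {T : ℝ≥0} {H : ℝ}

lemma absMNormSq_congr {f g : ℝ → X} (h : f =ᵐ[leb T] g) : absMNormSq H T f = absMNormSq H T g := by
  unfold absMNormSq
  congr 1
  refine lintegral_congr_ae ?_
  filter_upwards [h] with s hs
  refine lintegral_congr_ae ?_
  filter_upwards [h] with t ht
  rw [hs, ht]

/-- The function `u ↦ ∫ᵤᵀ ‖f(v)‖ ∂κ/∂v(v,u) dv`. -/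
noncomputable def absK (H : ℝ) (T : ℝ≥0) (f : ℝ → X) (u : ℝ) : ℝ≥0∞ :=
  ∫⁻ v, ‖f v‖ₑ * dKerE H v u ∂(leb T)

lemma absK_congr {f g : ℝ → X} (h : f =ᵐ[leb T] g) : absK H T f = absK H T g := by
  ext u
  refine lintegral_congr_ae ?_
  filter_upwards [h] with s hs
  rw [hs]

/-- Exhibits the norm as the `L²` norm of a sublinear expression in `f` that dominates `‖K* f‖`
pointwise; both the triangle inequality and the bound on `K*` follow. -/
lemma absMNormSq_eq_lintegral (hH : 1 / 2 < H) (hH1 : H < 1) {f : ℝ → X}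
    (hf : AEStronglyMeasurable f (leb T)) : absMNormSq H T f = ∫⁻ u, absK H T f u ^ 2 := by
  rw [absMNormSq_congr hf.ae_eq_mk, absK_congr hf.ae_eq_mk, absMNormSq]
  have hm : Measurable fun v => ‖hf.mk f v‖ₑ := hf.stronglyMeasurable_mk.enorm
  rw [← lintegral_mul_dKerE hH hH1 ((ae_leb_mem T).mono fun s hs => hs.1) hm hm]
  simp_rw [pow_two]
  rfl

lemma absK_add_le {f g : ℝ → X} (hf : AEStronglyMeasurable f (leb T)) (u : ℝ) :
    absK H T (fun t => f t + g t) u ≤ absK H T f u + absK H T g u := by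
  have hm : Measurable fun v => dKerE H v u :=
    (measurable_dKerE H).comp (measurable_id.prodMk measurable_const)
  have hm' : AEMeasurable (fun v => ‖f v‖ₑ * dKerE H v u) (leb T) := hf.enorm.mul hm.aemeasurable
  rw [absK, absK, absK, ← lintegral_add_left' hm']
  refine lintegral_mono fun v => ?_
  rw [← add_mul]
  gcongr
  exact enorm_add_le _ _

lemma ennreal_mul_le (a b : ℝ≥0∞) : a * b ≤ a ^ 2 + b ^ 2 := by
  rcases le_total a b with h | h
  · exact le_add_left (by rw [pow_two]; gcongr)
  · exact le_add_right (by rw [pow_two]; gcongr)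

lemma ennreal_add_sq_le (a b : ℝ≥0∞) : (a + b) ^ 2 ≤ 4 * (a ^ 2 + b ^ 2) := by
  calc (a + b) ^ 2 = a ^ 2 + b ^ 2 + 2 * (a * b) := by ring
    _ ≤ a ^ 2 + b ^ 2 + 2 * (a ^ 2 + b ^ 2) := by gcongr; exact ennreal_mul_le a b
    _ = 3 * (a ^ 2 + b ^ 2) := by ring
    _ ≤ 4 * (a ^ 2 + b ^ 2) := by gcongr; norm_num

lemma absMNormSq_add_le (hH : 1 / 2 < H) (hH1 : H < 1) {f g : ℝ → X}
    (hf : AEStronglyMeasurable f (leb T)) (hg : AEStronglyMeasurable g (leb T)) :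
    absMNormSq H T (fun t => f t + g t) ≤ 4 * (absMNormSq H T f + absMNormSq H T g) := by
  rw [absMNormSq_eq_lintegral hH hH1 hf, absMNormSq_eq_lintegral hH hH1 hg,
    absMNormSq_eq_lintegral (f := fun t => f t + g t) hH hH1 (hf.add hg), ← lintegral_add_left', ← lintegral_const_mul' _ _ (by norm_num)]
  · refine lintegral_mono fun u => ?_
    exact (pow_le_pow_left' (absK_add_le hf u) 2).trans (ennreal_add_sq_le _ _)
  · rw [absK_congr hf.ae_eq_mk]
    refine (Measurable.pow_const ?_ 2).aemeasurable
    refine Measurable.lintegral_prod_left' (f := fun p : ℝ × ℝ => ‖hf.mk f p.1‖ₑ * dKerE H p.1 p.2) ?_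
    exact (hf.stronglyMeasurable_mk.enorm.comp measurable_fst).mul (measurable_dKerE H)

lemma absMNormSq_mono {Y : Type*} [NormedAddCommGroup Y] {f : ℝ → X}
    {g : ℝ → Y} {C : ℝ≥0} (h : ∀ t, ‖f t‖ₑ ≤ C * ‖g t‖ₑ) :
    absMNormSq H T f ≤ C ^ 2 * absMNormSq H T g := by
  unfold absMNormSq
  rw [mul_left_comm, ← lintegral_const_mul' ((C : ℝ≥0∞) ^ 2) _ (by finiteness)]
  gcongr with s
  rw [← lintegral_const_mul' ((C : ℝ≥0∞) ^ 2) _ (by finiteness)]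
  refine lintegral_mono fun t => ?_
  calc ‖f s‖ₑ * ‖f t‖ₑ * ENNReal.ofReal (|s - t| ^ (2 * H - 2))
      ≤ (C * ‖g s‖ₑ) * (C * ‖g t‖ₑ) * ENNReal.ofReal (|s - t| ^ (2 * H - 2)) :=
        mul_le_mul' (mul_le_mul' (h s) (h t)) le_rfl
    _ = _ := by ring

/-- On `[0,T]` one has `|s-t| ≤ T`, and the exponent `2H - 2` is negative, so the kernel is bounded
below. -/
lemma eLpNorm_one_sq_le (hH : 1 / 2 < H) (hH1 : H < 1) {f : ℝ → X}
    (hf : AEStronglyMeasurable f (leb T)) :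
    ENNReal.ofReal (H * (2 * H - 1) * (T : ℝ) ^ (2 * H - 2)) * eLpNorm f 1 (leb T) ^ 2
      ≤ absMNormSq H T f := by
  have h0 : 0 ≤ H * (2 * H - 1) := mul_nonneg (by linarith) (by linarith)
  rw [absMNormSq, ENNReal.ofReal_mul h0, mul_assoc]
  gcongr
  rw [eLpNorm_one_eq_lintegral_enorm, pow_two, ← lintegral_mul_const'' _ hf.enorm,
    ← lintegral_const_mul' _ _ ENNReal.ofReal_ne_top]
  refine lintegral_mono_ae ?_
  filter_upwards [ae_leb_mem T] with s hs
  rw [← lintegral_const_mul'' _ hf.enorm, ← lintegral_const_mul' _ _ ENNReal.ofReal_ne_top]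
  refine lintegral_mono_ae ?_
  have hne : ∀ᵐ t ∂(leb T), t ≠ s := compl_mem_ae_iff.2 (measure_singleton s)
  filter_upwards [ae_leb_mem T, hne] with t ht hts
  rw [mul_comm]
  refine mul_le_mul' le_rfl (ENNReal.ofReal_le_ofReal ?_)
  refine Real.rpow_le_rpow_of_nonpos (abs_pos.2 (sub_ne_zero.2 hts.symm)) ?_ (by linarith)
  rw [abs_le]
  constructor <;> linarith [hs.1, hs.2, ht.1, ht.2]

/-- A Schur test: `ab ≤ a² + b²`, the kernel is symmetric, and its integrals in one variable are
bounded. -/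
lemma absMNormSq_le_eLpNorm_two (hH : 1 / 2 < H) {f : ℝ → X} (hf : AEStronglyMeasurable f (leb T)) :
    absMNormSq H T f ≤ ENNReal.ofReal (H * (2 * H - 1)) *
      (2 * (ENNReal.ofReal (2 * (T : ℝ) ^ (2 * H - 1) / (2 * H - 1)) * eLpNorm f 2 (leb T) ^ 2)) := by
  have h1 : 0 < 2 * H - 1 := by linarith
  unfold absMNormSq
  gcongr
  have hk : Measurable fun p : ℝ × ℝ => ENNReal.ofReal (|p.1 - p.2| ^ (2 * H - 2)) := by fun_prop
  have e0 : eLpNorm f 2 (leb T) ^ 2 = ∫⁻ s, ‖f s‖ₑ ^ 2 ∂(leb T) := by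
    rw [eLpNorm_eq_lintegral_rpow_enorm_toReal (by norm_num) (by norm_num)]
    simp only [ENNReal.toReal_ofNat, ENNReal.rpow_ofNat]
    rw [← ENNReal.rpow_natCast, ← ENNReal.rpow_mul]
    norm_num
  have e1 : ∫⁻ s, ∫⁻ t, ‖f s‖ₑ ^ 2 * ENNReal.ofReal (|s - t| ^ (2 * H - 2)) ∂(leb T) ∂(leb T)
      ≤ ENNReal.ofReal (2 * (T : ℝ) ^ (2 * H - 1) / (2 * H - 1)) * eLpNorm f 2 (leb T) ^ 2 := by
    rw [e0, ← lintegral_const_mul' _ _ ENNReal.ofReal_ne_top]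
    refine lintegral_mono_ae ?_
    filter_upwards [ae_leb_mem T] with s hs
    rw [lintegral_const_mul _ (by fun_prop), mul_comm]
    gcongr
    rw [leb_eq, lintegral_abs_sub_rpow hH hs.1 hs.2]
    refine ENNReal.ofReal_le_ofReal ?_
    gcongr
    have a1 := Real.rpow_le_rpow hs.1.le hs.2.le h1.le
    have a2 := Real.rpow_le_rpow (z := 2 * H - 1) (sub_pos.2 hs.2).le (show T - s ≤ T by linarith [hs.1]) h1.le
    linarith
  have e2 : ∫⁻ s, ∫⁻ t, ‖f t‖ₑ ^ 2 * ENNReal.ofReal (|s - t| ^ (2 * H - 2)) ∂(leb T) ∂(leb T)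
      = ∫⁻ s, ∫⁻ t, ‖f s‖ₑ ^ 2 * ENNReal.ofReal (|s - t| ^ (2 * H - 2)) ∂(leb T) ∂(leb T) := by
    rw [lintegral_lintegral_swap]
    · simp_rw [abs_sub_comm]
    · exact ((hf.enorm.pow_const 2).comp_quasiMeasurePreserving
        Measure.quasiMeasurePreserving_snd).mul hk.aemeasurable
  calc ∫⁻ s, ∫⁻ t, ‖f s‖ₑ * ‖f t‖ₑ * ENNReal.ofReal (|s - t| ^ (2 * H - 2)) ∂(leb T) ∂(leb T)
      ≤ ∫⁻ s, ∫⁻ t, (‖f s‖ₑ ^ 2 * ENNReal.ofReal (|s - t| ^ (2 * H - 2)) +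
          ‖f t‖ₑ ^ 2 * ENNReal.ofReal (|s - t| ^ (2 * H - 2))) ∂(leb T) ∂(leb T) := by
        gcongr with s t
        rw [← add_mul]
        gcongr
        exact ennreal_mul_le _ _
    _ = ∫⁻ s, ∫⁻ t, ‖f s‖ₑ ^ 2 * ENNReal.ofReal (|s - t| ^ (2 * H - 2)) ∂(leb T) ∂(leb T) +
        ∫⁻ s, ∫⁻ t, ‖f t‖ₑ ^ 2 * ENNReal.ofReal (|s - t| ^ (2 * H - 2)) ∂(leb T) ∂(leb T) := by
        rw [← lintegral_add_left']
        · congr 1; ext s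
          rw [lintegral_add_left (by fun_prop)]
        · have : AEMeasurable (fun s => ‖f s‖ₑ ^ 2 *
              ∫⁻ t, ENNReal.ofReal (|s - t| ^ (2 * H - 2)) ∂(leb T)) (leb T) :=
            (hf.enorm.pow_const 2).mul (Measurable.lintegral_prod_right' hk).aemeasurable
          refine this.congr (Eventually.of_forall fun s => ?_)
          exact (lintegral_const_mul _ (by fun_prop)).symm
    _ ≤ _ := by
        rw [e2, ← two_mul]
        gcongr

/-- Dominated convergence on the product space: at each point the truncated integrand is eventually
zero. -/
lemma tendsto_absMNormSq_truncation {f : ℝ → X} (hf : StronglyMeasurable f)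
    (h : absMNormSq H T f < ∞) (h0 : 0 < H * (2 * H - 1)) :
    Tendsto (fun n : ℕ => absMNormSq H T ({t | (n : ℝ) < ‖f t‖}.indicator f)) atTop (𝓝 0) := by
  have hS : ∀ n : ℕ, MeasurableSet {t | (n : ℝ) < ‖f t‖} := fun n =>
    measurableSet_lt measurable_const hf.norm.measurable
  have hm : ∀ g : ℝ → X, StronglyMeasurable g → Measurable fun p : ℝ × ℝ =>
      ‖g p.1‖ₑ * ‖g p.2‖ₑ * ENNReal.ofReal (|p.1 - p.2| ^ (2 * H - 2)) := fun g hg =>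
    ((hg.enorm.comp measurable_fst).mul (hg.enorm.comp measurable_snd)).mul (by fun_prop)
  have e : ∀ g : ℝ → X, StronglyMeasurable g → absMNormSq H T g = ENNReal.ofReal (H * (2 * H - 1)) *
      ∫⁻ p, ‖g p.1‖ₑ * ‖g p.2‖ₑ * ENNReal.ofReal (|p.1 - p.2| ^ (2 * H - 2)) ∂((leb T).prod (leb T)) := by
    intro g hg
    rw [absMNormSq, lintegral_prod _ (hm g hg).aemeasurable]
  have hle : ∀ (n : ℕ) t, ‖{t | (n : ℝ) < ‖f t‖}.indicator f t‖ₑ ≤ ‖f t‖ₑ := fun n t =>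
    enorm_indicator_le_enorm_self _ _
  simp_rw [fun n : ℕ => e _ (hf.indicator (hS n))]
  rw [e _ hf] at h
  have hfin := (ENNReal.mul_lt_top_iff.1 h).elim (fun h => h.2) (fun h => h.elim
    (fun h => absurd h (ENNReal.ofReal_pos.2 h0).ne') (fun h => by rw [h]; exact ENNReal.zero_lt_top))
  have key := tendsto_lintegral_of_dominated_convergence (μ := (leb T).prod (leb T))
    (F := fun (n : ℕ) (p : ℝ × ℝ) => ‖{t | (n : ℝ) < ‖f t‖}.indicator f p.1‖ₑ *
      ‖{t | (n : ℝ) < ‖f t‖}.indicator f p.2‖ₑ * ENNReal.ofReal (|p.1 - p.2| ^ (2 * H - 2)))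
    (f := fun _ => 0) _ (fun n => hm _ (hf.indicator (hS n)))
    (fun n => Eventually.of_forall fun p => 
      mul_le_mul' (mul_le_mul' (hle n p.1) (hle n p.2)) le_rfl) hfin.ne
    (Eventually.of_forall fun p => by
      refine tendsto_const_nhds.congr' ?_
      obtain ⟨N, hN⟩ := exists_nat_ge ‖f p.1‖
      filter_upwards [eventually_ge_atTop N] with n hn
      have : p.1 ∉ {t | (n : ℝ) < ‖f t‖} := by
        simp only [Set.mem_ofPred_eq, not_lt]
        exact hN.trans (by exact_mod_cast hn)
      rw [Set.indicator_of_notMem this]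
      simp)
  have := ENNReal.Tendsto.const_mul (a := ENNReal.ofReal (H * (2 * H - 1))) key
    (Or.inr ENNReal.ofReal_ne_top)
  simpa using this

end

/-! ### Density of simple functions. -/

section

variable {X : Type*} [NormedAddCommGroup X] [InnerProductSpace ℝ X] {T : ℝ≥0} {H : ℝ}

/-- The primitive of `h` vanishes on `(0,T)`, and almost everywhere its derivative is `h`. -/
lemma ae_eq_zero_of_forall_integral_ind {h : ℝ → ℝ} (hi : Integrable h (leb T))
    (h0 : ∀ r : ℝ, 0 < r → r ≤ T → ∫ t, ind r t * h t ∂(leb T) = 0) : h =ᵐ[leb T] 0 := by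
  have hT : (0 : ℝ) ≤ T := T.2
  have hii : IntervalIntegrable h volume 0 T := by
    rw [intervalIntegrable_iff_integrableOn_Icc_of_le hT]
    exact hi
  have h1 := hii.ae_hasDerivAt_integral
  have hF : ∀ r ∈ Set.Ioo (0 : ℝ) T, ∫ t in (0 : ℝ)..r, h t = 0 := by
    intro r hr
    refine Eq.trans ?_ (h0 r hr.1 hr.2.le)
    rw [intervalIntegral.integral_of_le hr.1.le, integral_Ioc_eq_integral_Ioo,
      leb_eq]
    have : ∀ t ∈ Set.Ioo (0 : ℝ) T, ind r t * h t = (Set.Ioo 0 r).indicator h t := fun t ht0 => by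
      by_cases ht : t < r
      · rw [ind_of_lt ht0.1.le ht, Set.indicator_of_mem (Set.mem_Ioo.2 ⟨ht0.1, ht⟩), one_mul]
      · rw [ind_of_le (not_lt.1 ht), Set.indicator_of_notMem (fun h => ht h.2), zero_mul]
    rw [setIntegral_congr_fun measurableSet_Ioo this, setIntegral_indicator measurableSet_Ioo,
      Set.Ioo_inter_Ioo]
    simp [hr.2.le]
  filter_upwards [ae_restrict_of_ae h1, ae_leb_mem T] with x hx hxT
  have hd := hx (by rw [Set.uIcc_of_le hT]; exact ⟨hxT.1.le, hxT.2.le⟩) 0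
    (by rw [Set.uIcc_of_le hT]; exact ⟨le_rfl, hT⟩)
  have hd2 : HasDerivAt (fun x => ∫ t in (0 : ℝ)..x, h t) 0 x := by
    refine (hasDerivAt_const x (0 : ℝ)).congr_of_eventuallyEq ?_
    filter_upwards [isOpen_Ioo.mem_nhds hxT] with r hr using hF r hr
  exact hd.unique hd2

lemma ae_eq_zero_of_forall_inner_basis {ι : Type*} [Countable ι] (e : HilbertBasis ι ℝ X)
    {α : Type*} [MeasurableSpace α] {μ : Measure α} {f : α → X}
    (h : ∀ k, (fun t => ⟪f t, e k⟫_ℝ) =ᵐ[μ] 0) : f =ᵐ[μ] 0 := by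
  filter_upwards [ae_all_iff.2 h] with t ht
  refine e.repr.injective ?_
  ext k
  rw [e.repr_apply_apply, real_inner_comm, ht k]
  simp

/-- Simple functions as elements of `L²`. -/
noncomputable def evalL2 : Simple T X →ₗ[ℝ] Lp X 2 (leb T) where
  toFun φ := (φ.memLp_eval 2).toLp
  map_add' φ ψ := by
    rw [← MemLp.toLp_add]
    congr 1; ext t
    exact Simple.eval_add φ ψ t
  map_smul' c φ := by
    rw [RingHom.id_apply, ← MemLp.toLp_const_smul]
    congr 1; ext t
    exact Simple.eval_smul c φ t

/-- An element orthogonal to every `eₖ 1_{[0,r)}` has coordinates whose integrals over all `[0,r)`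
vanish. -/
lemma denseRange_evalL2 [CompleteSpace X] {ι : Type*} [Countable ι] (e : HilbertBasis ι ℝ X) :
    DenseRange (evalL2 : Simple T X →ₗ[ℝ] Lp X 2 (leb T)) := by
  have : (LinearMap.range (evalL2 : Simple T X →ₗ[ℝ] Lp X 2 (leb T))).topologicalClosure = ⊤ := by
    rw [Submodule.topologicalClosure_eq_top_iff, Submodule.eq_bot_iff]
    intro g hg
    refine Lp.eq_zero_iff_ae_eq_zero.2 (ae_eq_zero_of_forall_inner_basis e fun k => ?_)
    have hgi : Integrable g (leb T) := (Lp.memLp g).integrable (by norm_num)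
    refine ae_eq_zero_of_forall_integral_ind (hgi.inner_const (𝕜 := ℝ) (e k)) fun r hr hrT => ?_
    lift r to ℝ≥0 using hr.le
    let ρ : Set.Ioc (0 : ℝ≥0) T := ⟨r, by exact_mod_cast hr, by exact_mod_cast hrT⟩
    have := (Submodule.mem_orthogonal _ _).1 hg _ ⟨Finsupp.single ρ (e k), rfl⟩
    rw [L2.inner_def] at this
    rw [← this]
    refine integral_congr_ae ?_
    filter_upwards [(Simple.memLp_eval (T := T)
      (Finsupp.single ρ (e k)) 2).coeFn_toLp] with t ht
    have e1 : evalL2 (T := T) (Finsupp.single ρ (e k)) t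
      = ind r t • e k := by
      refine ht.trans ?_
      rw [Simple.eval_eq]
      exact Finsupp.sum_single_index (smul_zero _)
    rw [e1, real_inner_smul_left, real_inner_comm]
  rw [DenseRange, ← LinearMap.coe_range]
  exact Submodule.dense_iff_topologicalClosure_eq_top.2 this

lemma exists_simple_eLpNorm_sub_le [CompleteSpace X] {ι : Type*} [Countable ι]
    (e : HilbertBasis ι ℝ X) {f : ℝ → X} (hf : MemLp f 2 (leb T)) {ε : ℝ} (hε : 0 < ε) :
    ∃ φ : Simple T X, eLpNorm (fun t => φ.eval t - f t) 2 (leb T) ≤ ENNReal.ofReal ε := by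
  obtain ⟨φ, hφ⟩ := (denseRange_evalL2 (T := T) e).exists_dist_lt hf.toLp hε
  refine ⟨φ, ?_⟩
  rw [dist_comm, Lp.dist_def] at hφ
  have h1 : (⇑(evalL2 φ) - ⇑hf.toLp : ℝ → X) =ᵐ[leb T] fun t => φ.eval t - f t :=
    (MemLp.coeFn_toLp (φ.memLp_eval 2)).sub hf.coeFn_toLp
  rw [eLpNorm_congr_ae h1] at hφ
  have h2 : eLpNorm (fun t => φ.eval t - f t) 2 (leb T) ≠ ∞ := ((φ.memLp_eval 2).sub hf).2.ne
  rw [← ENNReal.ofReal_toReal h2]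
  exact ENNReal.ofReal_le_ofReal hφ.le

/-- Truncation leaves a bounded function, which lies in `L²`; there simple functions are dense, and
the `L²` norm controls that of `|M|`. -/
lemma exists_simple_absMNormSq_sub_le [CompleteSpace X] {ι : Type*} [Countable ι]
    (e : HilbertBasis ι ℝ X) (hH : 1 / 2 < H) (hH1 : H < 1) {f : ℝ → X}
    (hf : AEStronglyMeasurable f (leb T)) (h : absMNormSq H T f < ∞) {ε : ℝ≥0∞} (hε : 0 < ε) :
    ∃ φ : Simple T X, absMNormSq H T (fun t => φ.eval t - f t) ≤ ε := by
  have h0 : 0 < H * (2 * H - 1) := mul_pos (by linarith) (by linarith)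
  wlog hεt : ε ≠ ∞ generalizing ε
  · obtain ⟨φ, hφ⟩ := this zero_lt_one (by simp)
    exact ⟨φ, by rw [not_not.1 hεt]; exact le_top⟩
  set g := hf.mk f with hg
  have hgm : StronglyMeasurable g := hf.stronglyMeasurable_mk
  have hfg : f =ᵐ[leb T] g := hf.ae_eq_mk
  rw [absMNormSq_congr hfg] at h
  have hlim := tendsto_absMNormSq_truncation hgm h h0
  -- The quasi-triangle inequality has the factor `4`, and `4 (ε/8 + ε/8) = ε`.
  have hδ : 0 < ε / 8 := ENNReal.div_pos hε.ne' (by simp)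
  obtain ⟨n, hn⟩ := (hlim.eventually (gt_mem_nhds hδ)).exists
  set S := {t | (n : ℝ) < ‖g t‖} with hS
  have hSm : MeasurableSet S := measurableSet_lt measurable_const hgm.norm.measurable
  have hb : MemLp (Sᶜ.indicator g) 2 (leb T) := by
    refine MemLp.of_bound (hgm.indicator hSm.compl).aestronglyMeasurable n (Eventually.of_forall fun t => ?_)
    by_cases ht : t ∈ Sᶜ
    · rw [Set.indicator_of_mem ht]
      exact not_lt.1 ht
    · rw [Set.indicator_of_notMem ht]; simp
  set C := ENNReal.ofReal (H * (2 * H - 1)) *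
      (2 * (ENNReal.ofReal (2 * (T : ℝ) ^ (2 * H - 1) / (2 * H - 1)))) with hC
  have hCt : C ≠ ∞ := by finiteness
  have hlim2 : Tendsto (fun x : ℝ => C * ENNReal.ofReal x ^ 2) (𝓝[>] 0) (𝓝 0) := by
    have h1 : Tendsto (fun x : ℝ => ENNReal.ofReal x ^ 2) (𝓝[>] 0) (𝓝 0) := by
      have := ((ENNReal.continuous_pow 2).comp ENNReal.continuous_ofReal).tendsto 0
      simp only [Function.comp_def, ENNReal.ofReal_zero, ne_eq, OfNat.ofNat_ne_zero,
        not_false_eq_true, zero_pow] at this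
      exact this.mono_left nhdsWithin_le_nhds
    have := ENNReal.Tendsto.const_mul h1 (Or.inr hCt)
    simpa using this
  obtain ⟨δ, hδ1, hδ2⟩ := ((hlim2.eventually (gt_mem_nhds hδ)).and self_mem_nhdsWithin).exists
  obtain ⟨φ, hφ⟩ := exists_simple_eLpNorm_sub_le e hb hδ2
  refine ⟨φ, ?_⟩
  have e1 : (fun t => φ.eval t - f t) =ᵐ[leb T]
      fun t => (φ.eval t - Sᶜ.indicator g t) + (-S.indicator g t) := by
    filter_upwards [hfg] with t ht
    rw [ht]
    by_cases hts : t ∈ S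
    · rw [Set.indicator_of_mem hts, Set.indicator_of_notMem (fun h : t ∈ Sᶜ => h hts)]; abel
    · rw [Set.indicator_of_notMem hts, Set.indicator_of_mem (show t ∈ Sᶜ from hts)]; abel
  have hm1 : AEStronglyMeasurable (fun t => φ.eval t - Sᶜ.indicator g t) (leb T) :=
    φ.stronglyMeasurable_eval.aestronglyMeasurable.sub hb.1
  have hm2 : AEStronglyMeasurable (fun t => -S.indicator g t) (leb T) :=
    (hgm.indicator hSm).neg.aestronglyMeasurable
  have e2 : absMNormSq H T (fun t => -S.indicator g t) = absMNormSq H T (S.indicator g) := by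
    simp only [absMNormSq, enorm_neg]
  calc absMNormSq H T (fun t => φ.eval t - f t)
      ≤ 4 * (absMNormSq H T (fun t => φ.eval t - Sᶜ.indicator g t) +
        absMNormSq H T (fun t => -S.indicator g t)) := by
        rw [absMNormSq_congr e1]
        exact absMNormSq_add_le hH hH1 hm1 hm2
    _ ≤ 4 * (ε / 8 + ε / 8) := by
        rw [e2]
        gcongr
        refine (absMNormSq_le_eLpNorm_two hH hm1).trans ?_
        refine le_trans (le_of_eq ?_) ((mul_le_mul' (le_refl C) (pow_le_pow_left' hφ 2)).trans hδ1.le)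
        rw [hC]; ring
    _ = ε := by
        rw [← two_mul, ← mul_assoc]
        norm_num
        exact ENNReal.mul_div_cancel (by norm_num) (by norm_num)

end

/-! ### Approximating sequences and the space of integrands. -/

section

lemma eLpNorm_two_sq {α E : Type*} [MeasurableSpace α] {μ : Measure α} [NormedAddCommGroup E]
    (f : α → E) : eLpNorm f 2 μ ^ 2 = ∫⁻ s, ‖f s‖ₑ ^ 2 ∂μ := by
  rw [eLpNorm_eq_lintegral_rpow_enorm_toReal (by norm_num) (by norm_num)]
  simp only [ENNReal.toReal_ofNat, ENNReal.rpow_ofNat]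
  rw [← ENNReal.rpow_natCast, ← ENNReal.rpow_mul]
  norm_num

variable {X : Type*} [NormedAddCommGroup X] [InnerProductSpace ℝ X] {T : ℝ≥0}
  {H : ℝ} [hH : Fact (0 < H ∧ H < 1 ∧ H ≠ 1 / 2)]

lemma enorm_kStar_le_absK (h : 1 / 2 < H) (φ : Simple T X) {t : ℝ} (ht : t ∈ Set.Ioo (0 : ℝ) T) :
    ‖φ.kStar H t‖ₑ ≤ absK H T φ.eval t := by
  rw [Simple.kStar, if_pos h, intervalIntegral.integral_of_le ht.2.le, absK]
  refine (enorm_integral_le_lintegral_enorm _).trans ?_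
  have e : ∀ s ∈ Set.Ioc t T, ‖deriv (fun s' => kappa H s' t) s • φ.eval s‖ₑ
      = ‖φ.eval s‖ₑ * dKerE H s t := by
    intro s hs
    rw [(hasDerivAt_kappa hH.out.1 ht.1 hs.1).deriv, enorm_smul, mul_comm, dKerE_of_lt ht.1 hs.1,
      Real.enorm_eq_ofReal_abs, abs_mul, abs_of_pos (dKer_pos ht.1 hs.1)]
  rw [setLIntegral_congr_fun measurableSet_Ioc e]
  exact lintegral_mono_set (Set.Ioc_subset_Icc_self.trans (Set.Icc_subset_Icc_left ht.1.le))

lemma enorm_kOp_sq_le [CompleteSpace X] (h : 1 / 2 < H) (φ : Simple T X) :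
    ‖kOp X T H φ‖ₑ ^ 2 ≤ absMNormSq H T φ.eval := by
  rw [Lp.enorm_def, eLpNorm_two_sq,
    absMNormSq_eq_lintegral h hH.out.2.1 φ.stronglyMeasurable_eval.aestronglyMeasurable]
  refine le_trans (lintegral_mono_ae ?_) (setLIntegral_le_lintegral _ _)
  filter_upwards [ae_leb_mem T, Simple.kStar_ae_eq (H := H) φ] with t ht h1
  rw [← h1]
  exact pow_le_pow_left' (enorm_kStar_le_absK h φ ht) 2

lemma isApprox_of_gt {H : ℝ} {f : ℝ → X} {φ : ℕ → Simple T X} (h : 1 / 2 < H) : IsApprox H T f φ ↔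
    Tendsto (fun n => absMNormSq H T (fun t => (φ n).eval t - f t)) atTop (𝓝 0) := by
  rw [IsApprox, if_pos h]

/-- Since `K*` is isometric, being Cauchy in `M` is the same as convergence of the images in the
complete space `L²`. -/
lemma isApprox_of_lt {f : ℝ → X} {φ : ℕ → Simple T X} (h : ¬ 1 / 2 < H) : IsApprox H T f φ ↔
    CauchySeq (fun n => kOp X T H (φ n)) ∧
    Tendsto (fun n => eLpNorm (fun t => (φ n).eval t - f t) 2 (leb T)) atTop (𝓝 0) := by
  rw [IsApprox, if_neg h, cauchySeq_iff_tendsto_dist_atTop_0]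
  refine and_congr_left fun _ => ?_
  have e : ∀ p : ℕ × ℕ, (φ p.1 - φ p.2).innerM H (φ p.1 - φ p.2)
      = dist (kOp X T H (φ p.1)) (kOp X T H (φ p.2)) ^ 2 := fun p => by
    rw [← inner_kOp, map_sub, real_inner_self_eq_norm_sq, dist_eq_norm]
  simp_rw [e]
  constructor
  · intro h1
    have := (Real.continuous_sqrt.tendsto 0).comp h1
    simpa [Function.comp_def, Real.sqrt_sq dist_nonneg] using this
  · intro h1
    simpa using h1.pow 2

lemma tendsto_of_pow_two_tendsto {α : Type*} {l : Filter α} {u : α → ℝ≥0∞}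
    (h : Tendsto (fun a => u a ^ 2) l (𝓝 0)) : Tendsto u l (𝓝 0) := by
  have := (ENNReal.continuous_rpow_const (y := (1 / 2 : ℝ))).tendsto 0 |>.comp h
  simp only [Function.comp_def, one_div] at this
  rw [ENNReal.zero_rpow_of_pos (by norm_num)] at this
  refine this.congr fun a => ?_
  rw [← ENNReal.rpow_natCast, ← ENNReal.rpow_mul]
  norm_num

/-- Functions in the space of integrands are approximated in `L¹`. -/
lemma IsApprox.tendsto_eLpNorm_one {f : ℝ → X} {φ : ℕ → Simple T X} (h : IsApprox H T f φ)
    (hf : AEStronglyMeasurable f (leb T)) :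
    Tendsto (fun n => eLpNorm (fun t => (φ n).eval t - f t) 1 (leb T)) atTop (𝓝 0) := by
  have hm : ∀ n, AEStronglyMeasurable (fun t => (φ n).eval t - f t) (leb T) := fun n =>
    (φ n).stronglyMeasurable_eval.aestronglyMeasurable.sub hf
  by_cases h2 : 1 / 2 < H
  · rw [isApprox_of_gt h2] at h
    rcases eq_or_ne T 0 with hT | hT
    · have : leb T = 0 := by subst hT; simp
      simp [this]
    · have hT0 : (0 : ℝ) < T := lt_of_le_of_ne T.2 (fun h => hT (NNReal.coe_injective h.symm))
      refine tendsto_of_pow_two_tendsto ?_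
      set c := ENNReal.ofReal (H * (2 * H - 1) * (T : ℝ) ^ (2 * H - 2)) with hc
      have hc0 : c ≠ 0 := by
        have h3 : 0 < 2 * H - 1 := by linarith
        have h4 := hH.out.1
        rw [hc, ENNReal.ofReal_ne_zero_iff]; positivity
      have hlim : Tendsto (fun n => c⁻¹ * absMNormSq H T (fun t => (φ n).eval t - f t)) atTop (𝓝 0) := by
        simpa using ENNReal.Tendsto.const_mul h (Or.inr (ENNReal.inv_ne_top.2 hc0))
      refine tendsto_of_tendsto_of_tendsto_of_le_of_le tendsto_const_nhds hlim (fun _ => zero_le) fun n => ?_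
      have := eLpNorm_one_sq_le h2 hH.out.2.1 (hm n)
      calc _ = c⁻¹ * (c * eLpNorm (fun t => (φ n).eval t - f t) 1 (leb T) ^ 2) := by
            rw [← mul_assoc, ENNReal.inv_mul_cancel hc0 ENNReal.ofReal_ne_top, one_mul]
        _ ≤ _ := by gcongr
  · have h3 := ((isApprox_of_lt h2).1 h).2
    set c := (leb T Set.univ) ^ (1 / (1 : ℝ≥0∞).toReal - 1 / (2 : ℝ≥0∞).toReal)
    have hc : c ≠ ∞ := ENNReal.rpow_ne_top_of_nonneg (by norm_num) (measure_ne_top _ _)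
    have hlim : Tendsto (fun n => eLpNorm (fun t => (φ n).eval t - f t) 2 (leb T) * c) atTop (𝓝 0) := by
      simpa using ENNReal.Tendsto.mul_const h3 (Or.inr hc)
    exact tendsto_of_tendsto_of_tendsto_of_le_of_le tendsto_const_nhds hlim (fun _ => zero_le) fun n =>
      eLpNorm_le_eLpNorm_mul_rpow_measure_univ (by norm_num) (hm n)

/-- For `H > 1/2` the bound `enorm_kOp_sq_le` carries convergence in `|M|` over to the images. -/
lemma IsApprox.cauchySeq [CompleteSpace X] {f : ℝ → X} {φ : ℕ → Simple T X} (h : IsApprox H T f φ)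
    (hf : AEStronglyMeasurable f (leb T)) : CauchySeq (fun n => kOp X T H (φ n)) := by
  have hm : ∀ n, AEStronglyMeasurable (fun t => (φ n).eval t - f t) (leb T) := fun n =>
    (φ n).stronglyMeasurable_eval.aestronglyMeasurable.sub hf
  by_cases h2 : 1 / 2 < H
  · rw [isApprox_of_gt h2] at h
    have hn : ∀ m, absMNormSq H T (fun t => -((φ m).eval t - f t))
        = absMNormSq H T (fun t => (φ m).eval t - f t) := fun m => by simp only [absMNormSq, enorm_neg]
    have hlim : Tendsto (fun p : ℕ × ℕ => 4 * (absMNormSq H T (fun t => (φ p.1).eval t - f t)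
        + absMNormSq H T (fun t => (φ p.2).eval t - f t))) atTop (𝓝 0) := by
      rw [← prod_atTop_atTop_eq]
      have := ENNReal.Tendsto.const_mul (a := 4)
        ((h.comp (tendsto_fst (g := atTop (α := ℕ)))).add (h.comp (tendsto_snd (f := atTop (α := ℕ)))))
        (Or.inr (by norm_num))
      simpa using this
    have hlim2 : Tendsto (fun p : ℕ × ℕ => edist (kOp X T H (φ p.1)) (kOp X T H (φ p.2))) atTop (𝓝 0) := by
      refine tendsto_of_pow_two_tendsto (tendsto_of_tendsto_of_tendsto_of_le_of_le tendsto_const_nhds hlim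
        (fun _ => zero_le) fun p => ?_)
      dsimp only
      rw [edist_eq_enorm_sub, ← map_sub, ← hn p.2]
      refine (enorm_kOp_sq_le h2 _).trans (le_trans (le_of_eq ?_)
        (absMNormSq_add_le h2 hH.out.2.1 (hm p.1) (hm p.2).neg))
      congr 1; ext t
      rw [Simple.eval_sub]; abel
    rw [cauchySeq_iff_tendsto_dist_atTop_0]
    have := (ENNReal.tendsto_toReal ENNReal.zero_ne_top).comp hlim2
    simpa [Function.comp_def, edist_dist, ENNReal.toReal_ofReal dist_nonneg] using this
  · exact ((isApprox_of_lt h2).1 h).1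

lemma MemIntegrand.integrable {f : ℝ → X} (hf : MemIntegrand H T f) : Integrable f (leb T) := by
  by_cases h2 : 1 / 2 < H
  · have h3 := hf.2
    rw [if_pos h2] at h3
    rcases eq_or_ne T 0 with hT | hT
    · have : leb T = 0 := by subst hT; simp
      simp [this]
    · have hT0 : (0 : ℝ) < T := lt_of_le_of_ne T.2 (fun h => hT (NNReal.coe_injective h.symm))
      have := (eLpNorm_one_sq_le h2 hH.out.2.1 hf.1).trans_lt h3
      have h3 : 0 < 2 * H - 1 := by linarith
      have h4 := hH.out.1
      have h5 : 0 < H * (2 * H - 1) * (T : ℝ) ^ (2 * H - 2) := by positivity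
      have h6 := ENNReal.lt_top_of_mul_ne_top_right this.ne (by simpa using h5)
      rw [← memLp_one_iff_integrable]
      exact ⟨hf.1, by simpa using h6⟩
  · have h3 := hf.2
    rw [if_neg h2] at h3
    obtain ⟨φ, hφ⟩ := h3
    obtain ⟨n, hn⟩ := ((hφ.tendsto_eLpNorm_one hf.1).eventually (gt_mem_nhds one_pos)).exists
    have h4 : Integrable (fun t => (φ n).eval t - f t) (leb T) :=
      memLp_one_iff_integrable.1 ⟨(φ n).stronglyMeasurable_eval.aestronglyMeasurable.sub hf.1, hn.trans_le le_top⟩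
    have h5 := (memLp_one_iff_integrable.1 ((φ n).memLp_eval 1)).sub h4
    refine h5.congr (Eventually.of_forall fun t => ?_)
    simp

lemma MemIntegrand.exists_isApprox [CompleteSpace X] {ι : Type*} [Countable ι] (e : HilbertBasis ι ℝ X)
    {f : ℝ → X} (hf : MemIntegrand H T f) : ∃ φ, IsApprox H T f φ := by
  have h3 := hf.2
  by_cases h2 : 1 / 2 < H
  · rw [if_pos h2] at h3
    have : ∀ n : ℕ, ∃ φ : Simple T X, absMNormSq H T (fun t => φ.eval t - f t) ≤ ((n : ℝ≥0∞) + 1)⁻¹ := fun n =>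
      exists_simple_absMNormSq_sub_le e h2 hH.out.2.1 hf.1 h3 (ENNReal.inv_pos.2 (by finiteness))
    choose φ hφ using this
    refine ⟨φ, (isApprox_of_gt h2).2 ?_⟩
    refine tendsto_of_tendsto_of_tendsto_of_le_of_le tendsto_const_nhds ?_ (fun _ => zero_le) hφ
    have := (tendsto_add_atTop_iff_nat 1).2 ENNReal.tendsto_inv_nat_nhds_zero
    simpa using this
  · rwa [if_neg h2] at h3

lemma IsApprox.add {f g : ℝ → X} {φ ψ : ℕ → Simple T X} (h : IsApprox H T f φ) (h' : IsApprox H T g ψ)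
    (hf : AEStronglyMeasurable f (leb T)) (hg : AEStronglyMeasurable g (leb T)) :
    IsApprox H T (fun t => f t + g t) (fun n => φ n + ψ n) := by
  have hm : ∀ n, AEStronglyMeasurable (fun t => (φ n).eval t - f t) (leb T) := fun n =>
    (φ n).stronglyMeasurable_eval.aestronglyMeasurable.sub hf
  have hm' : ∀ n, AEStronglyMeasurable (fun t => (ψ n).eval t - g t) (leb T) := fun n =>
    (ψ n).stronglyMeasurable_eval.aestronglyMeasurable.sub hg
  have e : ∀ n, (fun t => (φ n + ψ n).eval t - (f t + g t))
      = fun t => ((φ n).eval t - f t) + ((ψ n).eval t - g t) := fun n => by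
    ext t; rw [Simple.eval_add]; abel
  by_cases h2 : 1 / 2 < H
  · rw [isApprox_of_gt h2] at h h' ⊢
    have hlim := ENNReal.Tendsto.const_mul (a := 4) (h.add h') (Or.inr (by norm_num))
    rw [add_zero, mul_zero] at hlim
    refine tendsto_of_tendsto_of_tendsto_of_le_of_le tendsto_const_nhds hlim (fun _ => zero_le) fun n => ?_
    simp only [e]
    exact absMNormSq_add_le h2 hH.out.2.1 (hm n) (hm' n)
  · rw [isApprox_of_lt h2] at h h' ⊢
    refine ⟨by simp only [map_add]; exact h.1.add h'.1, ?_⟩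
    have hlim := h.2.add h'.2
    rw [add_zero] at hlim
    refine tendsto_of_tendsto_of_tendsto_of_le_of_le tendsto_const_nhds hlim (fun _ => zero_le) fun n => ?_
    simp only [e]
    exact eLpNorm_add_le (hm n) (hm' n) (by norm_num)

lemma enorm_clm_le {Y : Type*} [NormedAddCommGroup Y] [InnerProductSpace ℝ Y] (L : X →L[ℝ] Y) (x : X) :
    ‖L x‖ₑ ≤ ‖L‖₊ * ‖x‖ₑ := by
  simp only [enorm_eq_nnnorm]
  exact_mod_cast L.le_opNNNorm x

lemma IsApprox.map {Y : Type*} [NormedAddCommGroup Y] [InnerProductSpace ℝ Y] (L : X →L[ℝ] Y) {f : ℝ → X}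
    {φ : ℕ → Simple T X} (h : IsApprox H T f φ) :
    IsApprox H T (fun t => L (f t)) (fun n => Simple.map L (φ n)) := by
  have e : ∀ n, (fun t => (Simple.map L (φ n)).eval t - L (f t))
      = fun t => L ((φ n).eval t - f t) := fun n => by
    ext t; rw [Simple.eval_map, map_sub]
  by_cases h2 : 1 / 2 < H
  · rw [isApprox_of_gt h2] at h ⊢
    have hlim := ENNReal.Tendsto.const_mul (a := (‖L‖₊ : ℝ≥0∞) ^ 2) h (Or.inr (by finiteness))
    rw [mul_zero] at hlim
    refine tendsto_of_tendsto_of_tendsto_of_le_of_le tendsto_const_nhds hlim (fun _ => zero_le) fun n => ?_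
    simp only [e]
    exact absMNormSq_mono fun t => enorm_clm_le L _
  · rw [isApprox_of_lt h2] at h ⊢
    constructor
    · have := (L.compLpL 2 (leb T)).uniformContinuous.comp_cauchySeq h.1
      simp only [kOp_map]; exact this
    · have hlim := ENNReal.Tendsto.const_mul (a := (‖L‖₊ : ℝ≥0∞)) h.2 (Or.inr (by finiteness))
      rw [mul_zero] at hlim
      refine tendsto_of_tendsto_of_tendsto_of_le_of_le tendsto_const_nhds hlim (fun _ => zero_le) fun n => ?_
      simp only [e]
      exact eLpNorm_le_nnreal_smul_eLpNorm_of_ae_le_mul (Eventually.of_forall fun t => L.le_opNNNorm _) 2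

lemma MemIntegrand.map {Y : Type*} [NormedAddCommGroup Y] [InnerProductSpace ℝ Y] (L : X →L[ℝ] Y) {f : ℝ → X}
    (hf : MemIntegrand H T f) : MemIntegrand H T (fun t => L (f t)) := by
  refine ⟨L.continuous.comp_aestronglyMeasurable hf.1, ?_⟩
  have h3 := hf.2
  split_ifs at h3 ⊢ with h2
  · exact (absMNormSq_mono fun t => enorm_clm_le L _).trans_lt (ENNReal.mul_lt_top (by finiteness) h3)
  · obtain ⟨φ, hφ⟩ := h3
    exact ⟨_, hφ.map L⟩

lemma MemIntegrand.add {f g : ℝ → X} (hf : MemIntegrand H T f) (hg : MemIntegrand H T g) :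
    MemIntegrand H T (fun t => f t + g t) := by
  refine ⟨hf.1.add hg.1, ?_⟩
  have h3 := hf.2
  have h4 := hg.2
  split_ifs at h3 h4 ⊢ with h2
  · exact (absMNormSq_add_le h2 hH.out.2.1 hf.1 hg.1).trans_lt
      (ENNReal.mul_lt_top (by finiteness) (ENNReal.add_lt_top.2 ⟨h3, h4⟩))
  · obtain ⟨φ, hφ⟩ := h3
    obtain ⟨ψ, hψ⟩ := h4
    exact ⟨_, hφ.add hψ hf.1 hg.1⟩

end

section

/-! ### The extension of `K*` to integrands. -/

section KStar

variable {X : Type*} [NormedAddCommGroup X] [InnerProductSpace ℝ X] {T : ℝ≥0}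
  {H : ℝ} [hH : Fact (0 < H ∧ H < 1 ∧ H ≠ 1 / 2)] {ι : Type*} [Countable ι]

lemma isKStar_iff [CompleteSpace X] {f : ℝ → X} {g : Lp X 2 (leb T)} : IsKStar H T f g ↔
    ∃ φ, IsApprox H T f φ ∧ Tendsto (fun n => kOp X T H (φ n)) atTop (𝓝 g) := by
  refine exists_congr fun φ => and_congr_right fun _ => ?_
  rw [Lp.tendsto_Lp_iff_tendsto_eLpNorm']
  refine tendsto_congr fun n => eLpNorm_congr_ae ?_
  filter_upwards [(φ n).kStar_ae_eq (H := H)] with t ht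
  rw [ht, Pi.sub_apply]

/-- The weak characterisation of `K* f`. -/
lemma IsApprox.inner_eq {f : ℝ → X} {φ : ℕ → Simple T X} {g : Lp X 2 (leb T)} (h : IsApprox H T f φ)
    (hf : Integrable f (leb T)) (hg : Tendsto (fun n => kOp X T H (φ n)) atTop (𝓝 g)) (m : ℕ) (x : X) :
    ⟪g, powSmul T m x⟫_ℝ = momentConst H m * ∫ t, ⟪f t, x⟫_ℝ * t ^ (m + H + 1 / 2) ∂(leb T) := by
  have h1 := hg.inner (𝕜 := ℝ) (tendsto_const_nhds (x := powSmul T m x))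
  simp only [inner_kOp_powSmul] at h1
  have h0 := hH.out.1
  exact tendsto_nhds_unique h1 ((tendsto_integral_inner_mul_rpow
    (fun n => memLp_one_iff_integrable.1 ((φ n).memLp_eval 1)) hf (h.tendsto_eLpNorm_one hf.1) x
    (by positivity)).const_mul _)

lemma ext_inner_powSmul (e : HilbertBasis ι ℝ X) {g g' : Lp X 2 (leb T)}
    (h : ∀ (m : ℕ) (x : X), ⟪g, powSmul T m x⟫_ℝ = ⟪g', powSmul T m x⟫_ℝ) : g = g' := by
  rw [← sub_eq_zero]
  refine eq_zero_of_forall_inner_powSmul e fun m x => ?_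
  rw [inner_sub_left, h, sub_self]

variable [CompleteSpace X]

/-- Two approximating sequences produce limits with the same moments, since these depend only on
`f`. For `H < 1/2` this says that the `M`-completion is faithfully represented by `L²` limits as far
as `K*` is concerned. -/
lemma existsUnique_isKStar (e : HilbertBasis ι ℝ X) {f : ℝ → X} (hf : MemIntegrand H T f) :
    ∃! g, IsKStar H T f g := by
  obtain ⟨φ, hφ⟩ := hf.exists_isApprox e
  obtain ⟨g, hg⟩ := cauchySeq_tendsto_of_complete (hφ.cauchySeq hf.1)
  refine ⟨g, isKStar_iff.2 ⟨φ, hφ, hg⟩, fun g' hg' => ?_⟩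
  obtain ⟨ψ, hψ, hg'⟩ := isKStar_iff.1 hg'
  refine ext_inner_powSmul e fun m x => ?_
  rw [hφ.inner_eq hf.integrable hg, hψ.inner_eq hf.integrable hg']

lemma isKStar_kStar (e : HilbertBasis ι ℝ X) {f : ℝ → X} (hf : MemIntegrand H T f) :
    IsKStar H T f (kStar H T f) :=
  Classical.epsilon_spec (existsUnique_isKStar e hf).exists

lemma IsApprox.tendsto_kOp (e : HilbertBasis ι ℝ X) {f : ℝ → X} {φ : ℕ → Simple T X}
    (h : IsApprox H T f φ) (hf : MemIntegrand H T f) :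
    Tendsto (fun n => kOp X T H (φ n)) atTop (𝓝 (kStar H T f)) := by
  obtain ⟨g, hg⟩ := cauchySeq_tendsto_of_complete (h.cauchySeq hf.1)
  rwa [(existsUnique_isKStar e hf).unique (isKStar_kStar e hf) (isKStar_iff.2 ⟨φ, h, hg⟩)]

lemma inner_kStar_powSmul (e : HilbertBasis ι ℝ X) {f : ℝ → X} (hf : MemIntegrand H T f) (m : ℕ) (x : X) :
    ⟪kStar H T f, powSmul T m x⟫_ℝ
      = momentConst H m * ∫ t, ⟪f t, x⟫_ℝ * t ^ (m + H + 1 / 2) ∂(leb T) := by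
  obtain ⟨φ, hφ⟩ := hf.exists_isApprox e
  exact hφ.inner_eq hf.integrable (hφ.tendsto_kOp e hf) m x

lemma kStar_add (e : HilbertBasis ι ℝ X) {f g : ℝ → X} (hf : MemIntegrand H T f) (hg : MemIntegrand H T g) :
    kStar H T (fun t => f t + g t) = kStar H T f + kStar H T g := by
  obtain ⟨φ, hφ⟩ := hf.exists_isApprox e
  obtain ⟨ψ, hψ⟩ := hg.exists_isApprox e
  refine tendsto_nhds_unique ((hφ.add hψ hf.1 hg.1).tendsto_kOp e (hf.add hg)) ?_
  simp only [map_add]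
  exact (hφ.tendsto_kOp e hf).add (hψ.tendsto_kOp e hg)

lemma kStar_map {Y : Type*} [NormedAddCommGroup Y] [InnerProductSpace ℝ Y] [CompleteSpace Y] {ι' : Type*}
    [Countable ι'] (e : HilbertBasis ι ℝ X) (e' : HilbertBasis ι' ℝ Y) (L : X →L[ℝ] Y)
    {f : ℝ → X} (hf : MemIntegrand H T f) :
    kStar H T (fun t => L (f t)) = L.compLp (kStar H T f) := by
  obtain ⟨φ, hφ⟩ := hf.exists_isApprox e
  refine tendsto_nhds_unique ((hφ.map L).tendsto_kOp e' (hf.map L)) ?_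
  simp only [kOp_map]
  exact ((L.compLpL 2 (leb T)).continuous.tendsto _).comp (hφ.tendsto_kOp e hf)

end KStar

/-! ### Extension of inner-product preserving correspondences. -/

section Isometry

variable {S E F : Type*} [AddCommGroup S] [Module ℝ S] [NormedAddCommGroup E] [InnerProductSpace ℝ E]
  [CompleteSpace E] [NormedAddCommGroup F] [InnerProductSpace ℝ F] [CompleteSpace F]

/-- If `⟪A φ, A ψ⟫ = ⟪B φ, B ψ⟫`, then `A φ ↦ B φ` extends to a partial isometry. -/
lemma exists_partial_isometry (A : S →ₗ[ℝ] E) (B : S →ₗ[ℝ] F)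
    (h : ∀ φ ψ, ⟪A φ, A ψ⟫_ℝ = ⟪B φ, B ψ⟫_ℝ) :
    ∃ J : E →L[ℝ] F, (∀ φ, J (A φ) = B φ) ∧
      (∀ x ∈ (LinearMap.range A).topologicalClosure, ∀ y ∈ (LinearMap.range A).topologicalClosure,
        ⟪J x, J y⟫_ℝ = ⟪x, y⟫_ℝ) ∧ ∀ x, J x ∈ closure (Set.range B) := by
  set K := (LinearMap.range A).topologicalClosure with hK
  have hAK : ∀ φ, A φ ∈ K := fun φ => Submodule.le_topologicalClosure _ ⟨φ, rfl⟩
  let A' : S →ₗ[ℝ] K := A.codRestrict K hAK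
  have hd : DenseRange A' := by
    intro x
    rw [Metric.mem_closure_range_iff]
    intro ε hε
    obtain ⟨y, ⟨φ, rfl⟩, hy⟩ := Metric.mem_closure_iff.1 (show (x : E) ∈ closure (LinearMap.range A : Set E) from x.2) ε hε
    exact ⟨φ, hy⟩
  have hn : ∀ φ, ‖B φ‖ = ‖A' φ‖ := fun φ => by
    have h1 : ‖A' φ‖ = ‖A φ‖ := rfl
    rw [h1, ← sq_eq_sq₀ (norm_nonneg _) (norm_nonneg _), ← real_inner_self_eq_norm_sq, ← real_inner_self_eq_norm_sq, h]
  let J₀ : K →L[ℝ] F := B.extendOfNorm A'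
  have hJ₀ : ∀ φ, J₀ (A' φ) = B φ := fun φ =>
    LinearMap.extendOfNorm_eq hd ⟨1, fun φ => by rw [hn, one_mul]⟩ φ
  have hcl : IsClosed (K : Set E) := Submodule.isClosed_topologicalClosure _
  have : CompleteSpace K := hcl.completeSpace_coe
  have hJK : ∀ x : K, J₀.comp K.orthogonalProjectionOnto (x : E) = J₀ x := fun x => by
    simp
  -- Precomposition with the projection extends the map by zero on the orthogonal complement, so
  -- every value stays in the closure of the range of `B`.
  refine ⟨J₀.comp K.orthogonalProjectionOnto, fun φ => (hJK (A' φ)).trans (hJ₀ φ), fun x hx y hy => ?_, fun x => ?_⟩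
  swap
  · refine hd.induction_on (p := fun y : K => J₀ y ∈ closure (Set.range B)) (K.orthogonalProjectionOnto x) ?_ fun φ => ?_
    · exact isClosed_closure.preimage J₀.continuous
    · rw [hJ₀]; exact subset_closure ⟨φ, rfl⟩
  rw [hJK ⟨x, hx⟩, hJK ⟨y, hy⟩]
  have key : ∀ x y : K, ⟪J₀ x, J₀ y⟫_ℝ = ⟪x, y⟫_ℝ := by
    intro x y
    refine hd.induction_on₂ (p := fun x y : K => ⟪J₀ x, J₀ y⟫_ℝ = ⟪x, y⟫_ℝ) ?_ (fun φ ψ => ?_) x y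
    · exact isClosed_eq (by fun_prop) (by fun_prop)
    · rw [hJ₀, hJ₀, ← h]; rfl
  exact key _ _

end Isometry

end

section

/-! ### Limits of centred Gaussian variables in `L²`. -/

section Gaussian

variable {Ω : Type*} [MeasurableSpace Ω] {P : Measure Ω} [IsProbabilityMeasure P]

lemma integral_norm_le_norm_L2 (f : Lp ℝ 2 P) : ∫ ω, ‖f ω‖ ∂P ≤ ‖f‖ := by
  rw [integral_norm_eq_lintegral_enorm (Lp.aestronglyMeasurable f), ← eLpNorm_one_eq_lintegral_enorm,
    Lp.norm_def]
  exact ENNReal.toReal_mono (Lp.eLpNorm_ne_top f)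
    (eLpNorm_le_eLpNorm_of_exponent_le (by norm_num) (Lp.aestronglyMeasurable f))

lemma integrable_cexp (t : ℝ) {f : Ω → ℝ} (hf : AEStronglyMeasurable f P) :
    Integrable (fun ω => Complex.exp (t * f ω * Complex.I)) P := by
  refine Integrable.of_bound (C := 1) ?_ (Eventually.of_forall fun ω => ?_)
  · exact Complex.continuous_exp.comp_aestronglyMeasurable
      (((Complex.continuous_ofReal.comp_aestronglyMeasurable hf).const_mul _).mul_const _)
  · rw [← Complex.ofReal_mul, Complex.norm_exp_ofReal_mul_I]

lemma norm_cexp_sub_cexp_le (x y : ℝ) :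
    ‖Complex.exp (x * Complex.I) - Complex.exp (y * Complex.I)‖ ≤ |x - y| := by
  have e : Complex.exp (x * Complex.I) - Complex.exp (y * Complex.I)
      = Complex.exp (y * Complex.I) * (Complex.exp (Complex.I * ((x - y : ℝ) : ℂ)) - 1) := by
    rw [mul_sub, ← Complex.exp_add, mul_one]
    congr 2; push_cast; ring
  rw [e, norm_mul, Complex.norm_exp_ofReal_mul_I, one_mul]
  exact Real.norm_exp_I_mul_ofReal_sub_one_le

lemma continuous_integral_cexp (t : ℝ) :
    Continuous fun f : Lp ℝ 2 P => ∫ ω, Complex.exp (t * f ω * Complex.I) ∂P := by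
  refine LipschitzWith.continuous (K := ‖t‖₊) (LipschitzWith.of_dist_le_mul fun f g => ?_)
  rw [dist_eq_norm, dist_eq_norm, ← integral_sub (integrable_cexp t (Lp.aestronglyMeasurable f))
    (integrable_cexp t (Lp.aestronglyMeasurable g))]
  calc _ ≤ ∫ ω, ‖t‖ * ‖(f - g) ω‖ ∂P := by
        refine norm_integral_le_of_norm_le (((Lp.memLp (f - g)).integrable (by norm_num)).norm.const_mul _) ?_
        filter_upwards [Lp.coeFn_sub f g] with ω hω
        rw [hω, Pi.sub_apply, ← Complex.ofReal_mul, ← Complex.ofReal_mul, ← norm_mul, mul_sub]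
        exact norm_cexp_sub_cexp_le _ _
    _ ≤ _ := by
        rw [integral_const_mul, coe_nnnorm]
        gcongr
        exact integral_norm_le_norm_L2 _

lemma continuous_integral_L2 : Continuous fun f : Lp ℝ 2 P => ∫ ω, f ω ∂P := by
  refine LipschitzWith.continuous (K := 1) (LipschitzWith.of_dist_le_mul fun f g => ?_)
  rw [dist_eq_norm, dist_eq_norm, ← integral_sub ((Lp.memLp f).integrable (by norm_num))
    ((Lp.memLp g).integrable (by norm_num)), NNReal.coe_one, one_mul]
  refine (norm_integral_le_integral_norm _).trans (le_trans (le_of_eq ?_) (integral_norm_le_norm_L2 (f - g)))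
  refine integral_congr_ae ?_
  filter_upwards [Lp.coeFn_sub f g] with ω hω
  rw [hω, Pi.sub_apply]

lemma integral_sq_eq_norm_sq {P : Measure Ω} (f : Lp ℝ 2 P) : ∫ ω, f ω ^ 2 ∂P = ‖f‖ ^ 2 := by
  rw [← real_inner_self_eq_norm_sq, L2.inner_def]
  refine integral_congr_ae (Eventually.of_forall fun ω => ?_)
  simp [pow_two]

/-- For a centred variable the variance is the squared `L²` norm, so both sides of the
characteristic function identity are continuous in `f`. -/
lemma hasGaussianLaw_iff_of_mean_zero {f : Lp ℝ 2 P} (h0 : ∫ ω, f ω ∂P = 0) : HasGaussianLaw f P ↔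
    ∀ t : ℝ, ∫ ω, Complex.exp (t * f ω * Complex.I) ∂P = Complex.exp (-((t ^ 2 * ‖f‖ ^ 2 / 2 : ℝ) : ℂ)) := by
  have hm : AEMeasurable f P := (Lp.aestronglyMeasurable f).aemeasurable
  rw [hasGaussianLaw_iff_charFun_map_eq hm]
  refine forall_congr' fun t => ?_
  have e1 : charFun (P.map f) t = ∫ ω, Complex.exp (t * f ω * Complex.I) ∂P := by
    rw [charFun_apply_real, integral_map hm (by fun_prop)]
  have e2 : ∫ ω, ⟪t, f ω⟫_ℝ ∂P = 0 := by
    simp only [RCLike.inner_apply, conj_trivial]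
    rw [integral_mul_const, h0, zero_mul]
  have e3 : Var[fun ω => ⟪t, f ω⟫_ℝ; P] = t ^ 2 * ‖f‖ ^ 2 := by
    rw [variance_of_integral_eq_zero (by fun_prop) e2, ← integral_sq_eq_norm_sq, ← integral_const_mul]
    refine integral_congr_ae (Eventually.of_forall fun ω => ?_)
    simp [mul_pow, mul_comm]
  rw [e1, e2, e3]
  norm_num [neg_div]

lemma isClosed_centered_gaussian :
    IsClosed {f : Lp ℝ 2 P | ∫ ω, f ω ∂P = 0 ∧ HasGaussianLaw f P} := by
  have e : {f : Lp ℝ 2 P | ∫ ω, f ω ∂P = 0 ∧ HasGaussianLaw f P}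
      = {f : Lp ℝ 2 P | ∫ ω, f ω ∂P = 0} ∩ ⋂ t : ℝ, {f : Lp ℝ 2 P |
        ∫ ω, Complex.exp (t * f ω * Complex.I) ∂P = Complex.exp (-((t ^ 2 * ‖f‖ ^ 2 / 2 : ℝ) : ℂ))} := by
    ext f
    simp only [Set.mem_ofPred_eq, Set.mem_inter_iff, Set.mem_iInter]
    exact and_congr_right fun h0 => hasGaussianLaw_iff_of_mean_zero h0
  rw [e]
  refine (isClosed_eq continuous_integral_L2 continuous_const).inter (isClosed_iInter fun t => ?_)
  exact isClosed_eq (continuous_integral_cexp t) (by fun_prop)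

end Gaussian

/-! ### Wiener integrals of simple functions. -/

section Wiener

variable {Ω : Type*} [MeasurableSpace Ω] {P : Measure Ω} {H : ℝ} {T : ℝ≥0}
  {b : ℝ≥0 → Ω → ℝ}

lemma IsStandardFBM.memLp (hb : IsStandardFBM H P b) (t : ℝ≥0) : MemLp (b t) 2 P :=
  (hb.gaussian.hasGaussianLaw_eval t).memLp_two

lemma Simple.wiener_eq {Ω : Type*} {b : ℝ≥0 → Ω → ℝ} (φ : Simple T ℝ) (ω : Ω) :
    φ.wiener b ω = ∑ r ∈ φ.support, (b r ω - b 0 ω) * φ r := rfl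

lemma IsStandardFBM.memLp_wiener (hb : IsStandardFBM H P b) (φ : Simple T ℝ) : MemLp (φ.wiener b) 2 P :=
  memLp_finsetSum _ fun r _ => ((hb.memLp r).sub (hb.memLp 0)).mul_const (φ r)

lemma IsStandardFBM.measurable_wiener (hb : IsStandardFBM H P b) (φ : Simple T ℝ) :
    Measurable (φ.wiener b) :=
  Finset.measurable_fun_sum _ fun r _ => ((hb.measurable r).sub (hb.measurable 0)).mul_const (φ r)

/-- The Wiener integral on simple functions as a linear map into `L²`. -/
noncomputable def IsStandardFBM.wienerL2 (hb : IsStandardFBM H P b) : Simple T ℝ →ₗ[ℝ] Lp ℝ 2 P where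
  toFun φ := (hb.memLp_wiener φ).toLp
  map_add' φ ψ := by
    rw [← MemLp.toLp_add]
    congr 1; ext t
    exact Finsupp.sum_add_index' (fun _ => smul_zero _) (fun _ _ _ => smul_add _ _ _)
  map_smul' c φ := by
    rw [RingHom.id_apply, ← MemLp.toLp_const_smul]
    congr 1; ext t
    simp only [Simple.wiener, Pi.smul_apply]
    rw [Finsupp.sum_smul_index' (fun _ => smul_zero _), Finsupp.smul_sum]
    exact Finsupp.sum_congr fun r _ => smul_comm _ _ _

lemma IsStandardFBM.coeFn_wienerL2 (hb : IsStandardFBM H P b) (φ : Simple T ℝ) :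
    hb.wienerL2 φ =ᵐ[P] φ.wiener b := (hb.memLp_wiener φ).coeFn_toLp

lemma IsStandardFBM.integral_wiener [IsProbabilityMeasure P] (hb : IsStandardFBM H P b) (φ : Simple T ℝ) :
    ∫ ω, φ.wiener b ω ∂P = 0 := by
  have hi : ∀ t, Integrable (b t) P := fun t => (hb.memLp t).integrable (by norm_num)
  simp only [Simple.wiener_eq]
  have hii : ∀ r : Set.Ioc (0 : ℝ≥0) T, Integrable (fun ω => (b r ω - b 0 ω) * φ r) P := fun r =>
    ((hi r).sub (hi 0)).mul_const _
  rw [integral_finsetSum _ fun r _ => hii r]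
  refine Finset.sum_eq_zero fun r _ => ?_
  rw [integral_mul_const, integral_sub (hi r) (hi 0), hb.mean, hb.mean, sub_zero, zero_mul]

lemma R_zero_right {s : ℝ} (hH0 : 0 < H) (hs : 0 ≤ s) : R H s 0 = 0 := by
  rw [R, Real.zero_rpow (by linarith), sub_zero, abs_of_nonneg hs]; ring

/-- The contributions of `b 0` drop out because `R` vanishes when one argument is `0`. -/
lemma IsStandardFBM.inner_wienerL2 (hb : IsStandardFBM H P b) (hH0 : 0 < H) (φ ψ : Simple T ℝ) :
    ⟪hb.wienerL2 φ, hb.wienerL2 ψ⟫_ℝ = φ.innerM H ψ := by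
  have hi : ∀ s t, Integrable (fun ω => b s ω * b t ω) P := fun s t => (hb.memLp s).integrable_mul (hb.memLp t)
  have e : ∀ᵐ ω ∂P, ⟪hb.wienerL2 φ ω, hb.wienerL2 ψ ω⟫_ℝ
      = ∑ r ∈ φ.support, ∑ s ∈ ψ.support, ⟪φ r, ψ s⟫_ℝ *
        (b r ω * b s ω - b r ω * b 0 ω - b 0 ω * b s ω + b 0 ω * b 0 ω) := by
    filter_upwards [hb.coeFn_wienerL2 φ, hb.coeFn_wienerL2 ψ] with ω h1 h2
    rw [h1, h2, Simple.wiener_eq, Simple.wiener_eq, sum_inner]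
    refine Finset.sum_congr rfl fun r _ => ?_
    rw [inner_sum]
    refine Finset.sum_congr rfl fun s _ => ?_
    simp; ring
  have i1 : ∀ r s, Integrable (fun ω => b r ω * b s ω - b r ω * b 0 ω) P := fun r s =>
    (hi r s).sub (hi r 0)
  have i2 : ∀ r s, Integrable (fun ω => b r ω * b s ω - b r ω * b 0 ω - b 0 ω * b s ω) P := fun r s =>
    (i1 r s).sub (hi 0 s)
  have hii : ∀ r s, Integrable (fun ω => b r ω * b s ω - b r ω * b 0 ω - b 0 ω * b s ω + b 0 ω * b 0 ω) P :=
    fun r s => (i2 r s).add (hi 0 0)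
  have hic : ∀ r s : Set.Ioc (0 : ℝ≥0) T, Integrable (fun ω =>
      ⟪φ r, ψ s⟫_ℝ * (b r ω * b s ω - b r ω * b 0 ω - b 0 ω * b s ω + b 0 ω * b 0 ω)) P := fun r s => (hii r s).const_mul _
  rw [L2.inner_def, integral_congr_ae e, integral_finsetSum _ fun r _ =>
    integrable_finsetSum _ fun s _ => hic r s]
  refine Finset.sum_congr rfl fun r _ => ?_
  rw [integral_finsetSum _ fun s _ => hic r s]
  refine Finset.sum_congr rfl fun s _ => ?_
  rw [integral_const_mul, integral_add (i2 r s) (hi 0 0),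
    integral_sub (i1 r s) (hi 0 s), integral_sub (hi r s) (hi r 0)]
  simp only [hb.covariance, NNReal.coe_zero]
  rw [R_zero_right hH0 (NNReal.coe_nonneg _), R_comm (H := H) 0, R_zero_right hH0 (NNReal.coe_nonneg _),
    R_zero_right hH0 le_rfl]
  ring

lemma IsStandardFBM.hasGaussianLaw_wiener (hb : IsStandardFBM H P b) (φ : Simple T ℝ) :
    HasGaussianLaw (φ.wiener b) P := by
  classical
  -- The index `none` carries time `0` with the coefficient `-∑ φ r`, so that a sum of increments
  -- becomes a linear combination of values of the process.
  let f : Option φ.support → ℝ≥0 := fun o => o.elim 0 (fun r => (r : Set.Ioc (0 : ℝ≥0) T))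
  let c : Option φ.support → ℝ := fun o => o.elim (-∑ r : φ.support, φ r) (fun r => φ r)
  have h1 := ((hb.gaussian.comp_right f).smul c).hasGaussianLaw_fun_sum (I := Finset.univ)
  refine h1.congr (Eventually.of_forall fun ω => ?_)
  rw [Simple.wiener_eq, ← Finset.sum_coe_sort]
  simp only [Fintype.sum_option, f, c, Option.elim, Function.comp_apply, smul_eq_mul, sub_mul,
    Finset.sum_sub_distrib, ← Finset.mul_sum]
  rw [Finset.sum_congr rfl fun (r : φ.support) _ => mul_comm (φ r) (b r ω)]
  ring

end Wiener

end

/-! ### The isometry from `L²([0,T];X)` to `L²(Ω)`. -/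

section

section KOp

variable {X : Type*} [NormedAddCommGroup X] [InnerProductSpace ℝ X] {T : ℝ≥0}
  {H : ℝ} [hH : Fact (0 < H ∧ H < 1 ∧ H ≠ 1 / 2)]

lemma inner_kOp_single (r s : Set.Ioc (0 : ℝ≥0) T) (x y : X) :
    ⟪kOp X T H (Finsupp.single r x), kOp X T H (Finsupp.single s y)⟫_ℝ
      = ⟪x, y⟫_ℝ * R H (r : ℝ≥0) (s : ℝ≥0) := by
  rw [inner_kOp, Simple.innerM]
  have h1 : ∀ (r' : Set.Ioc (0 : ℝ≥0) T) (x' : X),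
      (Finsupp.single s y).sum (fun s' y' => ⟪x', y'⟫_ℝ * R H (r' : ℝ≥0) (s' : ℝ≥0))
        = ⟪x', y⟫_ℝ * R H (r' : ℝ≥0) (s : ℝ≥0) := fun r' x' =>
    Finsupp.sum_single_index (by simp)
  simp only [h1]
  exact Finsupp.sum_single_index (by simp)

variable (H) in
/-- The map `x ↦ K* (x 1_{[0,r)})`. -/
noncomputable def kOpSingle (r : Set.Ioc (0 : ℝ≥0) T) : X →L[ℝ] Lp X 2 (leb T) :=
  (kOp X T H ∘ₗ Finsupp.lsingle r).mkContinuous (√(R H (r : ℝ≥0) (r : ℝ≥0))) fun x => by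
    refine (sq_le_sq₀ (norm_nonneg _) (by positivity)).1 ?_
    rw [mul_pow, Real.sq_sqrt (R_nonneg hH.out.1 (NNReal.coe_nonneg _) (NNReal.coe_nonneg _)),
      ← real_inner_self_eq_norm_sq, ← real_inner_self_eq_norm_sq]
    exact (inner_kOp_single r r x x).le.trans (mul_comm _ _).le

lemma kOpSingle_apply (r : Set.Ioc (0 : ℝ≥0) T) (x : X) :
    kOpSingle H r x = kOp X T H (Finsupp.single r x) := rfl

lemma kOp_eq_sum (φ : Simple T X) : kOp X T H φ = φ.sum fun r x => kOpSingle H r x := by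
  conv_lhs => rw [← Finsupp.sum_single φ]
  rw [map_finsuppSum]
  rfl

lemma Simple.map_single {Y : Type*} [NormedAddCommGroup Y] [InnerProductSpace ℝ Y] (L : X →L[ℝ] Y)
    (r : Set.Ioc (0 : ℝ≥0) T) (x : X) :
    Simple.map L (Finsupp.single r x) = Finsupp.single r (L x) := by
  rw [Simple.map, Finsupp.mapRange.linearMap_apply, Finsupp.mapRange_single]
  rfl

lemma inner_kOp_map_toSpanSingleton (x y : X) (φ ψ : Simple T ℝ) :
    ⟪kOp X T H (Simple.map (.toSpanSingleton ℝ x) φ), kOp X T H (Simple.map (.toSpanSingleton ℝ y) ψ)⟫_ℝ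
      = ⟪x, y⟫_ℝ * φ.innerM H ψ := by
  rw [inner_kOp, Simple.innerM, Simple.innerM, Simple.map, Simple.map, Finsupp.mapRange.linearMap_apply,
    Finsupp.mapRange.linearMap_apply, Finsupp.sum_mapRange_index (by simp), Finsupp.mul_sum]
  refine Finsupp.sum_congr fun r _ => ?_
  rw [Finsupp.sum_mapRange_index (by simp), Finsupp.mul_sum]
  refine Finsupp.sum_congr fun s _ => ?_
  simp [real_inner_smul_left, real_inner_smul_right]
  ring

end KOp

section Representation

variable {Ω : Type*} [MeasurableSpace Ω] {P : Measure Ω} [IsProbabilityMeasure P] {T : ℝ≥0}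
  {ι : Type*} {b : ι → ℝ≥0 → Ω → ℝ}

lemma iIndepFun_wiener {P : Measure Ω} (hi : iIndepFun (fun k ω (t : ℝ≥0) => b k t ω) P) (φ : ι → Simple T ℝ) :
    iIndepFun (fun k => (φ k).wiener (b k)) P := by
  refine hi.comp (fun k (p : ℝ≥0 → ℝ) => ∑ r ∈ (φ k).support, (p r - p 0) * φ k r) fun k => ?_
  fun_prop

variable {H : ℝ}

lemma inner_wienerL2_of_ne (hb : ∀ k, IsStandardFBM H P (b k))
    (hi : iIndepFun (fun k ω (t : ℝ≥0) => b k t ω) P) {k l : ι} (hkl : k ≠ l) (φ ψ : Simple T ℝ) :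
    ⟪(hb k).wienerL2 φ, (hb l).wienerL2 ψ⟫_ℝ = 0 := by
  classical
  -- A family of integrands that takes the value `φ` at `k` and `ψ` at `l`.
  have h1 := (iIndepFun_wiener hi (fun j => if j = k then φ else ψ)).indepFun hkl
  simp only [if_true, if_neg hkl.symm] at h1
  have h2 := h1.integral_fun_mul_eq_mul_integral ((hb k).measurable_wiener φ).aestronglyMeasurable
    ((hb l).measurable_wiener ψ).aestronglyMeasurable
  rw [(hb k).integral_wiener, zero_mul] at h2
  rw [L2.inner_def, ← h2]
  refine integral_congr_ae ?_
  filter_upwards [(hb k).coeFn_wienerL2 φ, (hb l).coeFn_wienerL2 ψ] with ω h3 h4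
  rw [h3, h4]
  simp [mul_comm]

/-- Finite sums of Wiener integrals of simple functions. -/
noncomputable def wienerSum (hb : ∀ k, IsStandardFBM H P (b k)) : (ι →₀ Simple T ℝ) →ₗ[ℝ] Lp ℝ 2 P :=
  Finsupp.lsum ℝ fun k => (hb k).wienerL2

lemma wienerSum_mem (hb : ∀ k, IsStandardFBM H P (b k))
    (hi : iIndepFun (fun k ω (t : ℝ≥0) => b k t ω) P) (φ : ι →₀ Simple T ℝ) :
    ∫ ω, wienerSum hb φ ω ∂P = 0 ∧ HasGaussianLaw (wienerSum hb φ) P := by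
  have e : wienerSum hb φ =ᵐ[P] fun ω => ∑ k : φ.support, (φ k).wiener (b k) ω := by
    have h1 : wienerSum hb φ = ∑ k ∈ φ.support, (hb k).wienerL2 (φ k) := rfl
    rw [h1]
    refine (Lp.coeFn_finsetSum _ _).trans ?_
    have h2 : ∀ᵐ ω ∂P, ∀ k ∈ φ.support, (hb k).wienerL2 (φ k) ω = (φ k).wiener (b k) ω :=
      (Filter.eventually_all_finset _).2 fun k _ => (hb k).coeFn_wienerL2 (φ k)
    filter_upwards [h2] with ω hω
    rw [Finset.sum_apply, Finset.sum_congr rfl hω]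
    exact (Finset.sum_coe_sort φ.support (fun k => (φ k).wiener (b k) ω)).symm
  constructor
  · rw [integral_congr_ae e, integral_finsetSum _ fun (k : φ.support) _ => ((hb k).memLp_wiener (φ k)).integrable (by norm_num)]
    exact Finset.sum_eq_zero fun k _ => (hb k).integral_wiener _
  · refine HasGaussianLaw.congr ?_ e.symm
    exact iIndepFun.hasGaussianLaw_fun_sum (fun k : φ.support => (hb k).hasGaussianLaw_wiener (φ k))
      ((iIndepFun_wiener hi φ).precomp Subtype.val_injective)

/-- `J` is the isometry `K* f ↦ ∑ₖ ∫ ⟪f, eₖ⟫ dbₖ`. -/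
structure IsWienerMap {X : Type*} [NormedAddCommGroup X] [InnerProductSpace ℝ X] (H : ℝ)
    [Fact (0 < H ∧ H < 1 ∧ H ≠ 1 / 2)] (e : HilbertBasis ι ℝ X) (b : ι → ℝ≥0 → Ω → ℝ)
    (J : Lp X 2 (leb T) →L[ℝ] Lp ℝ 2 P) : Prop where
  apply_map : ∀ (k : ι) (φ : Simple T ℝ),
    J (kOp X T H (Simple.map (.toSpanSingleton ℝ (e k)) φ)) =ᵐ[P] φ.wiener (b k)
  inner_map : ∀ x ∈ closure (Set.range (kOp X T H)), ∀ y ∈ closure (Set.range (kOp X T H)),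
    ⟪J x, J y⟫_ℝ = ⟪x, y⟫_ℝ
  mean_zero : ∀ x, ∫ ω, J x ω ∂P = 0
  hasGaussianLaw : ∀ x, HasGaussianLaw (J x) P

/-- Inner products of `K*(φ eₖ)` and `K*(ψ eₗ)` vanish for `k ≠ l` by orthonormality, those of the
Wiener integrals by independence and centring; for `k = l` both are the `M` inner product.
Gaussianity passes from finite sums to the closure. -/
lemma exists_isWienerMap {X : Type*} [NormedAddCommGroup X] [InnerProductSpace ℝ X] [CompleteSpace X]
    [Fact (0 < H ∧ H < 1 ∧ H ≠ 1 / 2)] (e : HilbertBasis ι ℝ X) (hb : ∀ k, IsStandardFBM H P (b k))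
    (hi : iIndepFun (fun k ω (t : ℝ≥0) => b k t ω) P) :
    ∃ J : Lp X 2 (leb T) →L[ℝ] Lp ℝ 2 P, IsWienerMap H e b J := by
  classical
  have hH := (inferInstance : Fact (0 < H ∧ H < 1 ∧ H ≠ 1 / 2))
  let A : (ι →₀ Simple T ℝ) →ₗ[ℝ] Lp X 2 (leb T) :=
    Finsupp.lsum ℝ fun k => kOp X T H ∘ₗ Simple.map (.toSpanSingleton ℝ (e k))
  have hAB : ∀ φ ψ, ⟪A φ, A ψ⟫_ℝ = ⟪wienerSum hb φ, wienerSum hb ψ⟫_ℝ := by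
    intro φ ψ
    simp only [A, wienerSum, Finsupp.lsum_apply, Finsupp.sum, sum_inner, inner_sum]
    refine Finset.sum_congr rfl fun k _ => Finset.sum_congr rfl fun l _ => ?_
    rw [LinearMap.comp_apply, LinearMap.comp_apply, inner_kOp_map_toSpanSingleton]
    rcases eq_or_ne k l with rfl | hkl
    · rw [(hb k).inner_wienerL2 hH.out.1, real_inner_self_eq_norm_sq, e.orthonormal.norm_eq_one]
      ring
    · rw [inner_wienerL2_of_ne hb hi hkl.symm, e.orthonormal.inner_eq_zero hkl.symm, zero_mul]
  obtain ⟨J, hJ1, hJ2, hJ3⟩ := exists_partial_isometry A (wienerSum hb) hAB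
  have hA : ∀ k φ, A (Finsupp.single k φ) = kOp X T H (Simple.map (.toSpanSingleton ℝ (e k)) φ) := fun k φ => by
    simp [A]
  have hmem : ∀ x, ∫ ω, J x ω ∂P = 0 ∧ HasGaussianLaw (J x) P := fun x =>
    closure_minimal (Set.range_subset_iff.2 fun φ => wienerSum_mem hb hi φ) isClosed_centered_gaussian (hJ3 x)
  -- Expanding the coefficients of a simple function in the basis shows that the finite sums over
  -- coordinates already have the full closed range of `K*`.
  have hcl : closure (Set.range (kOp X T H)) ⊆ (LinearMap.range A).topologicalClosure := by
    have hc : IsClosed ((LinearMap.range A).topologicalClosure : Set (Lp X 2 (leb T))) :=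
      Submodule.isClosed_topologicalClosure _
    refine closure_minimal (Set.range_subset_iff.2 fun φ => ?_) hc
    rw [kOp_eq_sum]
    refine Submodule.sum_mem _ fun r _ => ?_
    have hs := (e.hasSum_repr (φ r)).mapL (kOpSingle (T := T) H r)
    refine hc.mem_of_tendsto hs (Eventually.of_forall fun s => Submodule.sum_mem _ fun k _ => ?_)
    rw [map_smul]
    refine Submodule.smul_mem _ _ (Submodule.le_topologicalClosure _ ⟨Finsupp.single k (Finsupp.single r 1), ?_⟩)
    rw [hA, Simple.map_single, kOpSingle_apply]
    simp
  refine ⟨J, fun k φ => ?_, fun x hx y hy => hJ2 x (hcl hx) y (hcl hy), fun x => (hmem x).1, fun x => (hmem x).2⟩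
  rw [← hA, hJ1]
  have : wienerSum hb (Finsupp.single k φ) = (hb k).wienerL2 φ := by simp [wienerSum]
  rw [this]
  exact (hb k).coeFn_wienerL2 φ

end Representation

end

section

/-! ### Coordinate expansions and the series of Wiener integrals. -/

section Basis

variable {X : Type*} [NormedAddCommGroup X] [InnerProductSpace ℝ X] {ι : Type*}

/-- The projection `x ↦ ⟪eₖ, x⟫ eₖ`. -/
noncomputable def basisProj (e : HilbertBasis ι ℝ X) (k : ι) : X →L[ℝ] X :=
  (ContinuousLinearMap.toSpanSingleton ℝ (e k)).comp (innerSL ℝ (e k))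

lemma basisProj_apply (e : HilbertBasis ι ℝ X) (k : ι) (x : X) :
    basisProj e k x = ⟪e k, x⟫_ℝ • e k := rfl

lemma hasSum_basisProj (e : HilbertBasis ι ℝ X) (x : X) : HasSum (fun k => basisProj e k x) x := by
  simpa only [basisProj_apply, e.repr_apply_apply] using e.hasSum_repr x

lemma norm_sum_basisProj_le (e : HilbertBasis ι ℝ X) (s : Finset ι) (x : X) :
    ‖∑ k ∈ s, basisProj e k x‖ ≤ ‖x‖ := by
  refine (sq_le_sq₀ (norm_nonneg _) (norm_nonneg _)).1 ?_
  have h := e.orthonormal.sum_inner_products_le (x := x) (s := s)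
  refine le_trans (le_of_eq ?_) h
  simp only [basisProj_apply]
  rw [← real_inner_self_eq_norm_sq, e.orthonormal.inner_sum]
  simp [pow_two]

/-- Pointwise this is the basis expansion of `g t`; Bessel's inequality bounds the error by `2‖g
t‖`, so dominated convergence applies. -/
lemma hasSum_compLp_basisProj [Countable ι] (e : HilbertBasis ι ℝ X) {α : Type*} [MeasurableSpace α]
    {μ : Measure α} (g : Lp X 2 μ) : HasSum (fun k => (basisProj e k).compLp g) g := by
  rw [HasSum, Lp.tendsto_Lp_iff_tendsto_eLpNorm']
  refine tendsto_of_pow_two_tendsto ?_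
  have e1 : ∀ s : Finset ι, eLpNorm (⇑(∑ k ∈ s, (basisProj e k).compLp g) - ⇑g) 2 μ ^ 2
      = ∫⁻ t, ‖∑ k ∈ s, basisProj e k (g t) - g t‖ₑ ^ 2 ∂μ := by
    intro s
    rw [← eLpNorm_two_sq]
    congr 1
    refine eLpNorm_congr_ae ?_
    have h2 : ∀ᵐ ω ∂μ, ∀ k ∈ s, (basisProj e k).compLp g ω = basisProj e k (g ω) :=
      (Filter.eventually_all_finset _).2 fun k _ => (basisProj e k).coeFn_compLp g
    filter_upwards [h2, Lp.coeFn_finsetSum s fun k => (basisProj e k).compLp g] with ω h3 h4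
    rw [Pi.sub_apply, h4, Finset.sum_apply, Finset.sum_congr rfl h3]
  simp only [e1]
  have hg := Lp.aestronglyMeasurable g
  have hfin : ∫⁻ t, (2 * ‖g t‖ₑ) ^ 2 ∂μ ≠ ∞ := by
    simp_rw [mul_pow]
    rw [lintegral_const_mul' _ _ (by finiteness), ← eLpNorm_two_sq]
    exact ENNReal.mul_ne_top (by finiteness) (ENNReal.pow_ne_top (Lp.eLpNorm_ne_top g))
  have := tendsto_lintegral_filter_of_dominated_convergence' (μ := μ) (l := (atTop : Filter (Finset ι)))
    (F := fun s t => ‖∑ k ∈ s, basisProj e k (g t) - g t‖ₑ ^ 2) (f := fun _ => 0)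
    (fun t => (2 * ‖g t‖ₑ) ^ 2) ?_ ?_ hfin ?_
  · simpa using this
  · refine Eventually.of_forall fun s => AEMeasurable.pow_const (AEStronglyMeasurable.enorm ?_) 2
    refine AEStronglyMeasurable.sub ?_ hg
    exact Finset.aestronglyMeasurable_fun_sum s fun k _ => (basisProj e k).continuous.comp_aestronglyMeasurable hg
  · refine Eventually.of_forall fun s => Eventually.of_forall fun t => ?_
    refine pow_le_pow_left' ((enorm_sub_le).trans ?_) 2
    rw [two_mul]
    gcongr
    rw [enorm_le_iff_norm_le]
    exact norm_sum_basisProj_le e s _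
  · refine Eventually.of_forall fun t => ?_
    have h1 := (hasSum_basisProj e (g t)).sub_const (g t)
    rw [sub_self] at h1
    simpa using ENNReal.Tendsto.pow (n := 2) ((continuous_enorm.tendsto _).comp h1)

end Basis

section WienerIntegral

variable {Ω : Type*} [MeasurableSpace Ω] {P : Measure Ω} {T : ℝ≥0}
  {ι : Type*} [Countable ι] {b : ι → ℝ≥0 → Ω → ℝ} {H : ℝ} [hH : Fact (0 < H ∧ H < 1 ∧ H ≠ 1 / 2)]
  {X : Type*} [NormedAddCommGroup X] [InnerProductSpace ℝ X] [CompleteSpace X] {e : HilbertBasis ι ℝ X}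
  {J : Lp X 2 (leb T) →L[ℝ] Lp ℝ 2 P}

/-- Multiplying scalar approximations of `⟪eₖ, f⟫` by `eₖ` approximates the `k`-th projection of
`f`, and `K*` commutes with that projection. Existence and uniqueness of the scalar integral follow
together. -/
lemma IsWienerMap.isWienerIntegral_iff (hJ : IsWienerMap H e b J) {f : ℝ → X} (hf : MemIntegrand H T f)
    (k : ι) (ξ : Lp ℝ 2 P) : IsWienerIntegral H T P (b k) (fun t => ⟪e k, f t⟫_ℝ) ξ ↔
      ξ = J ((basisProj e k).compLp (kStar H T f)) := by
  have key : ∀ φ : ℕ → Simple T ℝ, IsApprox H T (fun t => ⟪e k, f t⟫_ℝ) φ →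
      Tendsto (fun n => J (kOp X T H (Simple.map (.toSpanSingleton ℝ (e k)) (φ n)))) atTop
        (𝓝 (J ((basisProj e k).compLp (kStar H T f)))) := by
    intro φ hφ
    rw [← kStar_map e e (basisProj e k) hf]
    exact (J.continuous.tendsto _).comp
      ((hφ.map (.toSpanSingleton ℝ (e k))).tendsto_kOp e (hf.map (basisProj e k)))
  have key2 : ∀ (φ : ℕ → Simple T ℝ) (η : Lp ℝ 2 P),
      Tendsto (fun n => J (kOp X T H (Simple.map (.toSpanSingleton ℝ (e k)) (φ n)))) atTop (𝓝 η) ↔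
      Tendsto (fun n => eLpNorm (fun ω => (φ n).wiener (b k) ω - η ω) 2 P) atTop (𝓝 0) := by
    intro φ η
    rw [Lp.tendsto_Lp_iff_tendsto_eLpNorm']
    refine tendsto_congr fun n => eLpNorm_congr_ae ?_
    filter_upwards [hJ.apply_map k (φ n)] with ω hω
    rw [Pi.sub_apply, hω]
  constructor
  · rintro ⟨φ, hφ, h⟩
    exact tendsto_nhds_unique ((key2 φ ξ).2 h) (key φ hφ)
  · rintro rfl
    obtain ⟨φ, hφ⟩ := hf.exists_isApprox e
    have hφ' : IsApprox H T (fun t => ⟪e k, f t⟫_ℝ) fun n => Simple.map (innerSL ℝ (e k)) (φ n) :=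
      hφ.map (innerSL ℝ (e k))
    exact ⟨_, hφ', (key2 _ _).1 (key _ hφ')⟩

lemma IsWienerMap.wienerIntegral_eq (hJ : IsWienerMap H e b J) {f : ℝ → X} (hf : MemIntegrand H T f)
    (k : ι) : wienerIntegral H T P (b k) (fun t => ⟪e k, f t⟫_ℝ)
      = J ((basisProj e k).compLp (kStar H T f)) :=
  (hJ.isWienerIntegral_iff hf k _).1 (Classical.epsilon_spec
    (p := IsWienerIntegral H T P (b k) (fun t => ⟪e k, f t⟫_ℝ)) ⟨_, (hJ.isWienerIntegral_iff hf k _).2 rfl⟩)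

lemma IsWienerMap.hasSum_wienerIntegral (hJ : IsWienerMap H e b J) {f : ℝ → X} (hf : MemIntegrand H T f) :
    HasSum (fun k => wienerIntegral H T P (b k) (fun t => ⟪e k, f t⟫_ℝ)) (J (kStar H T f)) := by
  simp only [hJ.wienerIntegral_eq hf]
  exact (hasSum_compLp_basisProj e (kStar H T f)).mapL J

lemma kStar_mem_closure (e : HilbertBasis ι ℝ X) {f : ℝ → X} (hf : MemIntegrand H T f) :
    kStar H T f ∈ closure (Set.range (kOp X T H)) := by
  obtain ⟨φ, hφ⟩ := hf.exists_isApprox e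
  exact mem_closure_of_tendsto (hφ.tendsto_kOp e hf) (Eventually.of_forall fun n => ⟨_, rfl⟩)

end WienerIntegral

/-! ### Continuous dependence of `K*` on parameters. -/

section ClosedGraph

variable {T : ℝ≥0} {ι : Type*} [Countable ι] {H : ℝ} [hH : Fact (0 < H ∧ H < 1 ∧ H ≠ 1 / 2)]
  {X : Type*} [NormedAddCommGroup X] [InnerProductSpace ℝ X] [CompleteSpace X]
  {W : Type*} [NormedAddCommGroup W] [NormedSpace ℝ W] [CompleteSpace W]

/-- `K*` depends continuously on a parameter on which the integrand depends linearly and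
pointwise continuously. -/
lemma exists_kStar_clm (e : HilbertBasis ι ℝ X) (F : W →ₗ[ℝ] (ℝ → X)) (hF : ∀ w, MemIntegrand H T (F w))
    (hc : ∀ t, Continuous fun w => F w t) :
    ∃ K : W →L[ℝ] Lp X 2 (leb T), ∀ w, K w = kStar H T (F w) := by
  have hL1 : ∀ w, MemLp (F w) 1 (leb T) := fun w => memLp_one_iff_integrable.2 (hF w).integrable
  let A : W →ₗ[ℝ] Lp X 1 (leb T) :=
    { toFun := fun w => (hL1 w).toLp
      map_add' := fun v w => by
        rw [← MemLp.toLp_add]; congr 1; exact map_add F v w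
      map_smul' := fun c w => by
        rw [RingHom.id_apply, ← MemLp.toLp_const_smul]; congr 1; exact map_smul F c w }
  have hA : Continuous A := by
    -- A subsequence converges almost everywhere, where pointwise continuity in `w` identifies the
    -- limit.
    refine A.continuous_of_seq_closed_graph fun u x y hu hy => ?_
    have h1 := tendstoInMeasure_of_tendsto_Lp hy
    obtain ⟨ns, hns, h2⟩ := h1.exists_seq_tendsto_ae
    refine Lp.ext ?_
    have h3 : ∀ᵐ t ∂(leb T), ∀ n, A (u n) t = F (u n) t := ae_all_iff.2 fun n => (hL1 (u n)).coeFn_toLp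
    filter_upwards [h2, h3, (hL1 x).coeFn_toLp] with t h4 h5 h6
    refine tendsto_nhds_unique h4 ?_
    have h7 : A x t = F x t := h6
    rw [h7]
    simp only [Function.comp_def, h5]
    exact ((hc t).tendsto x).comp (hu.comp hns.tendsto_atTop)
  let K : W →ₗ[ℝ] Lp X 2 (leb T) :=
    { toFun := fun w => kStar H T (F w)
      map_add' := fun v w => by
        rw [map_add]; exact kStar_add e (hF v) (hF w)
      map_smul' := fun c w => by
        rw [map_smul, RingHom.id_apply]
        have := kStar_map e e (c • ContinuousLinearMap.id ℝ X) (hF w)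
        refine this.trans ?_
        refine Lp.ext ?_
        filter_upwards [(c • ContinuousLinearMap.id ℝ X).coeFn_compLp (kStar H T (F w)),
          Lp.coeFn_smul c (kStar H T (F w))] with t h1 h2
        rw [h1, h2]; rfl }
  have hK : Continuous K := by
    -- The `L²` limit is identified by its moments, which converge by the continuity into `L¹` just
    -- obtained.
    refine K.continuous_of_seq_closed_graph fun u x y hu hy => ?_
    refine ext_inner_powSmul e fun m z => ?_
    have h1 : Tendsto (fun n => eLpNorm (fun t => F (u n) t - F x t) 1 (leb T)) atTop (𝓝 0) := by
      have := (Lp.tendsto_Lp_iff_tendsto_eLpNorm' _ _).1 ((hA.tendsto x).comp hu)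
      refine this.congr fun n => eLpNorm_congr_ae ?_
      filter_upwards [(hL1 (u n)).coeFn_toLp, (hL1 x).coeFn_toLp] with t h1 h2
      exact congrArg₂ (· - ·) h1 h2
    have h0 := hH.out.1
    have h2 := tendsto_integral_inner_mul_rpow (fun n => (hF (u n)).integrable) (hF x).integrable h1 z
      (q := m + H + 1 / 2) (by positivity)
    have h3 := (hy.inner (𝕜 := ℝ) (tendsto_const_nhds (x := powSmul T m z)))
    refine tendsto_nhds_unique h3 ?_
    have h4 : ∀ w, ⟪K w, powSmul T m z⟫_ℝ = momentConst H m * ∫ t, ⟪F w t, z⟫_ℝ * t ^ (m + H + 1 / 2) ∂(leb T) :=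
      fun w => inner_kStar_powSmul e (hF w) m z
    simp only [Function.comp_def, h4]
    exact h2.const_mul _
  exact ⟨⟨K, hK⟩, fun w => rfl⟩

end ClosedGraph

end

section

/-! ### The adjoint `i*` and the integrand `i* Ψ(·)* v*`. -/

section Adjoint

variable {X U V : Type*} [NormedAddCommGroup X] [InnerProductSpace ℝ X] [CompleteSpace X]
  [NormedAddCommGroup U] [NormedSpace ℝ U] [NormedAddCommGroup V] [NormedSpace ℝ V]

/-- The adjoint `i* : U* → X* = X`. -/
noncomputable def dualAdjoint (i : X →L[ℝ] U) : StrongDual ℝ U →ₗ[ℝ] X where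
  toFun u := (InnerProductSpace.toDual ℝ X).symm (u.comp i)
  map_add' u v := by rw [ContinuousLinearMap.add_comp, map_add]
  map_smul' c u := by rw [ContinuousLinearMap.smul_comp, map_smulₛₗ]; rfl

lemma inner_dualAdjoint (i : X →L[ℝ] U) (u : StrongDual ℝ U) (x : X) : ⟪x, dualAdjoint i u⟫_ℝ = u (i x) := by
  rw [real_inner_comm]
  exact InnerProductSpace.toDual_symm_apply

lemma pullback_eq (i : X →L[ℝ] U) (Ψ : ℝ → U →L[ℝ] V) (v : StrongDual ℝ V) (t : ℝ) :
    pullback i Ψ v t = dualAdjoint i (v.comp (Ψ t)) := rfl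

lemma inner_pullback (i : X →L[ℝ] U) (Ψ : ℝ → U →L[ℝ] V) (v : StrongDual ℝ V) (t : ℝ) (x : X) :
    ⟪x, pullback i Ψ v t⟫_ℝ = v (Ψ t (i x)) := inner_dualAdjoint i _ x

/-- The map `v ↦ i* Ψ(·)* v` as a linear map. -/
noncomputable def pullbackₗ (i : X →L[ℝ] U) (Ψ : ℝ → U →L[ℝ] V) : StrongDual ℝ V →ₗ[ℝ] (ℝ → X) where
  toFun v := pullback i Ψ v
  map_add' v w := by
    ext t
    simp only [pullback_eq, Pi.add_apply, ContinuousLinearMap.add_comp, map_add]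
  map_smul' c v := by
    ext t
    simp only [pullback_eq, Pi.smul_apply, ContinuousLinearMap.smul_comp, map_smul, RingHom.id_apply]

lemma continuous_pullback (i : X →L[ℝ] U) (Ψ : ℝ → U →L[ℝ] V) (t : ℝ) :
    Continuous fun v : StrongDual ℝ V => pullback i Ψ v t :=
  (InnerProductSpace.toDual ℝ X).symm.continuous.comp
    ((continuous_id.clm_comp continuous_const).clm_comp continuous_const)

end Adjoint

/-! ### Independence of the representation. -/

section Independence

variable {Ω : Type*} [MeasurableSpace Ω] {P : Measure Ω} {T : ℝ≥0} {H : ℝ}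
  [hH : Fact (0 < H ∧ H < 1 ∧ H ≠ 1 / 2)]
  {U V : Type*} [NormedAddCommGroup U] [NormedSpace ℝ U] [NormedAddCommGroup V] [NormedSpace ℝ V]
  {B : ℝ≥0 → CylRV U P}
  {X : Type*} [NormedAddCommGroup X] [InnerProductSpace ℝ X] [CompleteSpace X] {ι : Type*}
  {e : HilbertBasis ι ℝ X} {i : X →L[ℝ] U} {b : ι → ℝ≥0 → Ω → ℝ} {J : Lp X 2 (leb T) →L[ℝ] Lp ℝ 2 P}
  {X' : Type*} [NormedAddCommGroup X'] [InnerProductSpace ℝ X'] [CompleteSpace X'] {ι' : Type*}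
  {e' : HilbertBasis ι' ℝ X'} {i' : X' →L[ℝ] U} {b' : ι' → ℝ≥0 → Ω → ℝ}
  {J' : Lp X' 2 (leb T) →L[ℝ] Lp ℝ 2 P}

lemma IsWienerMap.kOpSingle_basis {X : Type*} [NormedAddCommGroup X] [InnerProductSpace ℝ X]
    {e : HilbertBasis ι ℝ X} {J : Lp X 2 (leb T) →L[ℝ] Lp ℝ 2 P} (hJ : IsWienerMap H e b J) (k : ι) (r : Set.Ioc (0 : ℝ≥0) T) :
    J (kOpSingle H r (e k)) =ᵐ[P] fun ω => b k r ω - b k 0 ω := by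
  have h := hJ.apply_map k (Finsupp.single r 1)
  rw [Simple.map_single, ContinuousLinearMap.toSpanSingleton_apply, one_smul] at h
  refine h.trans (Eventually.of_forall fun ω => ?_)
  have h1 : Simple.wiener (b k) (Finsupp.single r (1 : ℝ)) ω = (b k r ω - b k 0 ω) • (1 : ℝ) :=
    Finsupp.sum_single_index (smul_zero _)
  rw [h1, smul_eq_mul, mul_one]

/-- The increments of `B` in terms of the isometry belonging to a representation of `B`. -/
lemma IsSeriesRepresentation.kOpSingle_ae_eq (h : IsSeriesRepresentation H B e i b) (hJ : IsWienerMap H e b J)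
    (r : Set.Ioc (0 : ℝ≥0) T) (u : StrongDual ℝ U) :
    J (kOpSingle H r (dualAdjoint i u)) =ᵐ[P] fun ω => (B r).toLin u ω - (B 0).toLin u ω := by
  have hm : ∀ t, AEStronglyMeasurable ((B t).toLin u) P := fun t => AEEqFun.aestronglyMeasurable _
  have hbm : ∀ (s : Finset ι) t, AEStronglyMeasurable (fun ω => ∑ k ∈ s, u (i (e k)) * b k t ω) P := fun s t =>
    Finset.aestronglyMeasurable_fun_sum s fun k _ =>
      ((h.fbm k).measurable t).aestronglyMeasurable.const_mul _
  have h1 : HasSum (fun k => u (i (e k)) • J (kOpSingle H r (e k))) (J (kOpSingle H r (dualAdjoint i u))) := by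
    have := (e.hasSum_repr (dualAdjoint i u)).mapL (J.comp (kOpSingle (T := T) H r))
    simpa only [e.repr_apply_apply, inner_dualAdjoint, map_smul, ContinuousLinearMap.comp_apply] using this
  have h2 := (Lp.tendsto_Lp_iff_tendsto_eLpNorm' _ _).1 h1
  set x := J (kOpSingle H r (dualAdjoint i u))
  have h3 := (h2.add (h.series u r)).add (h.series u 0)
  rw [add_zero, add_zero] at h3
  -- Three errors for the same partial sum, in `L²([0,T];X)` transported by `J` and in the series of
  -- `B` at times `r` and `0`; all tend to zero along `s`.
  have h4 : ∀ s : Finset ι, eLpNorm (fun ω => x ω - ((B r).toLin u ω - (B 0).toLin u ω)) 2 P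
      ≤ eLpNorm (⇑(∑ k ∈ s, u (i (e k)) • J (kOpSingle H r (e k))) - ⇑x) 2 P
        + eLpNorm (fun ω => (∑ k ∈ s, u (i (e k)) * b k r ω) - (B r).toLin u ω) 2 P
        + eLpNorm (fun ω => (∑ k ∈ s, u (i (e k)) * b k 0 ω) - (B 0).toLin u ω) 2 P := by
    intro s
    set S := ∑ k ∈ s, u (i (e k)) • J (kOpSingle H r (e k)) with hS
    have h5 : ∀ᵐ ω ∂P, ∀ k ∈ s, (u (i (e k)) • J (kOpSingle H r (e k)) : Lp ℝ 2 P) ω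
        = u (i (e k)) * (b k r ω - b k 0 ω) := by
      refine (Filter.eventually_all_finset _).2 fun k _ => ?_
      filter_upwards [Lp.coeFn_smul (u (i (e k))) (J (kOpSingle H r (e k))), hJ.kOpSingle_basis k r] with ω h6 h7
      rw [h6, Pi.smul_apply, h7, smul_eq_mul]
    have h8 : (fun ω => x ω - ((B r).toLin u ω - (B 0).toLin u ω)) =ᵐ[P]
        (-(⇑S - ⇑x) + fun ω => (∑ k ∈ s, u (i (e k)) * b k r ω) - (B r).toLin u ω)
          - fun ω => (∑ k ∈ s, u (i (e k)) * b k 0 ω) - (B 0).toLin u ω := by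
      filter_upwards [h5, Lp.coeFn_finsetSum s fun k => u (i (e k)) • J (kOpSingle H r (e k))] with ω h9 h10
      simp only [Pi.sub_apply, Pi.add_apply, Pi.neg_apply]
      rw [hS, h10, Finset.sum_apply, Finset.sum_congr rfl h9]
      simp only [mul_sub, Finset.sum_sub_distrib]
      ring
    rw [eLpNorm_congr_ae h8]
    have m1 : AEStronglyMeasurable (-(⇑S - ⇑x)) P := ((Lp.aestronglyMeasurable S).sub (Lp.aestronglyMeasurable x)).neg
    have m2 := (hbm s r).sub (hm r)
    have m3 := (hbm s 0).sub (hm 0)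
    refine (eLpNorm_sub_le (m1.add m2) m3 (by norm_num)).trans (add_le_add_left ?_ _)
    refine (eLpNorm_add_le m1 m2 (by norm_num)).trans (le_of_eq ?_)
    rw [eLpNorm_neg]
    rfl
  have h5 : eLpNorm (fun ω => x ω - ((B r).toLin u ω - (B 0).toLin u ω)) 2 P = 0 :=
    le_antisymm (ge_of_tendsto' h3 h4) zero_le
  have m := (Lp.aestronglyMeasurable x).sub ((hm r).sub (hm 0))
  filter_upwards [(eLpNorm_eq_zero_iff (f := fun ω => x ω - ((B r).toLin u ω - (B 0).toLin u ω)) m (by norm_num)).1 h5] with ω hω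
  exact sub_eq_zero.1 hω

lemma IsSeriesRepresentation.kOpSingle_eq (h : IsSeriesRepresentation H B e i b) (hJ : IsWienerMap H e b J)
    (h' : IsSeriesRepresentation H B e' i' b') (hJ' : IsWienerMap H e' b' J')
    (r : Set.Ioc (0 : ℝ≥0) T) (u : StrongDual ℝ U) :
    J (kOpSingle H r (dualAdjoint i u)) = J' (kOpSingle H r (dualAdjoint i' u)) :=
  Lp.ext ((h.kOpSingle_ae_eq hJ r u).trans (h'.kOpSingle_ae_eq hJ' r u).symm)

/-- Both inner products, multiplied by `R(T,T)`, equal the covariance of the same increments of `B`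
over `[0,T]`; `T > 0` allows division by `R(T,T)`. -/
lemma IsSeriesRepresentation.inner_dualAdjoint_eq (hT : 0 < T) (h : IsSeriesRepresentation H B e i b)
    (hJ : IsWienerMap H e b J) (h' : IsSeriesRepresentation H B e' i' b') (hJ' : IsWienerMap H e' b' J')
    (u v : StrongDual ℝ U) :
    ⟪dualAdjoint i u, dualAdjoint i v⟫_ℝ = ⟪dualAdjoint i' u, dualAdjoint i' v⟫_ℝ := by
  let r : Set.Ioc (0 : ℝ≥0) T := ⟨T, hT, le_rfl⟩
  have hR : R H (r : ℝ≥0) (r : ℝ≥0) ≠ 0 := by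
    have h1 : (0 : ℝ) < (r : ℝ≥0) := hT
    have h2 := hH.out.1
    rw [R, sub_self, abs_zero, Real.zero_rpow (by positivity)]
    have h3 := Real.rpow_pos_of_pos h1 (2 * H)
    refine ne_of_gt ?_
    linarith
  have e1 := hJ.inner_map _ (subset_closure ⟨Finsupp.single r (dualAdjoint i u), rfl⟩)
    _ (subset_closure ⟨Finsupp.single r (dualAdjoint i v), rfl⟩)
  have e2 := hJ'.inner_map _ (subset_closure ⟨Finsupp.single r (dualAdjoint i' u), rfl⟩)
    _ (subset_closure ⟨Finsupp.single r (dualAdjoint i' v), rfl⟩)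
  rw [inner_kOp_single] at e1 e2
  refine mul_right_cancel₀ hR (e1.symm.trans (Eq.trans ?_ e2))
  exact congrArg₂ (fun x y : Lp ℝ 2 P => ⟪x, y⟫_ℝ) (h.kOpSingle_eq hJ h' hJ' r u) (h.kOpSingle_eq hJ h' hJ' r v)

variable [Countable ι] [Countable ι']

/-- The operator `L` extending `i*u ↦ i'*u` maps one integrand pointwise to the other. On simple
functions with values in the closed range of `i*`, the identity `J' K* L = J K*` is the equality of
increments of `B`; it passes to the limit. -/
lemma IsSeriesRepresentation.memI_and_eq (hT : 0 < T) (h : IsSeriesRepresentation H B e i b)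
    (hJ : IsWienerMap H e b J) (h' : IsSeriesRepresentation H B e' i' b') (hJ' : IsWienerMap H e' b' J')
    {Ψ : ℝ → U →L[ℝ] V} (hΨ : MemI H T i Ψ) :
    MemI H T i' Ψ ∧ ∀ v, J' (kStar H T (pullback i' Ψ v)) = J (kStar H T (pullback i Ψ v)) := by
  obtain ⟨L, hL, -, -⟩ := exists_partial_isometry (dualAdjoint i) (dualAdjoint i')
    (h.inner_dualAdjoint_eq hT hJ h' hJ')
  have hp : ∀ v, pullback i' Ψ v = fun t => L (pullback i Ψ v t) := fun v => by
    ext t; rw [pullback_eq, pullback_eq, hL]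
  refine ⟨fun v => by rw [hp]; exact (hΨ v).map L, fun v => ?_⟩
  set D := (LinearMap.range (dualAdjoint i)).topologicalClosure with hD
  have hDc : IsClosed (D : Set X) := Submodule.isClosed_topologicalClosure _
  have : CompleteSpace D := hDc.completeSpace_coe
  -- Approximating simple functions need not take values in `D`; projecting them repairs this and
  -- fixes the integrand, which does.
  let p : X →L[ℝ] X := D.starProjection
  have hpD : ∀ x, p x ∈ D := fun x => D.starProjection_apply_mem x
  have hpf : (fun t => p (pullback i Ψ v t)) = pullback i Ψ v := by
    ext t
    refine D.starProjection_eq_self_iff.2 ?_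
    rw [pullback_eq]
    exact Submodule.le_topologicalClosure _ ⟨_, rfl⟩
  have hsingle : ∀ (r : Set.Ioc (0 : ℝ≥0) T), ∀ x ∈ D, J' (kOpSingle H r (L x)) = J (kOpSingle H r x) := by
    intro r x hx
    have hcl : IsClosed {x | J' (kOpSingle H r (L x)) = J (kOpSingle H r x)} :=
      isClosed_eq (by fun_prop) (by fun_prop)
    refine closure_minimal (s := (LinearMap.range (dualAdjoint i) : Set X)) ?_ hcl hx
    rintro _ ⟨u, rfl⟩
    rw [Set.mem_ofPred_eq, hL]
    exact (h.kOpSingle_eq hJ h' hJ' r u).symm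
  have hsimple : ∀ φ : Simple T X, J' (kOp X' T H (Simple.map L (Simple.map p φ))) = J (kOp X T H (Simple.map p φ)) := by
    intro φ
    induction φ using Finsupp.induction_linear with
    | zero => simp
    | add φ ψ h1 h2 => simp only [map_add, h1, h2]
    | single r x =>
      rw [Simple.map_single, Simple.map_single]
      exact hsingle r _ (hpD x)
  obtain ⟨φ, hφ⟩ := (hΨ v).exists_isApprox e
  have hφ' := hφ.map p
  rw [hpf] at hφ'
  rw [hp]
  refine tendsto_nhds_unique ((J'.continuous.tendsto _).comp ((hφ'.map L).tendsto_kOp e' ((hΨ v).map L))) ?_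
  simp only [Function.comp_def, hsimple]
  exact (J.continuous.tendsto _).comp (hφ'.tendsto_kOp e (hΨ v))

end Independence

end

/-! ### The operator `Γ` as a transpose. -/

section

section Gamma

variable {E W : Type*} [NormedAddCommGroup E] [InnerProductSpace ℝ E]
  [NormedAddCommGroup W] [NormedSpace ℝ W]

/-- The operator `Γ : E → W*` with `⟨Γ f, w⟩ = ⟪K w, f⟫`. -/
noncomputable def gammaOf (K : W →L[ℝ] E) : E →L[ℝ] StrongDual ℝ W :=
  (LinearMap.mk₂ ℝ (fun (f : E) (w : W) => ⟪K w, f⟫_ℝ) (fun f g w => inner_add_right _ _ _)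
    (fun c f w => real_inner_smul_right _ _ _) (fun f v w => by rw [map_add, inner_add_left])
    (fun c f w => by rw [map_smul, real_inner_smul_left]; rfl)).mkContinuous₂ ‖K‖ fun f w => by
      refine (norm_inner_le_norm _ _).trans ?_
      calc ‖K w‖ * ‖f‖ ≤ (‖K‖ * ‖w‖) * ‖f‖ := by gcongr; exact K.le_opNorm w
        _ = _ := by ring

lemma gammaOf_apply (K : W →L[ℝ] E) (f : E) (w : W) : gammaOf K f w = ⟪K w, f⟫_ℝ := rfl

lemma adjointOnDual_gammaOf [CompleteSpace E] {V : Type*} [NormedAddCommGroup V] [NormedSpace ℝ V] (K : StrongDual ℝ V →L[ℝ] E)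
    (v : StrongDual ℝ V) : adjointOnDual (gammaOf K) v = K v := by
  refine ext_inner_right ℝ fun f => ?_
  exact InnerProductSpace.toDual_symm_apply

end Gamma

end

end CylFBM

theorem proposition5p3
    {Ω : Type*} [MeasurableSpace Ω] (P : Measure Ω) [IsProbabilityMeasure P]
    {U : Type*} [NormedAddCommGroup U] [NormedSpace ℝ U] [CompleteSpace U]
    [TopologicalSpace.SeparableSpace U]
    {V : Type*} [NormedAddCommGroup V] [NormedSpace ℝ V] [CompleteSpace V]
    [TopologicalSpace.SeparableSpace V]
    (H : ℝ) (hH0 : 0 < H) (hH1 : H < 1) (hH : H ≠ 1 / 2) (T : ℝ≥0) (hT : 0 < T)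
    (B : ℝ≥0 → CylFBM.CylRV U P) (hB : CylFBM.IsCylindricalFBM H B)
    {X : Type*} [NormedAddCommGroup X] [InnerProductSpace ℝ X] [CompleteSpace X]
    {ι : Type*} [Countable ι] (e : HilbertBasis ι ℝ X) (i : X →L[ℝ] U) (b : ι → ℝ≥0 → Ω → ℝ)
    (hrep : CylFBM.IsSeriesRepresentation H B e i b)
    (Ψ : ℝ → U →L[ℝ] V) (hΨ : CylFBM.MemI H T i Ψ) :
    -- the Wiener integrals and the operator `K*` are well defined on the integrands in question
    (∀ (v : StrongDual ℝ V) (k : ι),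
      CylFBM.MemIntegrand H T (fun t => v (Ψ t (i (e k)))) ∧
      ∃! ξ : Lp ℝ 2 P, CylFBM.IsWienerIntegral H T P (b k) (fun t => v (Ψ t (i (e k)))) ξ) ∧
    (∀ v : StrongDual ℝ V,
      ∃! g : Lp X 2 (CylFBM.leb T), CylFBM.IsKStar H T (CylFBM.pullback i Ψ v) g) ∧
    ∃ (Z : StrongDual ℝ V →L[ℝ] Lp ℝ 2 P)
      (Γ : Lp X 2 (CylFBM.leb T) →L[ℝ] StrongDual ℝ (StrongDual ℝ V)),
      -- the series converges in `L²` to `Z v`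
      (∀ v : StrongDual ℝ V, HasSum
        (fun k => CylFBM.wienerIntegral H T P (b k) (fun t => v (Ψ t (i (e k))))) (Z v)) ∧
      -- `Z` is a Gaussian cylindrical random variable with covariance operator `Γ Γ*`
      (CylFBM.CylRV.ofL2 Z).IsGaussian ∧
      CylFBM.IsGammaOperator H T i Ψ Γ ∧
      (CylFBM.CylRV.ofL2 Z).HasCovarianceOperator (Γ.comp (CylFBM.adjointOnDual Γ)) ∧
      -- any other representation of `B` leads to the same `Z`
      (∀ {X' : Type*} [NormedAddCommGroup X'] [InnerProductSpace ℝ X'] [CompleteSpace X']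
        {ι' : Type*} [Countable ι'] (e' : HilbertBasis ι' ℝ X') (i' : X' →L[ℝ] U)
        (b' : ι' → ℝ≥0 → Ω → ℝ), CylFBM.IsSeriesRepresentation H B e' i' b' →
        CylFBM.MemI H T i' Ψ ∧
        ∀ v : StrongDual ℝ V, HasSum
          (fun k => CylFBM.wienerIntegral H T P (b' k) (fun t => v (Ψ t (i' (e' k))))) (Z v)) := by

  have hHfact : Fact (0 < H ∧ H < 1 ∧ H ≠ 1 / 2) := ⟨hH0, hH1, hH⟩
  obtain ⟨J, hJ⟩ := CylFBM.exists_isWienerMap (T := T) e hrep.fbm hrep.indep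
  -- The scalar integrands of the series are the coordinates of `i* Ψ(·)* v*`, so the results on
  -- `X`-valued integrands apply.
  have hcoord : ∀ v k, (fun t => v (Ψ t (i (e k)))) = fun t => ⟪e k, CylFBM.pullback i Ψ v t⟫_ℝ :=
    fun v k => by ext t; rw [CylFBM.inner_pullback]
  obtain ⟨K, hK⟩ := CylFBM.exists_kStar_clm e (CylFBM.pullbackₗ i Ψ) hΨ (CylFBM.continuous_pullback i Ψ)
  replace hK : ∀ v, K v = CylFBM.kStar H T (CylFBM.pullback i Ψ v) := hK
  refine ⟨fun v k => ?_, fun v => CylFBM.existsUnique_isKStar e (hΨ v), J.comp K, CylFBM.gammaOf K,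
    fun v => ?_, fun v => hJ.hasGaussianLaw (K v), fun f v => ?_, ⟨fun v => Lp.memLp (J (K v)), fun u v => ?_⟩, ?_⟩
  · rw [hcoord]
    refine ⟨(hΨ v).map (innerSL ℝ (e k)), _, (hJ.isWienerIntegral_iff (hΨ v) k _).2 rfl, fun ξ hξ => ?_⟩
    exact (hJ.isWienerIntegral_iff (hΨ v) k ξ).1 hξ
  · simp only [hcoord]
    rw [ContinuousLinearMap.comp_apply, hK]
    exact hJ.hasSum_wienerIntegral (hΨ v)
  · rw [CylFBM.gammaOf_apply, hK, L2.inner_def]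
  · have h1 : ∫ ω, J (K u) ω * J (K v) ω ∂P = ⟪J (K v), J (K u)⟫_ℝ := by
      rw [L2.inner_def]; rfl
    have h2 : ∀ v, K v ∈ closure (Set.range (CylFBM.kOp X T H)) := fun v => by
      rw [hK]; exact CylFBM.kStar_mem_closure e (hΨ v)
    rw [ContinuousLinearMap.comp_apply, CylFBM.adjointOnDual_gammaOf, CylFBM.gammaOf_apply]
    -- `J` is isometric only on the closed range of `K*`, hence the membership `h2`; the product of
    -- the means vanishes.
    refine (hJ.inner_map _ (h2 v) _ (h2 u)).symm.trans (h1.symm.trans ?_)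
    have h3 : ∫ ω, (CylFBM.CylRV.ofL2 (J.comp K)).toLin u ω ∂P = 0 := hJ.mean_zero (K u)
    rw [h3, zero_mul, sub_zero]
    rfl
  · intro X' _ _ _ ι' _ e' i' b' hrep'
    obtain ⟨J', hJ'⟩ := CylFBM.exists_isWienerMap (T := T) e' hrep'.fbm hrep'.indep
    obtain ⟨hΨ', hJJ⟩ := hrep.memI_and_eq hT hJ hrep' hJ' hΨ
    refine ⟨hΨ', fun v => ?_⟩
    rw [ContinuousLinearMap.comp_apply, hK, ← hJJ]
    have hcoord' : ∀ k, (fun t => v (Ψ t (i' (e' k)))) = fun t => ⟪e' k, CylFBM.pullback i' Ψ v t⟫_ℝ :=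
      fun k => by ext t; rw [CylFBM.inner_pullback]
    simp only [hcoord']
    exact hJ'.hasSum_wienerIntegral (hΨ' v)
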